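/- Cauchy's Integral Formula. Write $d^2z$ for Lebesgue measure on $\mathbb C$, so that $\frac{d\bar z\wedge dz}{2\pi\sqrt{-1}}=\frac1\pi d^2z$. For a bounded open set $\Omega\subset\mathbb C$ and $U\in L^2(\Omega)$ let $$(I_\Omega(0)h)(z)=\frac1\pi\int_\Omega\begin{pmatrix}(z-w)^{-1}&0\\0&(\bar z-\bar w)^{-1}\end{pmatrix}h(w)\,d^2w,\qquad M_U=\begin{pmatrix}0&-\bar U\\U&0\end{pmatrix},$$ for $\mathbb C^2$-valued $h$ (identified with quaternion-valued functions). For every $1<p<2$ there is $\varepsilon>0$, depending only on $p$, such that the following holds for every bounded open $\Omega\subset\mathbb C$ and every $U\in L^2(\Omega)$ with $\|U\|_{L^2(\Omega)}<\varepsilon$ (so that, for a given potential in $L^2_{\rm loc}$, it applies on every sufficiently small open set). (1) $1+M_U\circ I_\Omega(0)$ is a bijection of $L^p(\Omega,\mathbb C^2)$, so that $I_\Omega(U)=I_\Omega(0)\circ(1+M_U\circ I_\Omega(0))^{-1}$ is defined on $L^p(\Omega,\mathbb C^2)$, and $I_\Omega(U)$ is an integral operator: there is a measurable $2\times2$-matrix-valued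 function $K_\Omega(U,\cdot,\cdot)$ on $\Omega\times\Omega$ with $$(I_\Omega(U)f)(z)=\frac1\pi\int_\Omega K_\Omega(U,z,w)f(w)\,d^2w$$ (absolutely convergent for almost every $z\in\Omega$) for all $f\in L^p(\Omega,\mathbb C^2)$. (2) Let $K_\Omega(U,\cdot,\cdot)$ be any such integral kernel, and let $\psi,\phi\in L^q_{\rm loc}(\Omega,\mathbb C^2)$ (each for some $q>2$) lie in the kernels, in the sense of distributions on $\Omega$, of $$\begin{pmatrix}\bar\partial&-\bar U\\U&\partial\end{pmatrix}\quad\text{and}\quad\begin{pmatrix}-\bar\partial&U\\-\bar U&-\partial\end{pmatrix}$$ respectively. Then, for almost every $z'\in\Omega$ (with $\psi$ written as a column and $\phi$ as a row vector), $$\psi(z')=\frac{-1}{2\pi\sqrt{-1}}\oint_\gamma K_\Omega(U,z',z)\begin{pmatrix}dz&0\\0&-d\bar z\end{pmatrix}\psi(z),\qquad \phi(z')=\frac{1}{2\pi\sqrt{-1}}\oint_\gamma\phi(z)\begin{pmatrix}dz&0\\0&-d\bar z\end{pmatrix}K_\Omega(U,z,z')$$ for every closed path $\gamma$ in $\Omega$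 (Lipschitz parametrized) that avoids $z'$, has winding number $1$ around $z'$ and has winding number $0$ around every point of $\mathbb C\setminus\Omega$. Since the integrands are defined only almost everywhere, the statement that the contour integral along $\gamma$ equals $L$ means that, for some $r>0$ and almost every $w$ with $|w|<r$, the line integral along the translated path $\gamma+w$ converges absolutely and equals $L$. Moreover, for almost every $z'\in\Omega$ and every smooth matrix-valued (in particular, every smooth quaternion-valued) function $f$ with compact support in $\Omega$ which equals $1$ near $z'$, with absolutely convergent integrals, $$\psi(z')=\frac{1}{2\pi\sqrt{-1}}\int_\Omega df\wedge K_\Omega(U,z',z)\begin{pmatrix}dz&0\\0&-d\bar z\end{pmatrix}\psi(z),\qquad \phi(z')=\frac{1}{2\pi\sqrt{-1}}\int_\Omega \phi(z)\begin{pmatrix}dz&0\\0&-d\bar z\end{pmatrix}K_\Omega(U,z,z')\wedge df.$$ -/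

import Mathlib

open MeasureTheory Set Filter Topology Matrix Complex
open scoped ENNReal ContDiff ComplexConjugate

noncomputable section

namespace QuaternionicCauchy

/-- The Wirtinger derivative `∂̄ g = (∂ₓ g + i ∂_y g) / 2`. -/
def dbar (g : ℂ → ℂ) (z : ℂ) : ℂ :=
  (fderiv ℝ g z 1 + I * fderiv ℝ g z I) / 2

/-- The Wirtinger derivative `∂ g = (∂ₓ g - i ∂_y g) / 2`. -/
def del (g : ℂ → ℂ) (z : ℂ) : ℂ :=
  (fderiv ℝ g z 1 - I * fderiv ℝ g z I) / 2

/-- Complex-valued test functions on `Ω`. -/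
structure IsTestFunction (Ω : Set ℂ) (g : ℂ → ℂ) : Prop where
  smooth : ContDiff ℝ ∞ g
  compact : HasCompactSupport g
  support : tsupport g ⊆ Ω

/-- The `ℂ²`-valued function `ψ` belongs to `L^q_loc(Ω)`. -/
def MemLpLoc (Ω : Set ℂ) (q : ℝ≥0∞) (ψ : ℂ → Fin 2 → ℂ) : Prop :=
  ∀ C : Set ℂ, IsCompact C → C ⊆ Ω → MemLp ψ q (volume.restrict C)

/-- `ψ` lies in the kernel of `(∂̄, -Ū; U, ∂)` on `Ω`: it is in `L^q_loc(Ω)` for some `q > 2`,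
and `∂̄ψ₁ - Ūψ₂ = 0`, `Uψ₁ + ∂ψ₂ = 0` in the sense of distributions. -/
def MemKernel (Ω : Set ℂ) (U : ℂ → ℂ) (ψ : ℂ → Fin 2 → ℂ) : Prop :=
  (∃ q : ℝ≥0∞, 2 < q ∧ MemLpLoc Ω q ψ) ∧
  ∀ g : ℂ → ℂ, IsTestFunction Ω g →
    ∫ z in Ω, (-(ψ z 0 * dbar g z) - conj (U z) * ψ z 1 * g z) = 0 ∧
    ∫ z in Ω, (U z * ψ z 0 * g z - ψ z 1 * del g z) = 0

/-- `φ` lies in the kernel of the transposed operator `(-∂̄, U; -Ū, -∂)` on `Ω`: it is in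
`L^q_loc(Ω)` for some `q > 2`, and `-∂̄φ₁ + Uφ₂ = 0`, `-Ūφ₁ - ∂φ₂ = 0` in the sense of
distributions. -/
def MemKernelTransposed (Ω : Set ℂ) (U : ℂ → ℂ) (φ : ℂ → Fin 2 → ℂ) : Prop :=
  (∃ q : ℝ≥0∞, 2 < q ∧ MemLpLoc Ω q φ) ∧
  ∀ g : ℂ → ℂ, IsTestFunction Ω g →
    ∫ z in Ω, (φ z 0 * dbar g z + U z * φ z 1 * g z) = 0 ∧
    ∫ z in Ω, (-(conj (U z) * φ z 0 * g z) + φ z 1 * del g z) = 0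

/-- The operator `I_Ω(0)`, with integral kernel `diag ((z-w)⁻¹, (z̄-w̄)⁻¹) dw̄∧dw / (2πi)`;
here `dw̄∧dw / (2πi)` is `1/π` times Lebesgue measure. -/
def freeInverse (Ω : Set ℂ) (h : ℂ → Fin 2 → ℂ) (z : ℂ) : Fin 2 → ℂ :=
  ![(Real.pi : ℂ)⁻¹ * ∫ w in Ω, (z - w)⁻¹ * h w 0,
    (Real.pi : ℂ)⁻¹ * ∫ w in Ω, (conj z - conj w)⁻¹ * h w 1]

/-- Multiplication by the matrix `(0, -Ū; U, 0)`. -/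
def potentialMul (U : ℂ → ℂ) (g : ℂ → Fin 2 → ℂ) (z : ℂ) : Fin 2 → ℂ :=
  !![0, -conj (U z); U z, 0] *ᵥ g z

/-- The operator `1 + (0, -Ū; U, 0) ∘ I_Ω(0)`. -/
def onePlus (Ω : Set ℂ) (U : ℂ → ℂ) (h : ℂ → Fin 2 → ℂ) (z : ℂ) : Fin 2 → ℂ :=
  h z + potentialMul U (freeInverse Ω h) z

/-- `1 + (0, -Ū; U, 0) ∘ I_Ω(0)` is a well-defined bijection of the space `L^p(Ω)`
(of functions modulo equality almost everywhere). -/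
structure OnePlusBijective (p : ℝ≥0∞) (Ω : Set ℂ) (U : ℂ → ℂ) : Prop where
  maps : ∀ h : ℂ → Fin 2 → ℂ, MemLp h p (volume.restrict Ω) →
    MemLp (onePlus Ω U h) p (volume.restrict Ω)
  injective : ∀ h h' : ℂ → Fin 2 → ℂ, MemLp h p (volume.restrict Ω) →
    MemLp h' p (volume.restrict Ω) →
    onePlus Ω U h =ᵐ[volume.restrict Ω] onePlus Ω U h' → h =ᵐ[volume.restrict Ω] h'
  surjective : ∀ f : ℂ → Fin 2 → ℂ, MemLp f p (volume.restrict Ω) →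
    ∃ h : ℂ → Fin 2 → ℂ, MemLp h p (volume.restrict Ω) ∧
      onePlus Ω U h =ᵐ[volume.restrict Ω] f

/-- The graph of `I_Ω(U) = I_Ω(0) ∘ (1 + (0, -Ū; U, 0) ∘ I_Ω(0))⁻¹` on `L^p(Ω)`:
`g = I_Ω(U) f`. -/
def IsInverseValue (p : ℝ≥0∞) (Ω : Set ℂ) (U : ℂ → ℂ) (f g : ℂ → Fin 2 → ℂ) : Prop :=
  ∃ h : ℂ → Fin 2 → ℂ, MemLp h p (volume.restrict Ω) ∧
    onePlus Ω U h =ᵐ[volume.restrict Ω] f ∧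
    freeInverse Ω h =ᵐ[volume.restrict Ω] g

/-- `K(z,w) dw̄∧dw / (2πi)` is the integral kernel of the operator `I_Ω(U)` on `L^p(Ω)`. -/
structure IsInverseKernel (p : ℝ≥0∞) (Ω : Set ℂ) (U : ℂ → ℂ)
    (K : ℂ → ℂ → Matrix (Fin 2) (Fin 2) ℂ) : Prop where
  measurable : ∀ i j : Fin 2, AEStronglyMeasurable (fun x : ℂ × ℂ => K x.1 x.2 i j)
    ((volume.restrict Ω).prod (volume.restrict Ω))
  apply : ∀ f g : ℂ → Fin 2 → ℂ, IsInverseValue p Ω U f g →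
    ∀ᵐ z ∂(volume.restrict Ω),
      Integrable (fun w => K z w *ᵥ f w) (volume.restrict Ω) ∧
      g z = (Real.pi : ℂ)⁻¹ • ∫ w in Ω, K z w *ᵥ f w

/-- The winding number of the closed path `γ : [0,1] → ℂ` around `z`. -/
def windingNumber (γ : ℝ → ℂ) (z : ℂ) : ℂ :=
  (2 * Real.pi * I)⁻¹ * ∫ s in (0 : ℝ)..1, deriv γ s / (γ s - z)

/-- `γ : [0,1] → Ω` is a closed (Lipschitz parametrized) path in `Ω` that surrounds `z'` once
anti-clockwise and does not surround any point outside `Ω`. -/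
structure SurroundsOnce (Ω : Set ℂ) (γ : ℝ → ℂ) (z' : ℂ) : Prop where
  lipschitz : ∃ C, LipschitzOnWith C γ (Icc 0 1)
  closed : γ 0 = γ 1
  mapsTo : MapsTo γ (Icc 0 1) Ω
  avoids : z' ∉ γ '' Icc 0 1
  winding_outside : ∀ z, z ∉ Ω → windingNumber γ z = 0
  winding_one : windingNumber γ z' = 1

/-- The contour integral along `γ` of the `ℂ²`-valued one-form `η` (where `η z v` is its value
at the point `z` on the tangent vector `v`) is `L`. As `η` is only defined almost everywhere, this
means that the line integral along almost every small translate `γ + w` exists and equals `L`. -/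
def HasContourIntegral (η : ℂ → ℂ → Fin 2 → ℂ) (γ : ℝ → ℂ) (L : Fin 2 → ℂ) : Prop :=
  ∃ r : ℝ, 0 < r ∧ ∀ᵐ w ∂(volume.restrict (Metric.ball (0 : ℂ) r)),
    IntervalIntegrable (fun s => η (γ s + w) (deriv γ s)) volume 0 1 ∧
    ∫ s in (0 : ℝ)..1, η (γ s + w) (deriv γ s) = L

/-- The one-form `z ↦ K(z',z) diag(dz, -dz̄) ψ(z)`. -/
def leftForm (K : ℂ → ℂ → Matrix (Fin 2) (Fin 2) ℂ) (ψ : ℂ → Fin 2 → ℂ) (z' : ℂ) :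
    ℂ → ℂ → Fin 2 → ℂ :=
  fun z v => K z' z *ᵥ (Matrix.diagonal ![v, -conj v] *ᵥ ψ z)

/-- The one-form `z ↦ φ(z) diag(dz, -dz̄) K(z,z')`, with `φ` as a row vector. -/
def rightForm (K : ℂ → ℂ → Matrix (Fin 2) (Fin 2) ℂ) (φ : ℂ → Fin 2 → ℂ) (z' : ℂ) :
    ℂ → ℂ → Fin 2 → ℂ :=
  fun z v => (φ z ᵥ* Matrix.diagonal ![v, -conj v]) ᵥ* K z z'

/-- A smooth matrix-valued function with compact support in `Ω` that is the identity matrix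
near `z'`. -/
structure IsCutoff (Ω : Set ℂ) (z' : ℂ) (f : ℂ → Matrix (Fin 2) (Fin 2) ℂ) : Prop where
  smooth : ∀ i j : Fin 2, ContDiff ℝ ∞ (fun z => f z i j)
  compact : HasCompactSupport f
  support : tsupport f ⊆ Ω
  eq_one : ∀ᶠ z in 𝓝 z', f z = 1

/-- The entrywise differential of a matrix-valued function. -/
def matrixD (f : ℂ → Matrix (Fin 2) (Fin 2) ℂ) (z v : ℂ) : Matrix (Fin 2) (Fin 2) ℂ :=
  Matrix.of fun i j => fderiv ℝ (fun x => f x i j) z v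

/-- The density of the two-form `df ∧ η` with respect to `dx ∧ dy`. -/
def dWedge (f : ℂ → Matrix (Fin 2) (Fin 2) ℂ) (η : ℂ → ℂ → Fin 2 → ℂ) (z : ℂ) : Fin 2 → ℂ :=
  matrixD f z 1 *ᵥ η z I - matrixD f z I *ᵥ η z 1

/-- The density of the two-form `η ∧ df` with respect to `dx ∧ dy`. -/
def wedgeD (η : ℂ → ℂ → Fin 2 → ℂ) (f : ℂ → Matrix (Fin 2) (Fin 2) ℂ) (z : ℂ) : Fin 2 → ℂ :=
  η z 1 ᵥ* matrixD f z I - η z I ᵥ* matrixD f z 1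

end QuaternionicCauchy

end

/-! Part (1) rests on two inequalities. The Hardy–Littlewood–Sobolev inequality says that the kernel
1/|z-w| maps L^p to L^q with 1/q = 1/p - 1/2, with a constant C that does not depend on Ω
(`exists_eLpNorm_rieszOn_le`). By Hölder, multiplication by U ∈ L² maps L^q back to L^p. Hence M_U ∘
I_Ω(0) is a contraction of L^p as soon as C‖U‖₂ < 1, and 1 + M_U ∘ I_Ω(0) is bijective. The same
geometric bound, applied to the positive kernels |U(v)|/|v-w|, makes the Neumann series of integral
kernels converge absolutely, and a telescoping sum identifies its sum as a kernel of I_Ω(U)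
(`IsRieszBound.isInverseKernel_solutionKernel`).

Any other kernel agrees with this one almost everywhere on Ω × Ω (`IsInverseKernel.ae_eq`), so
symmetries need only be checked on the Neumann series. There -K_U(w,z)ᵀ = K_Ū(z,w), and the
transposed equation for U is the original equation for Ū, so the formulas for φ follow from those
for ψ.

For part (2), multiply ψ by a test function g. The equation becomes (D + M_U)(gψ) = (∂̄g ψ₁, ∂g ψ₂)
with D = diag(∂̄, ∂), and the Cauchy–Pompeiu formula inverts D on compactly supported functions. So
gψ = I_Ω(U)(∂̄g ψ₁, ∂g ψ₂), once gψ is known to lie in L^q; a priori it lies only in L^s for some s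
> 2, and `SobolevExponents.memLp_of_eq_freeInverse` closes this gap. Written with the kernel, π
g(z')ψ(z') = ∫ K(z',z)(∂̄g ψ₁, ∂g ψ₂)(z) d²z for almost every z'. The null set depends on g, but
countably many g are dense in the C¹ topology, so one null set serves all of them
(`MemKernel.ae_reproducesAt`). The formula with a cutoff f is this identity for the entries of f.

For a contour γ, take for g the winding number of γ convolved with a bump χ. It is smooth, has
compact support in Ω, equals ∫χ at z', and its derivatives ∂̄g and ∂g are line integrals of χ(z - γ)
along γ. By Fubini the identity then says that the contour integrals along the translates γ + w,
averaged against χ(w), give the expected constant times ∫χ. As χ is arbitrary near 0, almost every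
small translate gives that constant (`IsClosedPath.ae_integral_translate`). -/

noncomputable section

namespace QuaternionicCauchy

/-! ### Radial integrals in the plane and the layer cake formula -/

theorem lintegral_comp_norm {g : ℝ → ℝ≥0∞} (hg : Measurable g) :
    ∫⁻ z : ℂ, g ‖z‖ = ENNReal.ofReal (2 * Real.pi) * ∫⁻ r in Ioi (0 : ℝ), ENNReal.ofReal r * g r := by
  rw [← Complex.lintegral_comp_polarCoord_symm, polarCoord_target,
    Measure.volume_eq_prod, ← Measure.prod_restrict, lintegral_prod]
  · have : ∀ r ∈ Ioi (0 : ℝ), (∫⁻ θ in Ioo (-Real.pi) Real.pi,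
        ENNReal.ofReal (r, θ).1 • g ‖Complex.polarCoord.symm (r, θ)‖) =
        ENNReal.ofReal (2 * Real.pi) * (ENNReal.ofReal r * g r) := by
      intro r hr
      simp only [Complex.norm_polarCoord_symm, abs_of_pos (mem_Ioi.1 hr), lintegral_const,
        Measure.restrict_apply MeasurableSet.univ, univ_inter, Real.volume_Ioo, smul_eq_mul]
      rw [mul_comm]
      congr 2
      ring
    rw [setLIntegral_congr_fun measurableSet_Ioi this, lintegral_const_mul]
    fun_prop
  · simp only [Complex.norm_polarCoord_symm, smul_eq_mul]
    fun_prop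

theorem enorm_inv_eq (z : ℂ) : ‖z⁻¹‖ₑ = ENNReal.ofReal (‖z‖⁻¹) := by
  rw [← ofReal_norm, norm_inv]

theorem lintegral_inv_ball (R : ℝ) :
    ∫⁻ z : ℂ, (if ‖z‖ < R then ‖z⁻¹‖ₑ else 0) = ENNReal.ofReal (2 * Real.pi * R) := by
  simp only [enorm_inv_eq]
  rw [lintegral_comp_norm (g := fun r => if r < R then ENNReal.ofReal r⁻¹ else 0)
    (Measurable.ite measurableSet_Iio (by fun_prop) measurable_const)]
  have : ∀ r ∈ Ioi (0 : ℝ), ENNReal.ofReal r * (if r < R then ENNReal.ofReal r⁻¹ else 0) =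
      (Iio R).indicator 1 r := by
    intro r hr
    by_cases h : r < R
    · simp [h, ← ENNReal.ofReal_mul (mem_Ioi.1 hr).le, mul_inv_cancel₀ (ne_of_gt (mem_Ioi.1 hr))]
    · simp [h]
  rw [setLIntegral_congr_fun measurableSet_Ioi this, lintegral_indicator_one measurableSet_Iio,
    Measure.restrict_apply measurableSet_Iio, inter_comm, Ioi_inter_Iio, Real.volume_Ioo,
    ← ENNReal.ofReal_mul (by positivity), sub_zero]

/-- In polar coordinates the integrand is r^(1-s) on (R, ∞), which is integrable at infinity exactly
because s > 2. -/
theorem lintegral_inv_rpow_compl_ball {R s : ℝ} (hR : 0 < R) (hs : 2 < s) :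
    ∫⁻ z : ℂ, (if R ≤ ‖z‖ then ‖z⁻¹‖ₑ else 0) ^ s =
      ENNReal.ofReal (2 * Real.pi / (s - 2) * R ^ (2 - s)) := by
  have h0 : ∀ z : ℂ, (if R ≤ ‖z‖ then ‖z⁻¹‖ₑ else 0) ^ s =
      (Ici R).indicator (fun r => ENNReal.ofReal (r ^ (-s))) ‖z‖ := by
    intro z
    by_cases h : R ≤ ‖z‖
    · have hz : 0 < ‖z‖ := hR.trans_le h
      simp only [h, if_true, mem_Ici, indicator_of_mem, enorm_inv_eq]
      rw [ENNReal.ofReal_rpow_of_pos (inv_pos.2 hz), Real.inv_rpow hz.le, Real.rpow_neg hz.le]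
    · simp only [h, if_false, mem_Ici, not_false_eq_true, indicator_of_notMem]
      exact ENNReal.zero_rpow_of_pos (by linarith)
  simp only [h0]
  rw [lintegral_comp_norm (g := (Ici R).indicator (fun r => ENNReal.ofReal (r ^ (-s))))
    (Measurable.indicator (by fun_prop) measurableSet_Ici)]
  have : ∀ r ∈ Ioi (0 : ℝ), ENNReal.ofReal r * (Ici R).indicator
      (fun r => ENNReal.ofReal (r ^ (-s))) r =
      (Ici R).indicator (fun r => ENNReal.ofReal (r ^ (1 - s))) r := by
    intro r hr
    by_cases h : R ≤ r
    · simp only [mem_Ici, h, indicator_of_mem]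
      rw [← ENNReal.ofReal_mul (mem_Ioi.1 hr).le, sub_eq_add_neg, Real.rpow_add (mem_Ioi.1 hr),
        Real.rpow_one]
    · simp [h]
  rw [setLIntegral_congr_fun measurableSet_Ioi this, setLIntegral_indicator measurableSet_Ici,
    (inter_eq_left.2 fun x hx => hR.trans_le hx : Ici R ∩ Ioi 0 = Ici R),
    setLIntegral_congr Ioi_ae_eq_Ici.symm,
    ← ofReal_integral_eq_lintegral_ofReal (integrableOn_Ioi_rpow_of_lt (by linarith) hR),
    integral_Ioi_rpow_of_lt (by linarith) hR, ← ENNReal.ofReal_mul (by positivity)]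
  · congr 1
    have : s - 2 ≠ 0 := by linarith
    have : 1 - s + 1 ≠ 0 := by linarith
    rw [show 1 - s + 1 = 2 - s by ring] at *
    field_simp
    ring
  · filter_upwards [ae_restrict_mem measurableSet_Ioi] with r hr
    exact Real.rpow_nonneg (hR.trans hr).le _

/-- The layer cake formula for a single number. -/
theorem lintegral_layercake (x : ℝ≥0∞) {q : ℝ} (hq : 0 < q) :
    ∫⁻ t in Ioi (0 : ℝ), (if ENNReal.ofReal t < x then ENNReal.ofReal (q * t ^ (q - 1)) else 0) =
      x ^ q := by
  have key : ∀ a : ℝ, 0 ≤ a → ∫⁻ t in Ioo (0 : ℝ) a, ENNReal.ofReal (q * t ^ (q - 1)) =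
      ENNReal.ofReal (a ^ q) := by
    intro a ha
    rw [setLIntegral_congr Ioo_ae_eq_Ioc, ← ofReal_integral_eq_lintegral_ofReal,
      ← intervalIntegral.integral_of_le ha, intervalIntegral.integral_const_mul,
      integral_rpow (Or.inl (by linarith))]
    · congr 1
      rw [sub_add_cancel, Real.zero_rpow hq.ne']
      field_simp
      ring
    · exact (intervalIntegrable_iff_integrableOn_Ioc_of_le ha).1
        ((intervalIntegral.intervalIntegrable_rpow' (by linarith)).const_mul q)
    · filter_upwards [ae_restrict_mem measurableSet_Ioc] with r hr
      exact mul_nonneg hq.le (Real.rpow_nonneg hr.1.le _)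
  have ind : ∀ a : ℝ, 0 ≤ a → ∫⁻ t in Ioi (0 : ℝ),
      (if t < a then ENNReal.ofReal (q * t ^ (q - 1)) else 0) = ENNReal.ofReal (a ^ q) := by
    intro a ha
    rw [← key a ha, ← Ioi_inter_Iio, inter_comm, ← setLIntegral_indicator measurableSet_Iio]
    rfl
  rcases eq_or_ne x ∞ with rfl | hx
  · rw [ENNReal.top_rpow_of_pos hq, eq_top_iff]
    refine le_of_tendsto' (f := fun n : ℕ => ENNReal.ofReal ((n : ℝ) ^ q)) (x := atTop) ?_ ?_
    · exact ENNReal.tendsto_ofReal_atTop.comp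
        ((tendsto_rpow_atTop hq).comp tendsto_natCast_atTop_atTop)
    · intro n
      rw [← ind n (Nat.cast_nonneg n)]
      refine lintegral_mono fun t => ?_
      simp only [ENNReal.ofReal_lt_top, if_true]
      split_ifs <;> simp
  · have h := ind x.toReal ENNReal.toReal_nonneg
    rw [← ENNReal.ofReal_rpow_of_nonneg ENNReal.toReal_nonneg hq.le, ENNReal.ofReal_toReal hx] at h
    rw [← h]
    refine setLIntegral_congr_fun measurableSet_Ioi fun t ht => ?_
    simp only [ENNReal.ofReal_lt_iff_lt_toReal (mem_Ioi.1 ht).le hx]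

/-! ### The Hardy–Littlewood–Sobolev inequality for 1/|z - w| -/

/-- The operator with integral kernel `1 / |z - w|`. -/
def rieszPotential (f : ℂ → ℝ≥0∞) (z : ℂ) : ℝ≥0∞ :=
  ∫⁻ w, ‖(z - w)⁻¹‖ₑ * f w

theorem measurable_rieszPotential {f : ℂ → ℝ≥0∞} (hf : Measurable f) :
    Measurable (rieszPotential f) := by
  refine Measurable.lintegral_prod_right' (f := fun x : ℂ × ℂ => ‖(x.1 - x.2)⁻¹‖ₑ * f x.2) ?_
  fun_prop

/-- The part of the kernel `1 / |z|` near the origin. -/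
def nearKernel (R : ℝ) (z : ℂ) : ℝ≥0∞ := if ‖z‖ < R then ‖z⁻¹‖ₑ else 0

/-- The part of the kernel `1 / |z|` away from the origin. -/
def farKernel (R : ℝ) (z : ℂ) : ℝ≥0∞ := if R ≤ ‖z‖ then ‖z⁻¹‖ₑ else 0

@[fun_prop]
theorem measurable_nearKernel (R : ℝ) : Measurable (nearKernel R) :=
  Measurable.ite (measurableSet_lt (by fun_prop) measurable_const) (by fun_prop) measurable_const

@[fun_prop]
theorem measurable_farKernel (R : ℝ) : Measurable (farKernel R) :=
  Measurable.ite (measurableSet_le measurable_const (by fun_prop)) (by fun_prop) measurable_const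

theorem nearKernel_add_farKernel (R : ℝ) (z : ℂ) :
    nearKernel R z + farKernel R z = ‖z⁻¹‖ₑ := by
  by_cases h : ‖z‖ < R
  · simp [nearKernel, farKernel, h]
  · simp [nearKernel, farKernel, h, not_lt.1 h]

theorem lintegral_nearKernel_sub_right (R : ℝ) (w : ℂ) :
    ∫⁻ z, nearKernel R (z - w) = ENNReal.ofReal (2 * Real.pi * R) := by
  rw [lintegral_sub_right_eq_self (nearKernel R)]
  exact lintegral_inv_ball R

theorem lintegral_nearKernel_sub_left (R : ℝ) (z : ℂ) :
    ∫⁻ w, nearKernel R (z - w) = ENNReal.ofReal (2 * Real.pi * R) := by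
  rw [lintegral_sub_left_eq_self (nearKernel R)]
  exact lintegral_inv_ball R

theorem lintegral_lintegral_nearKernel {f : ℂ → ℝ≥0∞} (hf : Measurable f) (R : ℝ) :
    ∫⁻ z, ∫⁻ w, nearKernel R (z - w) * f w = ENNReal.ofReal (2 * Real.pi * R) * ∫⁻ w, f w := by
  rw [lintegral_lintegral_swap (by fun_prop)]
  rw [← lintegral_const_mul _ hf]
  refine lintegral_congr fun w => ?_
  rw [lintegral_mul_const _ (by fun_prop), lintegral_nearKernel_sub_right]

/-- Truncate f at height a and the kernel at radius R. The bounded part of f under the near kernel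
contributes at most 2πRa = t, and the far kernel contributes at most t. Where the potential exceeds
3t, the near kernel applied to the large part of f must therefore exceed t, and Markov's inequality
applies. -/
theorem rieszPotential_level_set {f : ℂ → ℝ≥0∞} (hf : Measurable f) {t R a : ℝ} (ht : 0 < t)
    (hRa : 2 * Real.pi * R * a = t) (hR : 0 < R)
    (hfar : ∀ z, ∫⁻ w, farKernel R (z - w) * f w ≤ ENNReal.ofReal t) :
    volume {z | ENNReal.ofReal t < rieszPotential f z / 3} ≤
      ENNReal.ofReal (2 * Real.pi * R / t) *
        ∫⁻ w, (if ENNReal.ofReal a < f w then f w else 0) := by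
  set F : ℂ → ℝ≥0∞ := fun w => if ENNReal.ofReal a < f w then f w else 0 with hFdef
  have hF : Measurable F := Measurable.ite (measurableSet_lt measurable_const hf) hf measurable_const
  have hfF : ∀ w, f w ≤ F w + ENNReal.ofReal a := by
    intro w
    by_cases h : ENNReal.ofReal a < f w
    · simp [hFdef, h]
    · simp [hFdef, h, not_lt.1 h]
  have hP : ∀ z, rieszPotential f z ≤
      (∫⁻ w, nearKernel R (z - w) * F w) + (ENNReal.ofReal t + ENNReal.ofReal t) := by
    intro z
    calc rieszPotential f z ≤ ∫⁻ w, (nearKernel R (z - w) * F w +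
          (nearKernel R (z - w) * ENNReal.ofReal a + farKernel R (z - w) * f w)) := by
          refine lintegral_mono fun w => ?_
          simp only
          rw [← nearKernel_add_farKernel R, add_mul, ← add_assoc, ← mul_add]
          gcongr
          exact hfF w
      _ = (∫⁻ w, nearKernel R (z - w) * F w) + ((∫⁻ w, nearKernel R (z - w)) * ENNReal.ofReal a +
            ∫⁻ w, farKernel R (z - w) * f w) := by
          rw [lintegral_add_left (by fun_prop), lintegral_add_left (by fun_prop),
            lintegral_mul_const _ (by fun_prop)]
      _ ≤ _ := by
          gcongr
          · rw [lintegral_nearKernel_sub_left, ← ENNReal.ofReal_mul (by positivity), hRa]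
          · exact hfar z
  have hsub : {z | ENNReal.ofReal t < rieszPotential f z / 3} ⊆
      {z | ENNReal.ofReal t ≤ ∫⁻ w, nearKernel R (z - w) * F w} := by
    intro z hz
    simp only [mem_ofPred_eq] at hz ⊢
    by_contra! hlt
    have h1 : rieszPotential f z ≤ ENNReal.ofReal t * 3 := by
      refine (hP z).trans ?_
      calc _ ≤ ENNReal.ofReal t + (ENNReal.ofReal t + ENNReal.ofReal t) := by gcongr
        _ = _ := by ring
    exact absurd hz (not_lt.2 (ENNReal.div_le_of_le_mul h1))
  have hmarkov := mul_meas_ge_le_lintegral (μ := volume)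
    (f := fun z => ∫⁻ w, nearKernel R (z - w) * F w)
    (Measurable.lintegral_prod_right' (f := fun x : ℂ × ℂ => nearKernel R (x.1 - x.2) * F x.2)
      (by fun_prop)) (ENNReal.ofReal t)
  rw [lintegral_lintegral_nearKernel hF] at hmarkov
  have ht0 : ENNReal.ofReal t ≠ 0 := by simpa using ht
  rw [mul_comm, ← ENNReal.le_div_iff_mul_le (Or.inl ht0) (Or.inl ENNReal.ofReal_ne_top)] at hmarkov
  refine (measure_mono hsub).trans (hmarkov.trans_eq ?_)
  rw [ENNReal.ofReal_div_of_pos ht, ENNReal.mul_div_right_comm]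

/-- An interpolation argument of Marcinkiewicz type: at each level t the radius R = k t^(-q/2) is
chosen so that the far part is at most t, the level set estimate is integrated against q t^(q-1),
and Tonelli leaves for each w an elementary integral in t, evaluated by the layer cake formula. -/
theorem lintegral_rieszPotential_rpow_le_of_far {f : ℂ → ℝ≥0∞} (hf : Measurable f) {q k : ℝ}
    (hq : 2 < q) (hk : 0 < k)
    (hfar : ∀ R, 0 < R → ∀ z, ∫⁻ w, farKernel R (z - w) * f w ≤ ENNReal.ofReal ((R / k) ^ (-2 / q))) :
    ∫⁻ z, (rieszPotential f z / 3) ^ q ≤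
      ENNReal.ofReal (2 * Real.pi * k * q / (q / 2 - 1)) *
        ENNReal.ofReal (2 * Real.pi * k) ^ ((q / 2 - 1) / (1 + q / 2)) *
          ∫⁻ w, f w ^ (q / (1 + q / 2)) := by
  have hm : 0 < q / 2 - 1 := by linarith
  have hb : 0 < 1 + q / 2 := by linarith
  have hpik : 0 < 2 * Real.pi * k := by positivity
  have hPm := measurable_rieszPotential hf
  calc ∫⁻ z, (rieszPotential f z / 3) ^ q
      = ∫⁻ z, ∫⁻ t in Ioi (0 : ℝ), (if ENNReal.ofReal t < rieszPotential f z / 3 then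
          ENNReal.ofReal (q * t ^ (q - 1)) else 0) := by
        simp_rw [lintegral_layercake _ (by linarith : 0 < q)]
    _ = ∫⁻ t in Ioi (0 : ℝ), ∫⁻ z, (if ENNReal.ofReal t < rieszPotential f z / 3 then
          ENNReal.ofReal (q * t ^ (q - 1)) else 0) := by
        refine lintegral_lintegral_swap (Measurable.aemeasurable ?_)
        refine Measurable.ite (measurableSet_lt (by fun_prop) ?_) (by fun_prop) measurable_const
        exact (hPm.comp measurable_fst).div_const 3
    _ ≤ ∫⁻ t in Ioi (0 : ℝ), ∫⁻ w, f w * (ENNReal.ofReal (2 * Real.pi * k * q / (q / 2 - 1)) *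
          (if ENNReal.ofReal t < (ENNReal.ofReal (2 * Real.pi * k) * f w) ^ (1 + q / 2)⁻¹ then
            ENNReal.ofReal ((q / 2 - 1) * t ^ (q / 2 - 1 - 1)) else 0)) := by
        refine setLIntegral_mono' measurableSet_Ioi fun t ht => ?_
        have ht : 0 < t := ht
        have hRpos : 0 < k * t ^ (-(q / 2)) := by positivity
        have hfar' : ∀ z, ∫⁻ w, farKernel (k * t ^ (-(q / 2))) (z - w) * f w ≤
            ENNReal.ofReal t := by
          intro z
          refine (hfar _ hRpos z).trans_eq ?_
          rw [mul_div_cancel_left₀ _ hk.ne', ← Real.rpow_mul ht.le]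
          have : -(q / 2) * (-2 / q) = 1 := by field_simp
          rw [this, Real.rpow_one]
        -- The truncation height a is forced by 2πRa = t.
        have hRa : 2 * Real.pi * (k * t ^ (-(q / 2))) * (t ^ (1 + q / 2) / (2 * Real.pi * k)) = t := by
          rw [Real.rpow_add ht, Real.rpow_neg ht.le, Real.rpow_one]
          have : t ^ (q / 2) ≠ 0 := by positivity
          field_simp
        have hlev := rieszPotential_level_set hf ht hRa hRpos hfar'
        have hset : ∀ z, (if ENNReal.ofReal t < rieszPotential f z / 3 then
            ENNReal.ofReal (q * t ^ (q - 1)) else 0) =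
            {z | ENNReal.ofReal t < rieszPotential f z / 3}.indicator
              (fun _ => ENNReal.ofReal (q * t ^ (q - 1))) z := fun z => by
          simp only [indicator_apply, mem_ofPred_eq]
        simp_rw [hset]
        rw [lintegral_indicator_const (measurableSet_lt measurable_const (hPm.div_const 3))]
        refine (mul_le_mul_right hlev _).trans_eq ?_
        rw [← mul_assoc, ← ENNReal.ofReal_mul (by positivity), ← lintegral_const_mul]
        · refine lintegral_congr fun w => ?_
          -- The condition a < f w is solved for t, so that the inner integral over t becomes a
          -- layer cake integral with exponent q/2 - 1 > 0.
          have hiff : ENNReal.ofReal (t ^ (1 + q / 2) / (2 * Real.pi * k)) < f w ↔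
              ENNReal.ofReal t < (ENNReal.ofReal (2 * Real.pi * k) * f w) ^ (1 + q / 2)⁻¹ := by
            rw [ENNReal.lt_rpow_inv_iff hb, ENNReal.ofReal_div_of_pos hpik,
              ENNReal.ofReal_rpow_of_pos ht, mul_comm (ENNReal.ofReal (2 * Real.pi * k)),
              ENNReal.div_lt_iff (Or.inl (by simpa using hpik)) (Or.inl ENNReal.ofReal_ne_top)]
          simp only [hiff]
          split_ifs
          · rw [← ENNReal.ofReal_mul (by positivity), mul_comm]
            congr 2
            -- The weight q t^(q-1) times the Markov constant 2πR/t is 2πkq t^(q/2-2), a multiple of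
            -- the derivative of t^(q/2-1).
            have e1 : t ^ (q - 1) = t ^ (q / 2 - 1 - 1) * t ^ (q / 2) * t := by
              rw [← Real.rpow_add ht, ← Real.rpow_add_one ht.ne']
              congr 1
              ring
            rw [e1, Real.rpow_neg ht.le]
            have : t ^ (q / 2) ≠ 0 := by positivity
            have : q - 2 ≠ 0 := by linarith
            field_simp
          · simp
        · exact Measurable.ite (measurableSet_lt measurable_const hf) hf measurable_const
    _ = ∫⁻ w, ∫⁻ t in Ioi (0 : ℝ), f w * (ENNReal.ofReal (2 * Real.pi * k * q / (q / 2 - 1)) *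
          (if ENNReal.ofReal t < (ENNReal.ofReal (2 * Real.pi * k) * f w) ^ (1 + q / 2)⁻¹ then
            ENNReal.ofReal ((q / 2 - 1) * t ^ (q / 2 - 1 - 1)) else 0)) := by
        refine lintegral_lintegral_swap (Measurable.aemeasurable ?_)
        refine (hf.comp measurable_snd).mul (Measurable.const_mul ?_ _)
        refine Measurable.ite (measurableSet_lt (by fun_prop) ?_) (by fun_prop) measurable_const
        exact ((hf.comp measurable_snd).const_mul _).pow_const _
    _ = ∫⁻ w, ENNReal.ofReal (2 * Real.pi * k * q / (q / 2 - 1)) *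
        ENNReal.ofReal (2 * Real.pi * k) ^ ((q / 2 - 1) / (1 + q / 2)) *
          f w ^ (q / (1 + q / 2)) := by
        refine lintegral_congr fun w => ?_
        have hmeas : Measurable fun t : ℝ => (if ENNReal.ofReal t <
            (ENNReal.ofReal (2 * Real.pi * k) * f w) ^ (1 + q / 2)⁻¹ then
            ENNReal.ofReal ((q / 2 - 1) * t ^ (q / 2 - 1 - 1)) else 0) :=
          Measurable.ite (measurableSet_lt (by fun_prop) measurable_const) (by fun_prop)
            measurable_const
        rw [lintegral_const_mul _ (hmeas.const_mul _), lintegral_const_mul _ hmeas,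
          lintegral_layercake _ hm, ← ENNReal.rpow_mul, ENNReal.mul_rpow_of_nonneg _ _ (by positivity)]
        have e1 : f w ^ (q / (1 + q / 2)) = f w * f w ^ ((q / 2 - 1) / (1 + q / 2)) := by
          nth_rewrite 2 [← ENNReal.rpow_one (f w)]
          rw [← ENNReal.rpow_add_of_nonneg _ _ zero_le_one (by positivity)]
          congr 1
          field_simp
          ring
        rw [e1, inv_mul_eq_div]
        ring
    _ = _ := lintegral_const_mul _ (hf.pow_const _)

/-- Hölder with the conjugate exponent s; the tail of |z|^(-s) has finite integral since s > 2, that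
is p < 2. -/
theorem lintegral_farKernel_mul_le {f : ℂ → ℝ≥0∞} (hf : Measurable f) {p s R : ℝ}
    (hsp : s.HolderConjugate p) (hs : 2 < s) (hR : 0 < R) (z : ℂ) :
    ∫⁻ w, farKernel R (z - w) * f w ≤
      ENNReal.ofReal ((2 * Real.pi / (s - 2)) ^ (1 / s) * R ^ (2 / s - 1)) *
        (∫⁻ w, f w ^ p) ^ (1 / p) := by
  refine (ENNReal.lintegral_mul_le_Lp_mul_Lq volume hsp
    (f := fun w => farKernel R (z - w)) (by fun_prop) hf.aemeasurable).trans_eq ?_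
  congr 1
  have h1 : ∫⁻ w, farKernel R (z - w) ^ s = ENNReal.ofReal (2 * Real.pi / (s - 2) * R ^ (2 - s)) := by
    rw [lintegral_sub_left_eq_self (fun w => farKernel R w ^ s)]
    exact lintegral_inv_rpow_compl_ball hR hs
  have h2 : 0 < s - 2 := by linarith
  have h3 : 0 < s := by linarith
  rw [h1, ENNReal.ofReal_rpow_of_nonneg (by positivity) (by positivity),
    Real.mul_rpow (by positivity) (by positivity), ← Real.rpow_mul hR.le]
  congr 3
  field_simp

/-- The Hardy-Littlewood-Sobolev inequality for the kernel `1 / |z - w|` on `ℂ`. -/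
theorem exists_rieszPotential_bound {p q : ℝ} (hp : 1 < p) (hq : 2 < q)
    (hpq : 1 / q = 1 / p - 1 / 2) :
    ∃ C : ℝ≥0∞, C ≠ ⊤ ∧ ∀ f : ℂ → ℝ≥0∞, Measurable f →
      (∫⁻ z, rieszPotential f z ^ q) ^ (1 / q) ≤ C * (∫⁻ w, f w ^ p) ^ (1 / p) := by
  have hp0 : 0 < p := by linarith
  have hq0 : 0 < q := by linarith
  have hm : 0 < q / 2 - 1 := by linarith
  have hb : 0 < 1 + q / 2 := by linarith
  have hpq' : p = q / (1 + q / 2) := by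
    field_simp at hpq ⊢
    linarith
  have hsp : (p / (p - 1)).HolderConjugate p := (Real.HolderConjugate.conjExponent hp).symm
  set s := p / (p - 1) with hs
  have hp2 : p < 2 := by
    have h1 : 0 < 1 / q := by positivity
    have h2 : 1 / 2 < 1 / p := by linarith
    exact (one_div_lt_one_div (by norm_num) hp0).1 h2
  have hs2 : 2 < s := by
    rw [hs, lt_div_iff₀ (by linarith)]
    linarith
  have hs0 : 0 < s := by linarith
  have hsq : 2 / s - 1 = -2 / q := by
    have : 1 / s = 1 - 1 / p := by
      have := hsp.inv_add_inv_eq_one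
      simp only [one_div]
      linarith
    have h2 : 2 / s = 2 * (1 / s) := by ring
    have h3 : -2 / q = -2 * (1 / q) := by ring
    rw [h2, h3, this, hpq]
    ring
  set c := (2 * Real.pi / (s - 2)) ^ (1 / s) with hc
  have hc0 : 0 < c := by
    have : 0 < s - 2 := by linarith
    positivity
  set D : ℝ := 2 * Real.pi * c ^ (q / 2) * q / (q / 2 - 1) *
    (2 * Real.pi * c ^ (q / 2)) ^ ((q / 2 - 1) / (1 + q / 2)) with hD
  refine ⟨3 * ENNReal.ofReal D ^ (1 / q), by finiteness, fun f hf => ?_⟩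
  rcases eq_or_ne (∫⁻ w, f w ^ p) 0 with h0 | h0
  · have hf0 : f =ᵐ[volume] 0 := by
      rw [lintegral_eq_zero_iff (hf.pow_const p)] at h0
      filter_upwards [h0] with w hw
      simpa [hp0, hp0.not_gt] using hw
    have : ∀ z, rieszPotential f z = 0 := by
      intro z
      rw [rieszPotential, lintegral_eq_zero_iff (by fun_prop)]
      filter_upwards [hf0] with w hw
      simp [hw]
    simp [this, hq0]
  rcases eq_or_ne (∫⁻ w, f w ^ p) ⊤ with htop | htop
  · rw [htop, ENNReal.top_rpow_of_pos (by positivity), ENNReal.mul_top]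
    · exact le_top
    · have : 0 < D := by positivity
      simp [this, hq0, ENNReal.rpow_eq_zero_iff]
  obtain ⟨A, hA0, hA⟩ : ∃ A : ℝ, 0 < A ∧ ∫⁻ w, f w ^ p = ENNReal.ofReal (A ^ p) := by
    refine ⟨(∫⁻ w, f w ^ p).toReal ^ (1 / p), Real.rpow_pos_of_pos (ENNReal.toReal_pos h0 htop) _, ?_⟩
    rw [← Real.rpow_mul ENNReal.toReal_nonneg, one_div_mul_cancel hp0.ne', Real.rpow_one,
      ENNReal.ofReal_toReal htop]
  have hA' : (∫⁻ w, f w ^ p) ^ (1 / p) = ENNReal.ofReal A := by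
    rw [hA, ENNReal.ofReal_rpow_of_pos (by positivity), ← Real.rpow_mul hA0.le,
      mul_one_div_cancel hp0.ne', Real.rpow_one]
  -- With A the L^p norm of f, Hölder bounds the far part by c A R^(-2/q). This is (R/k)^(-2/q)
  -- exactly for k = (cA)^(q/2).
  have key := lintegral_rieszPotential_rpow_le_of_far hf (k := (c * A) ^ (q / 2)) hq (by positivity) (by
    intro R hR z
    refine (lintegral_farKernel_mul_le hf hsp hs2 hR z).trans_eq ?_
    rw [hA', ← ENNReal.ofReal_mul (by positivity), hsq, Real.div_rpow hR.le (by positivity),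
      ← Real.rpow_mul (by positivity)]
    have : q / 2 * (-2 / q) = -1 := by field_simp
    rw [this, Real.rpow_neg_one]
    congr 1
    rw [div_inv_eq_mul, ← hc]
    ring)
  rw [← hpq', hA] at key
  have key2 : ∫⁻ z, (rieszPotential f z / 3) ^ q ≤ ENNReal.ofReal (D * A ^ q) := by
    refine key.trans_eq ?_
    rw [ENNReal.ofReal_rpow_of_pos (by positivity), ← ENNReal.ofReal_mul (by positivity),
      ← ENNReal.ofReal_mul (by positivity)]
    congr 1
    rw [Real.mul_rpow hc0.le hA0.le, ← mul_assoc (2 * Real.pi),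
      Real.mul_rpow (by positivity : 0 ≤ 2 * Real.pi * c ^ (q / 2)) (by positivity), hD]
    -- Homogeneity: the exponents q/2, (q/2)(q/2-1)/(1+q/2) and p of A add up to q because p =
    -- q/(1+q/2).
    have e : A ^ q = A ^ (q / 2) * (A ^ (q / 2)) ^ ((q / 2 - 1) / (1 + q / 2)) * A ^ p := by
      rw [← Real.rpow_mul hA0.le, ← Real.rpow_add hA0, ← Real.rpow_add hA0, hpq']
      congr 1
      field_simp
      ring
    rw [e]
    ring
  have e3 : ∀ z, rieszPotential f z ^ q = 3 ^ q * (rieszPotential f z / 3) ^ q := by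
    intro z
    rw [← ENNReal.mul_rpow_of_nonneg _ _ hq0.le, ENNReal.mul_div_cancel (by simp) (by simp)]
  simp_rw [e3]
  rw [lintegral_const_mul _ (((measurable_rieszPotential hf).div_const 3).pow_const q), hA',
    ENNReal.mul_rpow_of_nonneg _ _ (by positivity), ← ENNReal.rpow_mul, mul_one_div_cancel hq0.ne',
    ENNReal.rpow_one, mul_assoc]
  gcongr
  refine (ENNReal.rpow_le_rpow key2 (by positivity)).trans_eq ?_
  have hD0 : 0 < D := by positivity
  rw [ENNReal.ofReal_mul hD0.le, ENNReal.mul_rpow_of_nonneg _ _ (by positivity),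
    ENNReal.ofReal_rpow_of_pos (by positivity), ENNReal.ofReal_rpow_of_pos (by positivity),
    ← Real.rpow_mul hA0.le, mul_one_div_cancel hq0.ne', Real.rpow_one,
    ← ENNReal.ofReal_rpow_of_pos hD0]

/-! ### Sobolev exponents -/

/-- Exponents `1 < p < 2 < q < ∞` with `1/q = 1/p - 1/2`. -/
structure SobolevExponents (p q : ℝ≥0∞) : Prop where
  one_lt : 1 < p
  ne_top : q ≠ ⊤
  inv_add_inv : q⁻¹ + 2⁻¹ = p⁻¹

namespace SobolevExponents

variable {p q : ℝ≥0∞}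

theorem two_lt (h : SobolevExponents p q) : 2 < q := by
  rw [← ENNReal.inv_lt_inv]
  have h1 : p⁻¹ < 1 := ENNReal.inv_lt_one.2 h.one_lt
  rw [← h.inv_add_inv, ← ENNReal.inv_two_add_inv_two] at h1
  exact (ENNReal.add_lt_add_iff_right (by simp)).1 h1

theorem lt_two (h : SobolevExponents p q) : p < 2 := by
  rw [← ENNReal.inv_lt_inv, ← h.inv_add_inv]
  rw [add_comm]
  exact ENNReal.lt_add_right (by simp) (by simpa using h.ne_top)

theorem left_ne_top (h : SobolevExponents p q) : p ≠ ⊤ := (h.lt_two.trans (by simp)).ne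

theorem left_ne_zero (h : SobolevExponents p q) : p ≠ 0 := (zero_lt_one.trans h.one_lt).ne'

theorem right_ne_zero (h : SobolevExponents p q) : q ≠ 0 := (zero_lt_two.trans h.two_lt).ne'

theorem one_lt_toReal (h : SobolevExponents p q) : 1 < p.toReal := by
  rw [← ENNReal.toReal_one, ENNReal.toReal_lt_toReal (by simp) h.left_ne_top]
  exact h.one_lt

theorem two_lt_toReal (h : SobolevExponents p q) : 2 < q.toReal := by
  rw [← ENNReal.toReal_ofNat, ENNReal.toReal_lt_toReal (by simp) h.ne_top]
  exact h.two_lt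

theorem toReal_eq (h : SobolevExponents p q) : 1 / q.toReal = 1 / p.toReal - 1 / 2 := by
  have := congrArg ENNReal.toReal h.inv_add_inv
  rw [ENNReal.toReal_add (by simpa using h.right_ne_zero) (by simp), ENNReal.toReal_inv,
    ENNReal.toReal_inv, ENNReal.toReal_inv, ENNReal.toReal_ofNat] at this
  simp only [one_div]
  linarith

theorem of_left (h1 : 1 < p) (h2 : p < 2) : SobolevExponents p (p⁻¹ - 2⁻¹)⁻¹ where
  one_lt := h1
  ne_top := by
    rw [ENNReal.inv_ne_top, Ne, tsub_eq_zero_iff_le, not_le]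
    exact ENNReal.inv_lt_inv.2 h2
  inv_add_inv := by
    rw [inv_inv]
    exact tsub_add_cancel_of_le (ENNReal.inv_le_inv.2 h2.le)

/-- Used with q replaced by the integrability exponent of a given solution, which determines its own
partner below 2. -/
theorem of_right (h1 : 2 < q) (h2 : q ≠ ⊤) : SobolevExponents (q⁻¹ + 2⁻¹)⁻¹ q where
  one_lt := by
    rw [ENNReal.one_lt_inv, ← ENNReal.inv_two_add_inv_two]
    exact ENNReal.add_lt_add_right (by simp) (ENNReal.inv_lt_inv.2 h1)
  ne_top := h2
  inv_add_inv := (inv_inv _).symm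

end SobolevExponents

/-! ### Estimates for I_Ω(0) and for multiplication by U -/

/-- The operator with integral kernel `1 / |z - w|` on `Ω`. -/
def rieszOn (Ω : Set ℂ) (f : ℂ → ℝ≥0∞) (z : ℂ) : ℝ≥0∞ :=
  ∫⁻ w in Ω, ‖(z - w)⁻¹‖ₑ * f w

theorem rieszOn_congr {Ω : Set ℂ} {f g : ℂ → ℝ≥0∞} (h : f =ᵐ[volume.restrict Ω] g) :
    rieszOn Ω f = rieszOn Ω g := by
  funext z
  refine lintegral_congr_ae ?_
  filter_upwards [h] with w hw
  rw [hw]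

theorem exists_rieszOn_eq {Ω : Set ℂ} (hΩ : MeasurableSet Ω) {f : ℂ → ℝ≥0∞}
    (hf : AEMeasurable f (volume.restrict Ω)) :
    ∃ g : ℂ → ℝ≥0∞, Measurable g ∧ rieszOn Ω f = rieszPotential g ∧
      ∀ r : ℝ, 0 < r → ∫⁻ w, g w ^ r = ∫⁻ w in Ω, f w ^ r := by
  refine ⟨Ω.indicator (hf.mk f), hf.measurable_mk.indicator hΩ, ?_, fun r hr => ?_⟩
  · rw [rieszOn_congr hf.ae_eq_mk]
    funext z
    rw [rieszOn, rieszPotential, ← lintegral_indicator hΩ]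
    refine lintegral_congr fun w => ?_
    by_cases h : w ∈ Ω <;> simp [h]
  · rw [lintegral_congr_ae (hf.ae_eq_mk.mono fun w hw => by simp only [hw] :
      (fun w => f w ^ r) =ᵐ[volume.restrict Ω] fun w => hf.mk f w ^ r), ← lintegral_indicator hΩ]
    refine lintegral_congr fun w => ?_
    by_cases h : w ∈ Ω <;> simp [h, hr]

theorem measurable_rieszOn {Ω : Set ℂ} (hΩ : MeasurableSet Ω) {f : ℂ → ℝ≥0∞}
    (hf : AEMeasurable f (volume.restrict Ω)) : Measurable (rieszOn Ω f) := by
  obtain ⟨g, hg, h, -⟩ := exists_rieszOn_eq hΩ hf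
  rw [h]
  exact measurable_rieszPotential hg

/-- Extension by zero reduces Ω to the whole plane, so C does not depend on Ω. This is why the final
ε depends only on p. -/
theorem exists_eLpNorm_rieszOn_le {p q : ℝ≥0∞} (h : SobolevExponents p q) :
    ∃ C : ℝ≥0∞, C ≠ ⊤ ∧ ∀ (Ω : Set ℂ) (f : ℂ → ℝ≥0∞), MeasurableSet Ω →
      AEMeasurable f (volume.restrict Ω) →
      eLpNorm (rieszOn Ω f) q volume ≤ C * eLpNorm f p (volume.restrict Ω) := by
  obtain ⟨C, hC, hle⟩ := exists_rieszPotential_bound h.one_lt_toReal h.two_lt_toReal h.toReal_eq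
  refine ⟨C, hC, fun Ω f hΩ hf => ?_⟩
  obtain ⟨g, hg, hfg, hr⟩ := exists_rieszOn_eq hΩ hf
  rw [hfg, eLpNorm_eq_lintegral_rpow_enorm_toReal h.right_ne_zero h.ne_top,
    eLpNorm_eq_lintegral_rpow_enorm_toReal h.left_ne_zero h.left_ne_top]
  simp only [enorm_eq_self]
  rw [← hr p.toReal (by linarith [h.one_lt_toReal])]
  exact hle g hg

/-- Hölder for 1/p = 1/2 + 1/q: multiplication by U ∈ L² exactly undoes the gain of exponent in the
Sobolev inequality. -/
theorem eLpNorm_mul_le {p q : ℝ≥0∞} (h : SobolevExponents p q) {μ : Measure ℂ}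
    {u v : ℂ → ℝ≥0∞} (hu : AEMeasurable u μ) (hv : AEMeasurable v μ) :
    eLpNorm (fun z => u z * v z) p μ ≤ eLpNorm u 2 μ * eLpNorm v q μ := by
  rw [eLpNorm_eq_lintegral_rpow_enorm_toReal h.right_ne_zero h.ne_top,
    eLpNorm_eq_lintegral_rpow_enorm_toReal h.left_ne_zero h.left_ne_top,
    eLpNorm_eq_lintegral_rpow_enorm_toReal (by simp) (by simp)]
  simp only [enorm_eq_self, ENNReal.toReal_ofNat]
  refine ENNReal.lintegral_Lp_mul_le_Lq_mul_Lr (by linarith [h.one_lt_toReal]) ?_ ?_ μ hu hv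
  · rw [← ENNReal.toReal_ofNat, ENNReal.toReal_lt_toReal h.left_ne_top (by simp)]
    exact h.lt_two
  · linarith [h.toReal_eq]

theorem enorm_le_of_forall {v : Fin 2 → ℂ} {a : ℝ≥0∞} (h : ∀ i, ‖v i‖ₑ ≤ a) : ‖v‖ₑ ≤ a := by
  induction a with
  | top => exact le_top
  | coe a =>
    simp only [enorm_eq_nnnorm, ENNReal.coe_le_coe] at h ⊢
    exact pi_nnnorm_le_iff.2 h

theorem enorm_apply_le (v : Fin 2 → ℂ) (i : Fin 2) : ‖v i‖ₑ ≤ ‖v‖ₑ := by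
  simp only [enorm_eq_nnnorm, ENNReal.coe_le_coe]
  exact nnnorm_le_pi_nnnorm v i

theorem enorm_conj (z : ℂ) : ‖conj z‖ₑ = ‖z‖ₑ := by
  rw [← ofReal_norm, ← ofReal_norm, Complex.norm_conj]

theorem enorm_conj_sub_inv (z w : ℂ) : ‖(conj z - conj w)⁻¹‖ₑ = ‖(z - w)⁻¹‖ₑ := by
  rw [← map_sub, ← map_inv₀, enorm_conj]

theorem enorm_pi_inv_le : ‖(Real.pi : ℂ)⁻¹‖ₑ ≤ 1 := by
  rw [enorm_inv_eq, ENNReal.ofReal_le_one, Complex.norm_real, Real.norm_of_nonneg Real.pi_pos.le]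
  exact inv_le_one_of_one_le₀ (by linarith [Real.pi_gt_three])

/-- Both diagonal entries of the kernel have modulus 1/|z-w|, ℂ² carries the maximum norm, and the
factor 1/π ≤ 1 is dropped. -/
theorem enorm_freeInverse_le (Ω : Set ℂ) (h : ℂ → Fin 2 → ℂ) (z : ℂ) :
    ‖freeInverse Ω h z‖ₑ ≤ rieszOn Ω (fun w => ‖h w‖ₑ) z := by
  refine enorm_le_of_forall fun i => ?_
  have key : ∀ (k : ℂ → ℂ) (j : Fin 2), (∀ w, ‖k w‖ₑ = ‖(z - w)⁻¹‖ₑ) →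
      ‖(Real.pi : ℂ)⁻¹ * ∫ w in Ω, k w * h w j‖ₑ ≤ rieszOn Ω (fun w => ‖h w‖ₑ) z := by
    intro k j hk
    rw [enorm_mul]
    refine (mul_le_of_le_one_left zero_le enorm_pi_inv_le).trans ?_
    refine (enorm_integral_le_lintegral_enorm _).trans (lintegral_mono fun w => ?_)
    simp only [enorm_mul, hk]
    gcongr
    exact enorm_apply_le _ _
  fin_cases i
  · exact key _ 0 fun w => rfl
  · exact key _ 1 fun w => enorm_conj_sub_inv z w

theorem enorm_potentialMul_le (U : ℂ → ℂ) (g : ℂ → Fin 2 → ℂ) (z : ℂ) :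
    ‖potentialMul U g z‖ₑ ≤ ‖U z‖ₑ * ‖g z‖ₑ := by
  refine enorm_le_of_forall fun i => ?_
  fin_cases i
  · simp only [potentialMul, Matrix.mulVec, dotProduct, Fin.sum_univ_two]
    simp only [Fin.zero_eta, of_apply, cons_val', cons_val_zero, cons_val_fin_one, cons_val_one,
      zero_mul, zero_add, enorm_mul, enorm_neg, enorm_conj]
    gcongr
    exact enorm_apply_le _ _
  · simp only [potentialMul, Matrix.mulVec, dotProduct, Fin.sum_univ_two]
    simp only [Fin.mk_one, of_apply, cons_val', cons_val_zero, cons_val_fin_one, cons_val_one,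
      zero_mul, add_zero, enorm_mul]
    gcongr
    exact enorm_apply_le _ _

theorem potentialMul_apply_zero (U : ℂ → ℂ) (g : ℂ → Fin 2 → ℂ) (z : ℂ) :
    potentialMul U g z 0 = -conj (U z) * g z 1 := by
  simp [potentialMul, Matrix.mulVec, dotProduct, Fin.sum_univ_two]

theorem potentialMul_apply_one (U : ℂ → ℂ) (g : ℂ → Fin 2 → ℂ) (z : ℂ) :
    potentialMul U g z 1 = U z * g z 0 := by
  simp [potentialMul, Matrix.mulVec, dotProduct, Fin.sum_univ_two]

theorem aestronglyMeasurable_fin2 {α : Type*} {m : MeasurableSpace α} {μ : Measure α}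
    {f : α → Fin 2 → ℂ} (h : ∀ i, AEStronglyMeasurable (fun x => f x i) μ) :
    AEStronglyMeasurable f μ :=
  (aemeasurable_pi_lambda f fun i => (h i).aemeasurable).aestronglyMeasurable

theorem aestronglyMeasurable_apply {α : Type*} {m : MeasurableSpace α} {μ : Measure α}
    {f : α → Fin 2 → ℂ} (h : AEStronglyMeasurable f μ) (i : Fin 2) :
    AEStronglyMeasurable (fun x => f x i) μ :=
  (continuous_apply i).comp_aestronglyMeasurable h

theorem aestronglyMeasurable_potentialMul {μ : Measure ℂ} {U : ℂ → ℂ} {g : ℂ → Fin 2 → ℂ}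
    (hU : AEStronglyMeasurable U μ) (hg : AEStronglyMeasurable g μ) :
    AEStronglyMeasurable (potentialMul U g) μ := by
  refine aestronglyMeasurable_fin2 fun i => ?_
  fin_cases i
  · simp only [Fin.zero_eta, potentialMul_apply_zero]
    exact (continuous_conj.comp_aestronglyMeasurable hU).neg.mul (aestronglyMeasurable_apply hg 1)
  · simp only [Fin.mk_one, potentialMul_apply_one]
    exact hU.mul (aestronglyMeasurable_apply hg 0)

theorem aestronglyMeasurable_freeInverse {Ω : Set ℂ} {h : ℂ → Fin 2 → ℂ}
    (hh : AEStronglyMeasurable h (volume.restrict Ω)) (μ : Measure ℂ) [SFinite μ] :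
    AEStronglyMeasurable (freeInverse Ω h) μ := by
  refine aestronglyMeasurable_fin2 fun i => ?_
  fin_cases i
  · refine AEStronglyMeasurable.const_mul (AEStronglyMeasurable.integral_prod_right'
      (f := fun x : ℂ × ℂ => (x.1 - x.2)⁻¹ * h x.2 0) ?_) _
    exact (by fun_prop : Measurable fun x : ℂ × ℂ => (x.1 - x.2)⁻¹).aestronglyMeasurable.mul
      (aestronglyMeasurable_apply hh 0).comp_snd
  · refine AEStronglyMeasurable.const_mul (AEStronglyMeasurable.integral_prod_right'
      (f := fun x : ℂ × ℂ => (conj x.1 - conj x.2)⁻¹ * h x.2 1) ?_) _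
    refine AEStronglyMeasurable.mul (Measurable.aestronglyMeasurable ?_)
      (aestronglyMeasurable_apply hh 1).comp_snd
    exact ((continuous_conj.measurable.comp measurable_fst).sub
      (continuous_conj.measurable.comp measurable_snd)).inv

theorem freeInverse_congr {Ω : Set ℂ} {h h' : ℂ → Fin 2 → ℂ} (hh : h =ᵐ[volume.restrict Ω] h') :
    freeInverse Ω h = freeInverse Ω h' := by
  funext z
  have h0 : ∫ w in Ω, (z - w)⁻¹ * h w 0 = ∫ w in Ω, (z - w)⁻¹ * h' w 0 :=
    integral_congr_ae (hh.mono fun w hw => by simp only [hw])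
  have h1 : ∫ w in Ω, (conj z - conj w)⁻¹ * h w 1 = ∫ w in Ω, (conj z - conj w)⁻¹ * h' w 1 :=
    integral_congr_ae (hh.mono fun w hw => by simp only [hw])
  simp only [freeInverse, h0, h1]

/-- The integrals defining `freeInverse Ω h z` converge absolutely. -/
def FreeIntegrable (Ω : Set ℂ) (h : ℂ → Fin 2 → ℂ) (z : ℂ) : Prop :=
  Integrable (fun w => (z - w)⁻¹ * h w 0) (volume.restrict Ω) ∧
    Integrable (fun w => (conj z - conj w)⁻¹ * h w 1) (volume.restrict Ω)

theorem freeIntegrable_of_rieszOn_lt_top {Ω : Set ℂ} {h : ℂ → Fin 2 → ℂ}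
    (hh : AEStronglyMeasurable h (volume.restrict Ω)) {z : ℂ}
    (hz : rieszOn Ω (fun w => ‖h w‖ₑ) z < ⊤) : FreeIntegrable Ω h z := by
  have m1 : Measurable fun w : ℂ => (z - w)⁻¹ := by fun_prop
  have m2 : Measurable fun w : ℂ => (conj z - conj w)⁻¹ :=
    (continuous_conj.measurable.const_sub _).inv
  refine ⟨⟨m1.aestronglyMeasurable.mul (aestronglyMeasurable_apply hh 0), ?_⟩,
    ⟨m2.aestronglyMeasurable.mul (aestronglyMeasurable_apply hh 1), ?_⟩⟩
  · refine lt_of_le_of_lt (lintegral_mono fun w => ?_) hz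
    rw [enorm_mul]
    gcongr
    exact enorm_apply_le _ _
  · refine lt_of_le_of_lt (lintegral_mono fun w => ?_) hz
    rw [enorm_mul, enorm_conj_sub_inv]
    gcongr
    exact enorm_apply_le _ _

/-- A divergent Bochner integral has the value 0, so `freeInverse` is additive at a point only under
absolute convergence. -/
theorem freeInverse_sub {Ω : Set ℂ} {h h' : ℂ → Fin 2 → ℂ} {z : ℂ}
    (hh : FreeIntegrable Ω h z) (hh' : FreeIntegrable Ω h' z) :
    freeInverse Ω (h - h') z = freeInverse Ω h z - freeInverse Ω h' z := by
  simp only [freeInverse, Pi.sub_apply, mul_sub]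
  rw [integral_sub hh.1 hh'.1, integral_sub hh.2 hh'.2]
  funext i
  fin_cases i <;> simp [mul_sub]

/-- The potential of ‖h‖ has finite L^q norm on the whole plane, hence is finite almost everywhere.
-/
theorem ae_freeIntegrable {Ω : Set ℂ} (hΩ : MeasurableSet Ω) {p q : ℝ≥0∞}
    (hpq : SobolevExponents p q) {h : ℂ → Fin 2 → ℂ} (hh : MemLp h p (volume.restrict Ω)) :
    ∀ᵐ z, FreeIntegrable Ω h z := by
  obtain ⟨C, hC, hle⟩ := exists_eLpNorm_rieszOn_le hpq
  have hm := hh.1.aemeasurable.enorm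
  have h1 := hle Ω _ hΩ hm
  rw [eLpNorm_enorm] at h1
  have h2 : eLpNorm (rieszOn Ω fun w => ‖h w‖ₑ) q volume < ⊤ :=
    h1.trans_lt (ENNReal.mul_lt_top hC.lt_top hh.2)
  rw [eLpNorm_lt_top_iff_lintegral_rpow_enorm_lt_top hpq.right_ne_zero hpq.ne_top] at h2
  filter_upwards [ae_lt_top ((measurable_rieszOn hΩ hm).enorm.pow_const _) h2.ne] with z hz
  refine freeIntegrable_of_rieszOn_lt_top hh.1 ?_
  rw [lt_top_iff_ne_top]
  intro htop
  simp only [enorm_eq_self, htop] at hz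
  rw [ENNReal.top_rpow_of_pos (by linarith [hpq.two_lt_toReal])] at hz
  exact lt_irrefl _ hz

/-! ### Solving h + A h = f for a contraction A -/

section Contraction

variable {α E : Type*} {m : MeasurableSpace α} [NormedAddCommGroup E] {μ : Measure α}
  {p θ : ℝ≥0∞} {A : (α → E) → α → E}

/-- Banach's fixed point theorem for h ↦ f - A h on `Lp`. As A acts on functions and not on classes,
it is applied to the representative of each class. -/
theorem exists_add_ae_eq_of_contraction [CompleteSpace E] (hp : 1 ≤ p) (hθ : θ < 1)
    (hA : ∀ h, MemLp h p μ → MemLp (A h) p μ)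
    (hc : ∀ h h', MemLp h p μ → MemLp h' p μ → eLpNorm (A h - A h') p μ ≤ θ * eLpNorm (h - h') p μ)
    {f : α → E} (hf : MemLp f p μ) : ∃ h, MemLp h p μ ∧ h + A h =ᵐ[μ] f := by
  have : Fact (1 ≤ p) := ⟨hp⟩
  let Φ : Lp E p μ → Lp E p μ := fun h => (hf.sub (hA h (Lp.memLp h))).toLp
  lift θ to NNReal using (hθ.trans ENNReal.one_lt_top).ne
  have hΦ : ContractingWith θ Φ := by
    refine ⟨by exact_mod_cast hθ, fun h h' => ?_⟩
    rw [Lp.edist_toLp_toLp, sub_sub_sub_cancel_left, Lp.edist_def,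
      eLpNorm_sub_comm]
    exact hc h h' (Lp.memLp h) (Lp.memLp h')
  refine ⟨hΦ.fixedPoint, Lp.memLp _, ?_⟩
  have hfix : Φ hΦ.fixedPoint = hΦ.fixedPoint := hΦ.fixedPoint_isFixedPt
  have h1 : (hΦ.fixedPoint : α → E) =ᵐ[μ] f - A hΦ.fixedPoint := by
    nth_rewrite 1 [← hfix]
    exact MemLp.coeFn_toLp _
  filter_upwards [h1] with x hx
  simp only [Pi.add_apply]
  nth_rewrite 1 [hx]
  simp

theorem ae_eq_of_add_ae_eq_of_contraction (hp : 1 ≤ p) (hθ : θ < 1)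
    (hc : ∀ h h', MemLp h p μ → MemLp h' p μ → eLpNorm (A h - A h') p μ ≤ θ * eLpNorm (h - h') p μ)
    {h h' : α → E} (hh : MemLp h p μ) (hh' : MemLp h' p μ) (heq : h + A h =ᵐ[μ] h' + A h') :
    h =ᵐ[μ] h' := by
  have h1 : h - h' =ᵐ[μ] -(A h - A h') := by
    filter_upwards [heq] with x hx
    simp only [Pi.add_apply, Pi.sub_apply, Pi.neg_apply] at hx ⊢
    rw [neg_sub, sub_eq_sub_iff_add_eq_add, hx, add_comm]
  have h2 := hc h h' hh hh'
  rw [← eLpNorm_neg, ← eLpNorm_congr_ae h1] at h2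
  have h3 : eLpNorm (h - h') p μ = 0 := by
    by_contra hne
    refine absurd h2 (not_le.2 ?_)
    calc θ * eLpNorm (h - h') p μ < 1 * eLpNorm (h - h') p μ :=
          (ENNReal.mul_lt_mul_iff_left hne (hh.sub hh').2.ne).2 hθ
      _ = _ := one_mul _
  rw [eLpNorm_eq_zero_iff (hh.sub hh').1 (zero_lt_one.trans_le hp).ne'] at h3
  filter_upwards [h3] with x hx
  exact sub_eq_zero.1 hx

end Contraction

/-! ### Bijectivity on L^p and improvement of integrability -/

/-- `C` bounds the operator norms of all the operators `rieszOn Ω` from `L^p` to `L^q`. -/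
def IsRieszBound (p q C : ℝ≥0∞) : Prop :=
  ∀ (Ω : Set ℂ) (f : ℂ → ℝ≥0∞), MeasurableSet Ω → AEMeasurable f (volume.restrict Ω) →
    eLpNorm (rieszOn Ω f) q volume ≤ C * eLpNorm f p (volume.restrict Ω)

theorem potentialMul_sub (U : ℂ → ℂ) (g g' : ℂ → Fin 2 → ℂ) :
    potentialMul U (g - g') = potentialMul U g - potentialMul U g' := by
  funext z
  simp only [potentialMul, Pi.sub_apply, Matrix.mulVec_sub]

theorem potentialMul_congr {μ : Measure ℂ} {U U' : ℂ → ℂ} {g g' : ℂ → Fin 2 → ℂ}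
    (hU : U =ᵐ[μ] U') (hg : g =ᵐ[μ] g') : potentialMul U g =ᵐ[μ] potentialMul U' g' := by
  filter_upwards [hU, hg] with z h1 h2
  simp only [potentialMul, h1, h2]

section Bounds

variable {p q C : ℝ≥0∞} {Ω : Set ℂ} {U : ℂ → ℂ} {h u : ℂ → Fin 2 → ℂ}

theorem IsRieszBound.eLpNorm_freeInverse_le (hC : IsRieszBound p q C) (hΩ : MeasurableSet Ω)
    (hh : AEStronglyMeasurable h (volume.restrict Ω)) :
    eLpNorm (freeInverse Ω h) q (volume.restrict Ω) ≤ C * eLpNorm h p (volume.restrict Ω) := by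
  rw [← eLpNorm_enorm h]
  refine le_trans ?_ (hC Ω _ hΩ hh.aemeasurable.enorm)
  refine (eLpNorm_mono_measure _ Measure.restrict_le_self).trans (eLpNorm_mono_enorm fun z => ?_)
  exact enorm_freeInverse_le Ω h z

theorem SobolevExponents.memLp_freeInverse (hpq : SobolevExponents p q) (hΩ : MeasurableSet Ω)
    (hh : MemLp h p (volume.restrict Ω)) :
    MemLp (freeInverse Ω h) q (volume.restrict Ω) := by
  obtain ⟨C, hC, hle⟩ := exists_eLpNorm_rieszOn_le hpq
  exact ⟨aestronglyMeasurable_freeInverse hh.1 _,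
    (IsRieszBound.eLpNorm_freeInverse_le hle hΩ hh.1).trans_lt (ENNReal.mul_lt_top hC.lt_top hh.2)⟩

theorem SobolevExponents.eLpNorm_potentialMul_le (hpq : SobolevExponents p q)
    (hU : AEStronglyMeasurable U (volume.restrict Ω))
    (hu : AEStronglyMeasurable u (volume.restrict Ω)) :
    eLpNorm (potentialMul U u) p (volume.restrict Ω) ≤
      eLpNorm U 2 (volume.restrict Ω) * eLpNorm u q (volume.restrict Ω) := by
  rw [← eLpNorm_enorm U, ← eLpNorm_enorm u]
  refine le_trans (eLpNorm_mono_enorm fun z => ?_)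
    (eLpNorm_mul_le hpq hU.aemeasurable.enorm hu.aemeasurable.enorm)
  exact enorm_potentialMul_le U u z

theorem SobolevExponents.memLp_potentialMul (hpq : SobolevExponents p q)
    (hU : MemLp U 2 (volume.restrict Ω)) (hu : MemLp u q (volume.restrict Ω)) :
    MemLp (potentialMul U u) p (volume.restrict Ω) :=
  ⟨aestronglyMeasurable_potentialMul hU.1 hu.1,
    (hpq.eLpNorm_potentialMul_le hU.1 hu.1).trans_lt (ENNReal.mul_lt_top hU.2 hu.2)⟩

theorem SobolevExponents.freeInverse_sub_ae (hpq : SobolevExponents p q) (hΩ : MeasurableSet Ω)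
    {h' : ℂ → Fin 2 → ℂ} (hh : MemLp h p (volume.restrict Ω)) (hh' : MemLp h' p (volume.restrict Ω)) :
    freeInverse Ω (h - h') =ᵐ[volume.restrict Ω] freeInverse Ω h - freeInverse Ω h' := by
  refine ae_restrict_of_ae ?_
  filter_upwards [ae_freeIntegrable hΩ hpq hh, ae_freeIntegrable hΩ hpq hh'] with z h1 h2
  exact freeInverse_sub h1 h2

theorem IsRieszBound.contraction_left (hC : IsRieszBound p q C) (hpq : SobolevExponents p q)
    (hΩ : MeasurableSet Ω) (hU : MemLp U 2 (volume.restrict Ω)) {h' : ℂ → Fin 2 → ℂ}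
    (hh : MemLp h p (volume.restrict Ω)) (hh' : MemLp h' p (volume.restrict Ω)) :
    eLpNorm (potentialMul U (freeInverse Ω h) - potentialMul U (freeInverse Ω h')) p
      (volume.restrict Ω) ≤
      (C * eLpNorm U 2 (volume.restrict Ω)) * eLpNorm (h - h') p (volume.restrict Ω) := by
  rw [← potentialMul_sub, ← eLpNorm_congr_ae
    (potentialMul_congr (EventuallyEq.refl _ U) (hpq.freeInverse_sub_ae hΩ hh hh'))]
  refine (hpq.eLpNorm_potentialMul_le hU.1
    (aestronglyMeasurable_freeInverse (hh.sub hh').1 _)).trans ?_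
  rw [mul_comm C, mul_assoc]
  gcongr
  exact hC.eLpNorm_freeInverse_le hΩ (hh.sub hh').1

/-- The same two estimates composed in the other order, on L^q instead of L^p; this form serves the
regularity of solutions. -/
theorem IsRieszBound.contraction_right (hC : IsRieszBound p q C) (hpq : SobolevExponents p q)
    (hΩ : MeasurableSet Ω) (hU : MemLp U 2 (volume.restrict Ω)) {u' : ℂ → Fin 2 → ℂ}
    (hu : MemLp u q (volume.restrict Ω)) (hu' : MemLp u' q (volume.restrict Ω)) :
    eLpNorm (freeInverse Ω (potentialMul U u) - freeInverse Ω (potentialMul U u')) q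
      (volume.restrict Ω) ≤
      (C * eLpNorm U 2 (volume.restrict Ω)) * eLpNorm (u - u') q (volume.restrict Ω) := by
  rw [← eLpNorm_congr_ae (hpq.freeInverse_sub_ae hΩ (hpq.memLp_potentialMul hU hu)
    (hpq.memLp_potentialMul hU hu')), ← potentialMul_sub]
  refine (hC.eLpNorm_freeInverse_le hΩ
    (aestronglyMeasurable_potentialMul hU.1 (hu.sub hu').1)).trans ?_
  rw [mul_assoc]
  gcongr
  exact hpq.eLpNorm_potentialMul_le hU.1 (hu.sub hu').1

theorem IsRieszBound.onePlusBijective (hC : IsRieszBound p q C) (hpq : SobolevExponents p q)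
    (hΩ : MeasurableSet Ω) (hU : MemLp U 2 (volume.restrict Ω))
    (hsmall : C * eLpNorm U 2 (volume.restrict Ω) < 1) : OnePlusBijective p Ω U where
  maps _ hh := hh.add (hpq.memLp_potentialMul hU (hpq.memLp_freeInverse hΩ hh))
  injective _ _ hh hh' heq := ae_eq_of_add_ae_eq_of_contraction
    (A := fun h => potentialMul U (freeInverse Ω h)) hpq.one_lt.le hsmall
    (fun _ _ h1 h2 => hC.contraction_left hpq hΩ hU h1 h2) hh hh' heq
  surjective _ hf := exists_add_ae_eq_of_contraction
    (A := fun h => potentialMul U (freeInverse Ω h)) hpq.one_lt.le hsmall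
    (fun _ hh => hpq.memLp_potentialMul hU (hpq.memLp_freeInverse hΩ hh))
    (fun _ _ h1 h2 => hC.contraction_left hpq hΩ hU h1 h2) hf

theorem potentialMul_add_potential (U V : ℂ → ℂ) (g : ℂ → Fin 2 → ℂ) :
    potentialMul (U + V) g = potentialMul U g + potentialMul V g := by
  funext z i
  fin_cases i
  · simp only [Fin.zero_eta, potentialMul_apply_zero, Pi.add_apply, map_add]
    ring
  · simp only [Fin.mk_one, potentialMul_apply_one, Pi.add_apply, add_mul]

/-- A solution in `L^s`, `s > 2`, of `u = I_Ω(0) (F - U u)` with `F ∈ L^p` is in `L^q`. -/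
theorem SobolevExponents.memLp_of_eq_freeInverse (hpq : SobolevExponents p q) {r s : ℝ≥0∞}
    (hrs : SobolevExponents r s) (hsq : s ≤ q) (hΩ : MeasurableSet Ω) (hfin : volume Ω ≠ ⊤)
    (hU : MemLp U 2 (volume.restrict Ω)) {F : ℂ → Fin 2 → ℂ} (hF : MemLp F p (volume.restrict Ω))
    (hu : MemLp u s (volume.restrict Ω))
    (heq : u =ᵐ[volume.restrict Ω] freeInverse Ω (F - potentialMul U u)) :
    MemLp u q (volume.restrict Ω) := by
  have : IsFiniteMeasure (volume.restrict Ω) := isFiniteMeasure_restrict.2 hfin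
  have hrp : r ≤ p := by
    rw [← ENNReal.inv_le_inv, ← hpq.inv_add_inv, ← hrs.inv_add_inv]
    gcongr
  have hps : p ≤ s := (hpq.lt_two.trans hrs.two_lt).le
  obtain ⟨C, hCt, hC⟩ := exists_eLpNorm_rieszOn_le hpq
  obtain ⟨D, hDt, hD⟩ := exists_eLpNorm_rieszOn_le hrs
  -- No smallness of U is available relative to the constant D of the exponents (r, s). A number δ
  -- is fixed such that a potential of L² norm at most δ contracts both on L^s and on L^q.
  obtain ⟨δ, hδ0, hδ⟩ : ∃ δ : ℝ, 0 < δ ∧ ENNReal.ofReal δ * (C + D + 1) = 2⁻¹ := by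
    refine ⟨(2⁻¹ / (C + D + 1)).toReal, ENNReal.toReal_pos ?_ ?_, ?_⟩
    · exact (ENNReal.div_pos (by simp) (by finiteness)).ne'
    · exact ENNReal.div_ne_top (by simp) (by simp)
    · rw [ENNReal.ofReal_toReal (ENNReal.div_ne_top (by simp) (by simp)),
        ENNReal.div_mul_cancel (by simp) (by finiteness)]
  set U₀ := hU.1.mk U with hU₀
  have hUU₀ : U =ᵐ[volume.restrict Ω] U₀ := hU.1.ae_eq_mk
  have hU₀m : StronglyMeasurable U₀ := hU.1.stronglyMeasurable_mk
  -- The potential is split at height M: the part V where |U₀| ≥ M has L² norm at most δ, and the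
  -- remainder W is bounded by M.
  obtain ⟨M, hM0, hM⟩ :=
    (hU.ae_eq hUU₀).eLpNorm_indicator_norm_ge_pos_le hU₀m hδ0
  set S : Set ℂ := {x | M ≤ ‖U₀ x‖₊} with hS
  have hSm : MeasurableSet S := measurableSet_le measurable_const hU₀m.norm.measurable
  set V := S.indicator U₀ with hV
  set W := Sᶜ.indicator U₀ with hW
  have hVW : V + W = U₀ := indicator_self_add_compl S U₀
  have hV2 : MemLp V 2 (volume.restrict Ω) := (hU.ae_eq hUU₀).indicator hSm
  have hWM : ∀ z, ‖W z‖ ≤ M := by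
    intro z
    by_cases hz : z ∈ S
    · simp [hW, hz, hM0.le]
    · simp only [hW, mem_compl_iff, hz, not_false_eq_true, indicator_of_mem]
      simp only [hS, mem_ofPred_eq, not_le, coe_nnnorm] at hz
      exact hz.le
  -- On a set of finite measure u ∈ L^s ⊆ L^p, since p < 2 < s, and the bounded factor W preserves
  -- this.
  have hWu : MemLp (potentialMul W u) p (volume.restrict Ω) := by
    refine MemLp.of_le_mul (c := M) (hu.mono_exponent hps)
      (aestronglyMeasurable_potentialMul (hU₀m.aestronglyMeasurable.indicator hSm.compl) hu.1) ?_
    refine Eventually.of_forall fun z => ?_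
    have h1 := enorm_potentialMul_le W u z
    simp only [enorm_eq_nnnorm, ← ENNReal.coe_mul, ENNReal.coe_le_coe] at h1
    refine le_trans (b := ‖W z‖ * ‖u z‖) (by exact_mod_cast h1) ?_
    gcongr
    exact hWM z
  have hsmall : ∀ B : ℝ≥0∞, B ≤ C + D + 1 → B * eLpNorm V 2 (volume.restrict Ω) < 1 := by
    intro B hB
    calc B * eLpNorm V 2 (volume.restrict Ω) ≤ (C + D + 1) * ENNReal.ofReal δ := by gcongr
      _ = 2⁻¹ := by rw [mul_comm, hδ]
      _ < 1 := by simp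
  have hC1 := hsmall C (by rw [add_assoc]; exact le_self_add)
  have hD1 := hsmall D (by rw [add_comm C D, add_assoc]; exact le_self_add)
  have hFW := hF.sub hWu
  -- The bounded part moves to the right-hand side, which becomes I_Ω(0) of an L^p function and
  -- hence lies in L^q.
  have heq' : u + freeInverse Ω (potentialMul V u) =ᵐ[volume.restrict Ω]
      freeInverse Ω (F - potentialMul W u) := by
    have h1 : freeInverse Ω (F - potentialMul U u) =
        freeInverse Ω ((F - potentialMul W u) - potentialMul V u) := by
      refine freeInverse_congr ?_
      filter_upwards [potentialMul_congr hUU₀ (EventuallyEq.refl _ u)] with z hz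
      rw [← hVW, potentialMul_add_potential] at hz
      simp only [Pi.sub_apply, hz, Pi.add_apply]
      abel
    rw [h1] at heq
    filter_upwards [heq, hrs.freeInverse_sub_ae hΩ (hFW.mono_exponent hrp)
      (hrs.memLp_potentialMul hV2 hu)] with z h2 h3
    rw [Pi.add_apply, h2, h3, Pi.sub_apply, sub_add_cancel]
  -- The equation u' + I_Ω(0)(V u') = I_Ω(0)(F - W u) is solved in L^q. As L^q ⊆ L^s here,
  -- uniqueness in L^s identifies the solution with u.
  obtain ⟨u', hu', hu'eq⟩ := exists_add_ae_eq_of_contraction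
    (A := fun u => freeInverse Ω (potentialMul V u)) (one_le_two.trans hpq.two_lt.le) hC1
    (fun _ hu => hpq.memLp_freeInverse hΩ (hpq.memLp_potentialMul hV2 hu))
    (fun _ _ h1 h2 => IsRieszBound.contraction_right hC hpq hΩ hV2 h1 h2)
    (hpq.memLp_freeInverse hΩ hFW)
  have huu' := ae_eq_of_add_ae_eq_of_contraction
    (A := fun u => freeInverse Ω (potentialMul V u)) (one_le_two.trans hrs.two_lt.le) hD1
    (fun _ _ h1 h2 => IsRieszBound.contraction_right hD hrs hΩ hV2 h1 h2)
    hu (hu'.mono_exponent hsq) (heq'.trans hu'eq.symm)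
  exact hu'.ae_eq huu'.symm

end Bounds

/-! ### The Neumann series of kernels and its positive majorant -/

/-- Linear operators on `ℂ²`. -/
abbrev Op := (Fin 2 → ℂ) →L[ℂ] (Fin 2 → ℂ)

/-- The operator on `ℂ²` defined by a matrix. -/
def matrixOp : Matrix (Fin 2) (Fin 2) ℂ ≃ₗ[ℂ] Op :=
  Matrix.toLin'.trans LinearMap.toContinuousLinearMap

theorem matrixOp_apply (A : Matrix (Fin 2) (Fin 2) ℂ) (x : Fin 2 → ℂ) :
    matrixOp A x = A *ᵥ x := rfl

theorem matrixOp_symm_mulVec (A : Op) (x : Fin 2 → ℂ) : matrixOp.symm A *ᵥ x = A x := by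
  rw [← matrixOp_apply, LinearEquiv.apply_symm_apply]

theorem enorm_op_le {A : Op} {a : ℂ} (h : ∀ x, ‖A x‖ₑ ≤ ‖a‖ₑ * ‖x‖ₑ) : ‖A‖ₑ ≤ ‖a‖ₑ := by
  rw [← ofReal_norm, ← ofReal_norm]
  refine ENNReal.ofReal_le_ofReal (A.opNorm_le_bound (norm_nonneg a) fun x => ?_)
  have := h x
  simp only [enorm_eq_nnnorm, ← ENNReal.coe_mul, ENNReal.coe_le_coe] at this
  exact_mod_cast this

theorem enorm_op_apply_le (A : Op) (x : Fin 2 → ℂ) : ‖A x‖ₑ ≤ ‖A‖ₑ * ‖x‖ₑ := by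
  simp only [enorm_eq_nnnorm, ← ENNReal.coe_mul, ENNReal.coe_le_coe]
  exact A.le_opNNNorm x

theorem enorm_op_mul_le (A B : Op) : ‖A * B‖ₑ ≤ ‖A‖ₑ * ‖B‖ₑ := by
  simp only [enorm_eq_nnnorm, ← ENNReal.coe_mul, ENNReal.coe_le_coe]
  exact nnnorm_mul_le A B

/-- The operator `diag ((z-w)⁻¹, (z̄-w̄)⁻¹)`. -/
def freeKernel (z w : ℂ) : Op :=
  matrixOp (Matrix.diagonal ![(z - w)⁻¹, (conj z - conj w)⁻¹])

/-- The operator `(0, -Ū; U, 0)`. -/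
def potentialOp (U : ℂ → ℂ) (z : ℂ) : Op :=
  matrixOp !![0, -conj (U z); U z, 0]

theorem freeKernel_apply (z w : ℂ) (x : Fin 2 → ℂ) :
    freeKernel z w x = ![(z - w)⁻¹ * x 0, (conj z - conj w)⁻¹ * x 1] := by
  funext i
  rw [freeKernel, matrixOp_apply, Matrix.mulVec_diagonal]
  fin_cases i <;> rfl

theorem enorm_freeKernel_le (z w : ℂ) : ‖freeKernel z w‖ₑ ≤ ‖(z - w)⁻¹‖ₑ := by
  refine enorm_op_le fun x => enorm_le_of_forall fun i => ?_
  rw [freeKernel_apply]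
  fin_cases i
  · simp only [Fin.zero_eta, cons_val_zero, enorm_mul]
    gcongr
    exact enorm_apply_le _ _
  · simp only [Fin.mk_one, cons_val_one, cons_val_fin_one, enorm_mul, enorm_conj_sub_inv]
    gcongr
    exact enorm_apply_le _ _

theorem enorm_potentialOp_le (U : ℂ → ℂ) (z : ℂ) : ‖potentialOp U z‖ₑ ≤ ‖U z‖ₑ :=
  enorm_op_le fun x => enorm_potentialMul_le U (fun _ => x) z

/-- The integral kernel of `(0, -Ū; U, 0) ∘ I(0)`. -/
def stepKernel (U : ℂ → ℂ) (v w : ℂ) : Op :=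
  (Real.pi : ℂ)⁻¹ • (potentialOp U v * freeKernel v w)

/-- The integral kernel of `I(0) ∘ (0, -Ū; U, 0)`. -/
def stepKernelLeft (U : ℂ → ℂ) (z v : ℂ) : Op :=
  (Real.pi : ℂ)⁻¹ • (freeKernel z v * potentialOp U v)

theorem enorm_stepKernel_le (U : ℂ → ℂ) (v w : ℂ) :
    ‖stepKernel U v w‖ₑ ≤ ‖U v‖ₑ * ‖(v - w)⁻¹‖ₑ := by
  rw [stepKernel, enorm_smul]
  refine (mul_le_of_le_one_left zero_le enorm_pi_inv_le).trans ?_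
  refine (enorm_op_mul_le _ _).trans ?_
  gcongr
  · exact enorm_potentialOp_le U v
  · exact enorm_freeKernel_le v w

theorem enorm_stepKernelLeft_le (U : ℂ → ℂ) (z v : ℂ) :
    ‖stepKernelLeft U z v‖ₑ ≤ ‖(z - v)⁻¹‖ₑ * ‖U v‖ₑ := by
  rw [stepKernelLeft, enorm_smul]
  refine (mul_le_of_le_one_left zero_le enorm_pi_inv_le).trans ?_
  refine (enorm_op_mul_le _ _).trans ?_
  gcongr
  · exact enorm_freeKernel_le z v
  · exact enorm_potentialOp_le U v

/-- The terms of the Neumann series of the integral kernel of `I_Ω(U)`. -/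
def iterKernel (Ω : Set ℂ) (U : ℂ → ℂ) : ℕ → ℂ → ℂ → Op
  | 0 => freeKernel
  | n + 1 => fun z w => -∫ v in Ω, iterKernel Ω U n z v * stepKernel U v w

/-- The terms of a series that dominates the Neumann series of the integral kernel of `I_Ω(U)`. -/
def iterMajorant (Ω : Set ℂ) (U : ℂ → ℂ) : ℕ → ℂ → ℂ → ℝ≥0∞
  | 0 => fun z w => ‖(z - w)⁻¹‖ₑ
  | n + 1 => fun z w => ∫⁻ v in Ω, iterMajorant Ω U n z v * (‖U v‖ₑ * ‖(v - w)⁻¹‖ₑ)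

variable {Ω : Set ℂ} {U : ℂ → ℂ}

/-- Valid at every point, without integrability: a divergent Bochner integral is 0 and is still
dominated. -/
theorem enorm_iterKernel_le (n : ℕ) (z w : ℂ) :
    ‖iterKernel Ω U n z w‖ₑ ≤ iterMajorant Ω U n z w := by
  induction n generalizing z w with
  | zero => exact enorm_freeKernel_le z w
  | succ n ih =>
    simp only [iterKernel, iterMajorant, enorm_neg]
    refine (enorm_integral_le_lintegral_enorm _).trans (lintegral_mono fun v => ?_)
    refine (enorm_op_mul_le _ _).trans ?_
    gcongr
    · exact ih z v
    · exact enorm_stepKernel_le U v w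

theorem stronglyMeasurable_freeKernel :
    StronglyMeasurable fun x : ℂ × ℂ => freeKernel x.1 x.2 := by
  have h1 : ∀ z w : ℂ, freeKernel z w = (z - w)⁻¹ • matrixOp (Matrix.diagonal ![1, 0]) +
      (conj z - conj w)⁻¹ • matrixOp (Matrix.diagonal ![0, 1]) := by
    intro z w
    rw [freeKernel, ← map_smul, ← map_smul, ← map_add, ← Matrix.diagonal_smul,
      ← Matrix.diagonal_smul, Matrix.diagonal_add]
    congr 2
    funext i
    fin_cases i <;> simp
  have h2 : Measurable fun x : ℂ × ℂ => (x.1 - x.2)⁻¹ := by fun_prop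
  have h3 : Measurable fun x : ℂ × ℂ => (conj x.1 - conj x.2)⁻¹ :=
    ((continuous_conj.measurable.comp measurable_fst).sub
      (continuous_conj.measurable.comp measurable_snd)).inv
  simp only [h1]
  exact (h2.stronglyMeasurable.smul_const _).add (h3.stronglyMeasurable.smul_const _)

theorem stronglyMeasurable_potentialOp (hU : StronglyMeasurable U) :
    StronglyMeasurable (potentialOp U) := by
  have h1 : potentialOp U = fun z => U z • matrixOp !![0, 0; 1, 0] +
      conj (U z) • matrixOp !![0, -1; 0, 0] := by
    funext z
    rw [potentialOp, ← map_smul matrixOp, ← map_smul matrixOp, ← map_add matrixOp]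
    congr 1
    ext i j
    fin_cases i <;> fin_cases j <;> simp
  rw [h1]
  exact (hU.smul_const _).add ((continuous_conj.comp_stronglyMeasurable hU).smul_const _)

theorem stronglyMeasurable_op_mul {α : Type*} [MeasurableSpace α]
    {f g : α → Op} (hf : StronglyMeasurable f) (hg : StronglyMeasurable g) :
    StronglyMeasurable fun x => f x * g x := hf.mul hg

theorem stronglyMeasurable_op_smul {α : Type*} [MeasurableSpace α]
    {f : α → Op} (c : ℂ) (hf : StronglyMeasurable f) :
    StronglyMeasurable fun x => c • f x := hf.const_smul c

theorem stronglyMeasurable_stepKernel (hU : StronglyMeasurable U) :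
    StronglyMeasurable fun x : ℂ × ℂ => stepKernel U x.1 x.2 :=
  stronglyMeasurable_op_smul _ (stronglyMeasurable_op_mul
    ((stronglyMeasurable_potentialOp hU).comp_measurable measurable_fst)
    stronglyMeasurable_freeKernel)

theorem stronglyMeasurable_stepKernelLeft (hU : StronglyMeasurable U) :
    StronglyMeasurable fun x : ℂ × ℂ => stepKernelLeft U x.1 x.2 :=
  stronglyMeasurable_op_smul _ (stronglyMeasurable_op_mul stronglyMeasurable_freeKernel
    ((stronglyMeasurable_potentialOp hU).comp_measurable measurable_snd))

theorem stronglyMeasurable_comp_pair {α E : Type*} [MeasurableSpace α] [TopologicalSpace E]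
    {F : ℂ → ℂ → E} (hF : StronglyMeasurable fun x : ℂ × ℂ => F x.1 x.2) {a b : α → ℂ}
    (ha : Measurable a) (hb : Measurable b) : StronglyMeasurable fun y => F (a y) (b y) :=
  hF.comp_measurable (ha.prodMk hb)

theorem stronglyMeasurable_iterKernel (hU : StronglyMeasurable U) (n : ℕ) :
    StronglyMeasurable fun x : ℂ × ℂ => iterKernel Ω U n x.1 x.2 := by
  induction n with
  | zero => exact stronglyMeasurable_freeKernel
  | succ n ih =>
    simp only [iterKernel]
    refine (StronglyMeasurable.integral_prod_right
      (f := fun (x : ℂ × ℂ) v => iterKernel Ω U n x.1 v * stepKernel U v x.2) ?_).neg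
    have hA : StronglyMeasurable fun y : (ℂ × ℂ) × ℂ => iterKernel Ω U n y.1.1 y.2 :=
      stronglyMeasurable_comp_pair ih (by fun_prop) (by fun_prop)
    have hB : StronglyMeasurable fun y : (ℂ × ℂ) × ℂ => stepKernel U y.2 y.1.2 :=
      stronglyMeasurable_comp_pair (stronglyMeasurable_stepKernel hU) (by fun_prop) (by fun_prop)
    have hAB : StronglyMeasurable fun y : (ℂ × ℂ) × ℂ =>
        iterKernel Ω U n y.1.1 y.2 * stepKernel U y.2 y.1.2 := stronglyMeasurable_op_mul hA hB
    exact hAB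

theorem measurable_iterMajorant (hU : Measurable U) (n : ℕ) :
    Measurable fun x : ℂ × ℂ => iterMajorant Ω U n x.1 x.2 := by
  induction n with
  | zero =>
    simp only [iterMajorant]
    fun_prop
  | succ n ih =>
    simp only [iterMajorant]
    refine Measurable.lintegral_prod_right'
      (f := fun y : (ℂ × ℂ) × ℂ => iterMajorant Ω U n y.1.1 y.2 *
        (‖U y.2‖ₑ * ‖(y.2 - y.1.2)⁻¹‖ₑ)) ?_
    have m1 : Measurable fun y : (ℂ × ℂ) × ℂ => (y.1.1, y.2) := by fun_prop
    exact (ih.comp m1).mul (by fun_prop)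

/-- The positive operator that dominates `(0, -Ū; U, 0) ∘ I_Ω(0)`. -/
def majorantStep (Ω : Set ℂ) (U : ℂ → ℂ) (f : ℂ → ℝ≥0∞) (v : ℂ) : ℝ≥0∞ :=
  ‖U v‖ₑ * rieszOn Ω f v

theorem measurable_majorantStep (hΩ : MeasurableSet Ω) (hU : Measurable U) {f : ℂ → ℝ≥0∞}
    (hf : AEMeasurable f (volume.restrict Ω)) : Measurable (majorantStep Ω U f) :=
  hU.enorm.mul (measurable_rieszOn hΩ hf)

/-- By Tonelli the last step of the majorant can be moved onto f; repeated n times, the n-th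
majorant acts as the Riesz operator after n positive steps. -/
theorem lintegral_iterMajorant_succ (hU : Measurable U) {f : ℂ → ℝ≥0∞}
    (hf : AEMeasurable f (volume.restrict Ω)) (n : ℕ) (z : ℂ) :
    ∫⁻ w in Ω, iterMajorant Ω U (n + 1) z w * f w =
      ∫⁻ v in Ω, iterMajorant Ω U n z v * majorantStep Ω U f v := by
  have mG := measurable_iterMajorant (Ω := Ω) hU n
  have mG1 : Measurable fun v => iterMajorant Ω U n z v := mG.comp measurable_prodMk_left
  have h1 : ∀ w, iterMajorant Ω U (n + 1) z w * f w =
      ∫⁻ v in Ω, iterMajorant Ω U n z v * (‖U v‖ₑ * ‖(v - w)⁻¹‖ₑ) * f w := by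
    intro w
    have mG2 : Measurable fun v => iterMajorant Ω U n z v * (‖U v‖ₑ * ‖(v - w)⁻¹‖ₑ) :=
      mG1.mul (by fun_prop)
    rw [lintegral_mul_const _ mG2]
    rfl
  simp_rw [h1]
  rw [lintegral_lintegral_swap]
  · refine lintegral_congr fun v => ?_
    simp only [majorantStep, rieszOn, mul_assoc]
    rw [lintegral_const_mul'', lintegral_const_mul'']
    · exact AEMeasurable.mul (by fun_prop) hf
    · exact AEMeasurable.const_mul (AEMeasurable.mul (by fun_prop) hf) _
  · refine AEMeasurable.mul (Measurable.aemeasurable ?_) hf.comp_fst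
    exact (mG1.comp measurable_snd).mul (by fun_prop)

theorem lintegral_iterMajorant (hΩ : MeasurableSet Ω) (hU : Measurable U) {f : ℂ → ℝ≥0∞}
    (hf : AEMeasurable f (volume.restrict Ω)) (n : ℕ) (z : ℂ) :
    ∫⁻ w in Ω, iterMajorant Ω U n z w * f w = rieszOn Ω ((majorantStep Ω U)^[n] f) z := by
  induction n generalizing f with
  | zero => rfl
  | succ n ih =>
    rw [lintegral_iterMajorant_succ hU hf,
      ih (measurable_majorantStep hΩ hU hf).aemeasurable]
    rfl

theorem aemeasurable_iterate_majorantStep (hΩ : MeasurableSet Ω) (hU : Measurable U) {f : ℂ → ℝ≥0∞}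
    (hf : AEMeasurable f (volume.restrict Ω)) (n : ℕ) :
    AEMeasurable ((majorantStep Ω U)^[n] f) (volume.restrict Ω) := by
  induction n with
  | zero => exact hf
  | succ n ih =>
    rw [Function.iterate_succ_apply']
    exact (measurable_majorantStep hΩ hU ih).aemeasurable

/-- Each step costs C by the Sobolev inequality and ‖U‖₂ by Hölder. The majorants thus obey the
geometric bound that governs the operators themselves. -/
theorem IsRieszBound.eLpNorm_iterate_majorantStep_le {p q C : ℝ≥0∞} (hC : IsRieszBound p q C)
    (hpq : SobolevExponents p q) (hΩ : MeasurableSet Ω) (hU : Measurable U) {f : ℂ → ℝ≥0∞}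
    (hf : AEMeasurable f (volume.restrict Ω)) (n : ℕ) :
    eLpNorm ((majorantStep Ω U)^[n] f) p (volume.restrict Ω) ≤
      (C * eLpNorm U 2 (volume.restrict Ω)) ^ n * eLpNorm f p (volume.restrict Ω) := by
  induction n with
  | zero => simp
  | succ n ih =>
    have hm := aemeasurable_iterate_majorantStep hΩ hU hf n
    rw [Function.iterate_succ_apply']
    refine (eLpNorm_mul_le hpq hU.enorm.aemeasurable
      (measurable_rieszOn hΩ hm).aemeasurable).trans ?_
    rw [eLpNorm_enorm, pow_succ', mul_assoc, mul_assoc, mul_left_comm]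
    refine mul_le_mul' le_rfl ?_
    refine (eLpNorm_mono_measure _ Measure.restrict_le_self).trans ((hC Ω _ hΩ hm).trans ?_)
    exact mul_le_mul' le_rfl ih

/-- Minkowski's inequality for the partial sums, passed to the limit by monotone convergence. -/
theorem eLpNorm_tsum_le {p : ℝ≥0∞} (hp : 1 ≤ p) (hp' : p ≠ ⊤) {μ : Measure ℂ}
    {f : ℕ → ℂ → ℝ≥0∞} (hf : ∀ n, AEMeasurable (f n) μ) :
    eLpNorm (fun z => ∑' n, f n z) p μ ≤ ∑' n, eLpNorm (f n) p μ := by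
  have hp0 : p ≠ 0 := (zero_lt_one.trans_le hp).ne'
  have hp1 : 0 < p.toReal := ENNReal.toReal_pos hp0 hp'
  have hpart : ∀ N, eLpNorm (∑ n ∈ Finset.range N, f n) p μ ≤ ∑' n, eLpNorm (f n) p μ := fun N =>
    (eLpNorm_sum_le (fun n _ => (hf n).aestronglyMeasurable) hp).trans (ENNReal.sum_le_tsum _)
  simp only [eLpNorm_eq_lintegral_rpow_enorm_toReal hp0 hp' (f := fun z => ∑' n, f n z),
    enorm_eq_self]
  rw [one_div, ENNReal.rpow_inv_le_iff hp1]
  have hlim : ∀ z, Tendsto (fun N => (∑ n ∈ Finset.range N, f n z) ^ p.toReal) atTop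
      (𝓝 ((∑' n, f n z) ^ p.toReal)) := fun z =>
    (ENNReal.continuous_rpow_const.tendsto _).comp (ENNReal.tendsto_nat_tsum _)
  have hmono : ∀ᵐ z ∂μ, Monotone fun N => (∑ n ∈ Finset.range N, f n z) ^ p.toReal := by
    refine Eventually.of_forall fun z N M hNM => ENNReal.rpow_le_rpow ?_ hp1.le
    exact Finset.sum_le_sum_of_subset (Finset.range_mono hNM)
  have := lintegral_tendsto_of_tendsto_of_monotone
    (fun N => (Finset.aemeasurable_fun_sum (Finset.range N) fun n _ => hf n).pow_const p.toReal)
    hmono (Eventually.of_forall hlim)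
  refine le_of_tendsto' this fun N => ?_
  have h1 := hpart N
  rw [eLpNorm_eq_lintegral_rpow_enorm_toReal hp0 hp', one_div, ENNReal.rpow_inv_le_iff hp1] at h1
  simpa only [enorm_eq_self, Finset.sum_apply] using h1

/-- The function that dominates the integral kernel of `I_Ω(U)`. -/
def majorant (Ω : Set ℂ) (U : ℂ → ℂ) (z w : ℂ) : ℝ≥0∞ := ∑' n, iterMajorant Ω U n z w

theorem measurable_majorant (hU : Measurable U) :
    Measurable fun x : ℂ × ℂ => majorant Ω U x.1 x.2 :=
  Measurable.tsum fun n => measurable_iterMajorant hU n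

/-- The integral is the Riesz operator applied to the sum of all iterated steps of f. That sum is in
L^p by the geometric series, so its image is in L^q and finite almost everywhere. -/
theorem IsRieszBound.lintegral_majorant_lt_top {p q C : ℝ≥0∞} (hC : IsRieszBound p q C)
    (hpq : SobolevExponents p q) (hCt : C ≠ ⊤) (hΩ : MeasurableSet Ω) (hU : Measurable U)
    (hsmall : C * eLpNorm U 2 (volume.restrict Ω) < 1) {f : ℂ → ℝ≥0∞}
    (hf : AEMeasurable f (volume.restrict Ω)) (hfp : eLpNorm f p (volume.restrict Ω) < ⊤) :
    ∀ᵐ z, ∫⁻ w in Ω, majorant Ω U z w * f w < ⊤ := by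
  have hm := aemeasurable_iterate_majorantStep hΩ hU hf
  have hm' : AEMeasurable (fun w => ∑' n, (majorantStep Ω U)^[n] f w) (volume.restrict Ω) :=
    AEMeasurable.tsum hm
  have h1 : ∀ z, ∫⁻ w in Ω, majorant Ω U z w * f w =
      rieszOn Ω (fun w => ∑' n, (majorantStep Ω U)^[n] f w) z := by
    intro z
    simp only [majorant, rieszOn, ← ENNReal.tsum_mul_left, ← ENNReal.tsum_mul_right]
    rw [lintegral_tsum, lintegral_tsum]
    · exact tsum_congr fun n => lintegral_iterMajorant hΩ hU hf n z
    · exact fun n => AEMeasurable.mul (by fun_prop) (hm n)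
    · exact fun n => AEMeasurable.mul
        ((measurable_iterMajorant hU n).comp measurable_prodMk_left).aemeasurable hf
  simp_rw [h1]
  have h2 : eLpNorm (fun w => ∑' n, (majorantStep Ω U)^[n] f w) p (volume.restrict Ω) < ⊤ := by
    refine (eLpNorm_tsum_le hpq.one_lt.le hpq.left_ne_top hm).trans_lt ?_
    refine (ENNReal.tsum_le_tsum fun n =>
      hC.eLpNorm_iterate_majorantStep_le hpq hΩ hU hf n).trans_lt ?_
    rw [ENNReal.tsum_mul_right, ENNReal.tsum_geometric]
    refine ENNReal.mul_lt_top ?_ hfp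
    rw [ENNReal.inv_lt_top]
    exact tsub_pos_of_lt hsmall
  have h3 : eLpNorm (rieszOn Ω fun w => ∑' n, (majorantStep Ω U)^[n] f w) q volume < ⊤ :=
    (hC Ω _ hΩ hm').trans_lt (ENNReal.mul_lt_top hCt.lt_top h2)
  rw [eLpNorm_lt_top_iff_lintegral_rpow_enorm_lt_top hpq.right_ne_zero hpq.ne_top] at h3
  filter_upwards [ae_lt_top ((measurable_rieszOn hΩ hm').enorm.pow_const _) h3.ne] with z hz
  rw [lt_top_iff_ne_top]
  intro htop
  simp only [enorm_eq_self, htop] at hz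
  rw [ENNReal.top_rpow_of_pos (by linarith [hpq.two_lt_toReal])] at hz
  exact lt_irrefl _ hz

/-! ### The sum of the Neumann series is a kernel of I_Ω(U) -/

variable {Ω : Set ℂ} {U : ℂ → ℂ}

/-- The integral kernel of `I_Ω(U)`, as the sum of its Neumann series. -/
def solutionKernel (Ω : Set ℂ) (U : ℂ → ℂ) (z w : ℂ) : Op :=
  open Classical in if majorant Ω U z w < ⊤ then ∑' n, iterKernel Ω U n z w else 0

theorem summable_nnnorm_iterKernel {z w : ℂ} (h : majorant Ω U z w < ⊤) :
    Summable fun n => ‖iterKernel Ω U n z w‖₊ :=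
  ENNReal.tsum_coe_ne_top_iff_summable.1
    (ne_top_of_le_ne_top h.ne (ENNReal.tsum_le_tsum fun n => enorm_iterKernel_le n z w))

theorem summable_iterKernel {z w : ℂ} (h : majorant Ω U z w < ⊤) :
    Summable fun n => iterKernel Ω U n z w :=
  (summable_nnnorm_iterKernel h).of_nnnorm

/-- The value 0 where the majorant is infinite makes the bound hold everywhere and not just almost
everywhere. -/
theorem enorm_solutionKernel_le (z w : ℂ) : ‖solutionKernel Ω U z w‖ₑ ≤ majorant Ω U z w := by
  rw [solutionKernel, enorm_eq_nnnorm]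
  split_ifs with h
  · have hs := summable_nnnorm_iterKernel h
    refine (ENNReal.coe_le_coe.2 (nnnorm_tsum_le hs)).trans ?_
    rw [ENNReal.coe_tsum hs]
    exact ENNReal.tsum_le_tsum fun n => enorm_iterKernel_le n z w
  · rw [nnnorm_zero, ENNReal.coe_zero]
    exact zero_le

theorem stronglyMeasurable_solutionKernel (hU : StronglyMeasurable U) :
    StronglyMeasurable fun x : ℂ × ℂ => solutionKernel Ω U x.1 x.2 := by
  classical
  have hS : MeasurableSet {x : ℂ × ℂ | majorant Ω U x.1 x.2 < ⊤} :=
    measurableSet_lt (measurable_majorant hU.measurable) measurable_const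
  refine stronglyMeasurable_of_tendsto (u := atTop) (f := fun (N : ℕ) (x : ℂ × ℂ) =>
    if majorant Ω U x.1 x.2 < ⊤ then ∑ n ∈ Finset.range N, iterKernel Ω U n x.1 x.2 else 0)
    (fun N => ?_) (tendsto_pi_nhds.2 fun x => ?_)
  · exact StronglyMeasurable.ite hS (Finset.stronglyMeasurable_fun_sum _ fun n _ =>
      stronglyMeasurable_iterKernel hU n) stronglyMeasurable_const
  · by_cases h : majorant Ω U x.1 x.2 < ⊤
    · simp only [solutionKernel, h, if_true]
      exact (summable_iterKernel h).hasSum.tendsto_sum_nat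
    · simp only [solutionKernel, h, if_false]
      exact tendsto_const_nhds

/-- Evaluation at a vector, as a continuous linear function of the operator. -/
def evalOp (x : Fin 2 → ℂ) : Op →L[ℂ] (Fin 2 → ℂ) := ContinuousLinearMap.apply ℂ (Fin 2 → ℂ) x

theorem integral_op_apply {μ : Measure ℂ} {A : ℂ → Op}
    (hA : Integrable A μ) (x : Fin 2 → ℂ) : (∫ v, A v ∂μ) x = ∫ v, A v x ∂μ :=
  ((evalOp x).integral_comp_comm hA).symm

theorem aestronglyMeasurable_op_apply {α : Type*} [MeasurableSpace α] {μ : Measure α}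
    {A : α → Op} {f : α → Fin 2 → ℂ} (hA : AEStronglyMeasurable A μ)
    (hf : AEStronglyMeasurable f μ) : AEStronglyMeasurable (fun x => A x (f x)) μ :=
  isBoundedBilinearMap_apply.continuous.comp_aestronglyMeasurable (hA.prodMk hf)

theorem FreeIntegrable.integrable {h : ℂ → Fin 2 → ℂ} {z : ℂ} (hz : FreeIntegrable Ω h z) :
    Integrable (fun w => freeKernel z w (h w)) (volume.restrict Ω) := by
  refine Integrable.of_eval fun i => ?_
  simp only [freeKernel_apply]
  fin_cases i
  · exact hz.1
  · exact hz.2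

theorem FreeIntegrable.freeInverse_eq {h : ℂ → Fin 2 → ℂ} {z : ℂ} (hz : FreeIntegrable Ω h z) :
    freeInverse Ω h z = (Real.pi : ℂ)⁻¹ • ∫ w in Ω, freeKernel z w (h w) := by
  have hi : ∀ i, Integrable (fun w => (freeKernel z w (h w)) i) (volume.restrict Ω) :=
    fun i => hz.integrable.eval i
  funext i
  rw [Pi.smul_apply, eval_integral hi]
  simp only [freeKernel_apply]
  fin_cases i <;> rfl

theorem potentialMul_freeInverse_eq {h : ℂ → Fin 2 → ℂ} {v : ℂ} (hv : FreeIntegrable Ω h v)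
    (A : Op) :
    ∫ w in Ω, (A * stepKernel U v w) (h w) = A (potentialMul U (freeInverse Ω h) v) := by
  have h1 : ∀ w, (A * stepKernel U v w) (h w) =
      (A * ((Real.pi : ℂ)⁻¹ • potentialOp U v)) (freeKernel v w (h w)) := fun w => rfl
  simp only [h1]
  rw [ContinuousLinearMap.integral_comp_comm _ hv.integrable]
  have h2 : ∀ x, (A * ((Real.pi : ℂ)⁻¹ • potentialOp U v)) x =
      A (potentialOp U v ((Real.pi : ℂ)⁻¹ • x)) := fun x => by
    rw [map_smul]
    rfl
  rw [h2, ← hv.freeInverse_eq]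
  rfl

/-- Fubini, justified by the majorant: the last factor of the kernel, integrated against h, is M_U
I_Ω(0) h. -/
theorem integral_iterKernel_succ (hU : StronglyMeasurable U) {h : ℂ → Fin 2 → ℂ}
    (hh : AEStronglyMeasurable h (volume.restrict Ω)) (n : ℕ) {z : ℂ}
    (hfin : ∫⁻ w in Ω, iterMajorant Ω U (n + 1) z w * ‖h w‖ₑ < ⊤)
    (hfree : ∀ᵐ v ∂(volume.restrict Ω), FreeIntegrable Ω h v) :
    ∫ w in Ω, iterKernel Ω U (n + 1) z w (h w) =
      -∫ v in Ω, iterKernel Ω U n z v (potentialMul U (freeInverse Ω h) v) := by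
  set μ := volume.restrict Ω with hμ
  have mK : StronglyMeasurable fun v => iterKernel Ω U n z v :=
    (stronglyMeasurable_iterKernel hU n).comp_measurable measurable_prodMk_left
  have mG : Measurable fun v => iterMajorant Ω U n z v :=
    (measurable_iterMajorant hU.measurable n).comp measurable_prodMk_left
  have mG' : Measurable fun v => iterMajorant Ω U (n + 1) z v :=
    (measurable_iterMajorant hU.measurable (n + 1)).comp measurable_prodMk_left
  have mKS : StronglyMeasurable fun x : ℂ × ℂ => iterKernel Ω U n z x.2 * stepKernel U x.2 x.1 :=
    stronglyMeasurable_op_mul (mK.comp_measurable measurable_snd)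
      (stronglyMeasurable_comp_pair (stronglyMeasurable_stepKernel hU) measurable_snd measurable_fst)
  have hbound : ∀ w, ∫⁻ v in Ω, ‖iterKernel Ω U n z v * stepKernel U v w‖ₑ ≤
      iterMajorant Ω U (n + 1) z w := by
    intro w
    refine lintegral_mono fun v => (enorm_op_mul_le _ _).trans ?_
    gcongr
    · exact enorm_iterKernel_le n z v
    · exact enorm_stepKernel_le U v w
  have hF : Integrable (fun x : ℂ × ℂ => (iterKernel Ω U n z x.2 * stepKernel U x.2 x.1) (h x.1))
      (μ.prod μ) := by
    have hm := aestronglyMeasurable_op_apply (μ := μ.prod μ) mKS.aestronglyMeasurable hh.comp_fst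
    refine ⟨hm, ?_⟩
    rw [HasFiniteIntegral, lintegral_prod _ hm.enorm]
    refine lt_of_le_of_lt (lintegral_mono fun w => ?_) hfin
    calc ∫⁻ v, ‖(iterKernel Ω U n z v * stepKernel U v w) (h w)‖ₑ ∂μ
        ≤ ∫⁻ v, ‖iterKernel Ω U n z v * stepKernel U v w‖ₑ * ‖h w‖ₑ ∂μ :=
          lintegral_mono fun v => enorm_op_apply_le _ _
      _ = (∫⁻ v, ‖iterKernel Ω U n z v * stepKernel U v w‖ₑ ∂μ) * ‖h w‖ₑ :=
          lintegral_mul_const _ (mKS.comp_measurable measurable_prodMk_left).enorm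
      _ ≤ _ := by
          gcongr
          exact hbound w
  have h1 : ∫ w in Ω, iterKernel Ω U (n + 1) z w (h w) =
      ∫ w in Ω, -∫ v in Ω, (iterKernel Ω U n z v * stepKernel U v w) (h w) := by
    refine integral_congr_ae ?_
    -- Finiteness of the product of the majorant with ‖h w‖ bounds the majorant only where h w ≠ 0;
    -- elsewhere both sides vanish.
    filter_upwards [ae_lt_top' (mG'.aemeasurable.mul hh.enorm) hfin.ne] with w hw
    simp only [iterKernel, _root_.neg_apply]
    by_cases h0 : h w = 0
    · simp [h0]
    · congr 1
      refine integral_op_apply ⟨(mKS.comp_measurable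
        measurable_prodMk_left).aestronglyMeasurable, (hbound w).trans_lt ?_⟩ _
      by_contra htop
      rw [not_lt, top_le_iff] at htop
      simp [htop, h0] at hw
  rw [h1, integral_neg, integral_integral_swap (f := fun w v =>
    (iterKernel Ω U n z v * stepKernel U v w) (h w)) hF]
  congr 1
  refine integral_congr_ae ?_
  filter_upwards [hfree] with v hv
  exact potentialMul_freeInverse_eq hv _

theorem integrable_op_apply_of_majorant {f : ℂ → Fin 2 → ℂ} (hf : AEStronglyMeasurable f (volume.restrict Ω)) {z : ℂ}
    (hfin : ∫⁻ w in Ω, majorant Ω U z w * ‖f w‖ₑ < ⊤) {A : ℂ → Op}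
    (hA : StronglyMeasurable A) (hAG : ∀ w, ‖A w‖ₑ ≤ majorant Ω U z w) :
    Integrable (fun w => A w (f w)) (volume.restrict Ω) := by
  refine ⟨aestronglyMeasurable_op_apply hA.aestronglyMeasurable hf, ?_⟩
  refine lt_of_le_of_lt (lintegral_mono fun w => (enorm_op_apply_le _ _).trans ?_) hfin
  gcongr
  exact hAG w

/-- Dominated summation: the integrals of the norms of the terms add up to at most the integral of
the majorant against ‖f‖. -/
theorem hasSum_integral_iterKernel (hU : StronglyMeasurable U)
    {f : ℂ → Fin 2 → ℂ} (hf : AEStronglyMeasurable f (volume.restrict Ω)) {z : ℂ}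
    (hfin : ∫⁻ w in Ω, majorant Ω U z w * ‖f w‖ₑ < ⊤) :
    HasSum (fun n => ∫ w in Ω, iterKernel Ω U n z w (f w))
      (∫ w in Ω, solutionKernel Ω U z w (f w)) := by
  have mK : ∀ n, StronglyMeasurable fun v => iterKernel Ω U n z v := fun n =>
    (stronglyMeasurable_iterKernel hU n).comp_measurable measurable_prodMk_left
  have mG : Measurable fun v => majorant Ω U z v :=
    (measurable_majorant hU.measurable).comp measurable_prodMk_left
  have hle : ∀ n w, ‖iterKernel Ω U n z w‖ₑ ≤ majorant Ω U z w := fun n w =>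
    (enorm_iterKernel_le n z w).trans (ENNReal.le_tsum n)
  have hint : ∀ n, Integrable (fun w => iterKernel Ω U n z w (f w)) (volume.restrict Ω) :=
    fun n => integrable_op_apply_of_majorant hf hfin (mK n) (hle n)
  have hsum : Summable fun n => ∫ w in Ω, ‖iterKernel Ω U n z w (f w)‖ := by
    simp_rw [fun n => integral_norm_eq_lintegral_enorm (hint n).1]
    refine ENNReal.summable_toReal (ne_top_of_le_ne_top hfin.ne ?_)
    rw [← lintegral_tsum fun n => (hint n).1.enorm]
    refine lintegral_mono fun w => ?_
    simp only [majorant, ← ENNReal.tsum_mul_right]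
    refine ENNReal.tsum_le_tsum fun n => (enorm_op_apply_le _ _).trans ?_
    gcongr
    exact enorm_iterKernel_le n z w
  have h1 := hasSum_integral_of_summable_integral_norm hint hsum
  have h2 : ∫ w in Ω, ∑' n, iterKernel Ω U n z w (f w) =
      ∫ w in Ω, solutionKernel Ω U z w (f w) := by
    refine integral_congr_ae ?_
    filter_upwards [ae_lt_top' (mG.aemeasurable.mul hf.enorm) hfin.ne] with w hw
    by_cases h0 : f w = 0
    · simp [h0]
    · have htop : majorant Ω U z w < ⊤ := by
        by_contra htop
        rw [not_lt, top_le_iff] at htop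
        simp [htop, h0] at hw
      simp only [solutionKernel, htop, if_true]
      exact ((evalOp (f w)).map_tsum (summable_iterKernel htop)).symm
  rwa [h2] at h1

theorem IsRieszBound.isInverseKernel_solutionKernel {p q C : ℝ≥0∞} (hC : IsRieszBound p q C)
    (hpq : SobolevExponents p q) (hCt : C ≠ ⊤) (hΩ : MeasurableSet Ω) (hU : StronglyMeasurable U)
    (hU2 : MemLp U 2 (volume.restrict Ω)) (hsmall : C * eLpNorm U 2 (volume.restrict Ω) < 1) :
    IsInverseKernel p Ω U (fun z w => matrixOp.symm (solutionKernel Ω U z w)) where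
  measurable i j := by
    have h1 : Continuous fun A : Op => A (Pi.single j 1) i := by fun_prop
    have h2 : ∀ A : Op, matrixOp.symm A i j = A (Pi.single j 1) i := fun A => by
      rw [← matrixOp_symm_mulVec, Matrix.mulVec_single_one, Matrix.col_apply]
    simp only [h2]
    exact (h1.comp_stronglyMeasurable (stronglyMeasurable_solutionKernel hU)).aestronglyMeasurable
  apply f g hfg := by
    obtain ⟨h, hh, hf, hg⟩ := hfg
    simp only [matrixOp_symm_mulVec]
    have hfp : MemLp f p (volume.restrict Ω) :=
      ((hC.onePlusBijective hpq hΩ hU2 hsmall).maps h hh).ae_eq hf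
    have hfin : ∀ φ : ℂ → Fin 2 → ℂ, MemLp φ p (volume.restrict Ω) →
        ∀ᵐ z ∂(volume.restrict Ω), ∫⁻ w in Ω, majorant Ω U z w * ‖φ w‖ₑ < ⊤ := fun φ hφ =>
      ae_restrict_of_ae (hC.lintegral_majorant_lt_top hpq hCt hΩ hU.measurable hsmall
        hφ.1.aemeasurable.enorm (by rw [eLpNorm_enorm]; exact hφ.2))
    have hfree := ae_restrict_of_ae (s := Ω) (ae_freeIntegrable hΩ hpq hh)
    filter_upwards [hfin f hfp, hfin h hh, hg, hfree] with z hzf hzh hzg hzfree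
    refine ⟨integrable_op_apply_of_majorant hfp.1 hzf
      ((stronglyMeasurable_solutionKernel hU).comp_measurable measurable_prodMk_left)
      (enorm_solutionKernel_le z), ?_⟩
    have mK : ∀ n, StronglyMeasurable fun v => iterKernel Ω U n z v := fun n =>
      (stronglyMeasurable_iterKernel hU n).comp_measurable measurable_prodMk_left
    have hle : ∀ n w, ‖iterKernel Ω U n z w‖ₑ ≤ majorant Ω U z w := fun n w =>
      (enorm_iterKernel_le n z w).trans (ENNReal.le_tsum n)
    -- Since f = h + M_U I_Ω(0) h, the n-th term applied to f is the difference of the n-th and the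
    -- (n+1)-st terms applied to h. The series telescopes.
    have hrec : ∀ n, ∫ w in Ω, iterKernel Ω U n z w (f w) =
        (∫ w in Ω, iterKernel Ω U n z w (h w)) - ∫ w in Ω, iterKernel Ω U (n + 1) z w (h w) := by
      intro n
      rw [integral_iterKernel_succ hU hh.1 n (lt_of_le_of_lt (lintegral_mono fun w =>
        mul_le_mul_left (ENNReal.le_tsum (n + 1)) _) hzh) hfree]
      have h1 : ∫ v in Ω, iterKernel Ω U n z v (potentialMul U (freeInverse Ω h) v) =
          ∫ v in Ω, (iterKernel Ω U n z v (f v) - iterKernel Ω U n z v (h v)) := by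
        refine integral_congr_ae ?_
        filter_upwards [hf] with v hv
        rw [← hv, onePlus, map_add, add_sub_cancel_left]
      rw [h1, integral_sub (integrable_op_apply_of_majorant hfp.1 hzf (mK n) (hle n))
        (integrable_op_apply_of_majorant hh.1 hzh (mK n) (hle n))]
      abel
    have hs1 := (hasSum_integral_iterKernel hU hfp.1 hzf).tendsto_sum_nat
    have hs2 := (hasSum_integral_iterKernel hU hh.1 hzh).summable.tendsto_atTop_zero
    -- What remains is the zeroth term, the free kernel applied to h, minus terms that tend to 0
    -- because the series for h converges.
    simp_rw [hrec, Finset.sum_range_sub'] at hs1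
    have hs3 := tendsto_nhds_unique hs1 (tendsto_const_nhds.sub hs2)
    rw [hs3, sub_zero, ← hzg, hzfree.freeInverse_eq]
    rfl

/-! ### Transposition of the kernel -/

section Transpose

variable {Ω : Set ℂ} {U : ℂ → ℂ}

theorem enorm_inv_sub_comm (z w : ℂ) : ‖(z - w)⁻¹‖ₑ = ‖(w - z)⁻¹‖ₑ := by
  rw [← neg_sub, ← neg_inv, enorm_neg]

theorem iterMajorant_succ_left (hU : Measurable U) (n : ℕ) (z w : ℂ) :
    iterMajorant Ω U (n + 1) z w =
      ∫⁻ v in Ω, ‖(z - v)⁻¹‖ₑ * ‖U v‖ₑ * iterMajorant Ω U n v w := by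
  induction n generalizing z w with
  | zero =>
    simp only [iterMajorant, mul_assoc]
  | succ n ih =>
    have mG := measurable_iterMajorant (Ω := Ω) hU n
    have h1 : ∀ v, iterMajorant Ω U (n + 1) z v * (‖U v‖ₑ * ‖(v - w)⁻¹‖ₑ) =
        ∫⁻ u in Ω, ‖(z - u)⁻¹‖ₑ * ‖U u‖ₑ * (iterMajorant Ω U n u v *
          (‖U v‖ₑ * ‖(v - w)⁻¹‖ₑ)) := by
      intro v
      have m1 : Measurable fun u => ‖(z - u)⁻¹‖ₑ * ‖U u‖ₑ * iterMajorant Ω U n u v :=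
        Measurable.mul (by fun_prop) (mG.comp measurable_prodMk_right)
      rw [ih, ← lintegral_mul_const _ m1]
      simp only [mul_assoc]
    calc iterMajorant Ω U (n + 1 + 1) z w
        = ∫⁻ v in Ω, iterMajorant Ω U (n + 1) z v * (‖U v‖ₑ * ‖(v - w)⁻¹‖ₑ) := rfl
      _ = ∫⁻ v in Ω, ∫⁻ u in Ω, ‖(z - u)⁻¹‖ₑ * ‖U u‖ₑ * (iterMajorant Ω U n u v *
          (‖U v‖ₑ * ‖(v - w)⁻¹‖ₑ)) := lintegral_congr h1
      _ = ∫⁻ u in Ω, ∫⁻ v in Ω, ‖(z - u)⁻¹‖ₑ * ‖U u‖ₑ * (iterMajorant Ω U n u v *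
          (‖U v‖ₑ * ‖(v - w)⁻¹‖ₑ)) := by
          refine lintegral_lintegral_swap (Measurable.aemeasurable ?_)
          refine Measurable.mul (by fun_prop) (Measurable.mul ?_ (by fun_prop))
          exact mG.comp measurable_swap
      _ = _ := by
          refine lintegral_congr fun u => ?_
          have m1 : Measurable fun v => iterMajorant Ω U n u v * (‖U v‖ₑ * ‖(v - w)⁻¹‖ₑ) :=
            Measurable.mul (mG.comp measurable_prodMk_left) (by fun_prop)
          rw [lintegral_const_mul _ m1]
          rfl

theorem iterMajorant_symm (hU : Measurable U) (n : ℕ) (z w : ℂ) :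
    iterMajorant Ω U n z w = iterMajorant Ω U n w z := by
  induction n generalizing z w with
  | zero => exact enorm_inv_sub_comm z w
  | succ n ih =>
    rw [iterMajorant_succ_left hU]
    simp only [iterMajorant]
    refine lintegral_congr fun v => ?_
    rw [ih v w, enorm_inv_sub_comm z v, mul_comm, mul_comm ‖U v‖ₑ]

theorem iterMajorant_conj (n : ℕ) (z w : ℂ) :
    iterMajorant Ω (fun v => conj (U v)) n z w = iterMajorant Ω U n z w := by
  induction n generalizing z w with
  | zero => rfl
  | succ n ih => simp only [iterMajorant, enorm_conj, ih]

theorem majorant_conj_symm (hU : Measurable U) (z w : ℂ) :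
    majorant Ω (fun v => conj (U v)) z w = majorant Ω U w z :=
  tsum_congr fun n => by rw [iterMajorant_conj, iterMajorant_symm hU]

theorem stepKernel_eq_zero {v w : ℂ} (h : ‖U v‖ₑ * ‖(v - w)⁻¹‖ₑ = 0) : stepKernel U v w = 0 := by
  have := enorm_stepKernel_le U v w
  rw [h, nonpos_iff_eq_zero, enorm_eq_nnnorm, ENNReal.coe_eq_zero, nnnorm_eq_zero] at this
  exact this

theorem stepKernelLeft_eq_zero {z v : ℂ} (h : ‖(z - v)⁻¹‖ₑ * ‖U v‖ₑ = 0) :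
    stepKernelLeft U z v = 0 := by
  have := enorm_stepKernelLeft_le U z v
  rw [h, nonpos_iff_eq_zero, enorm_eq_nnnorm, ENNReal.coe_eq_zero, nnnorm_eq_zero] at this
  exact this

theorem op_neg_mul (A B : Op) : -A * B = -(A * B) := rfl

theorem op_mul_neg (A B : Op) : A * -B = -(A * B) := by
  ext1 x
  exact map_neg A (B x)

theorem op_mul_smul (c : ℂ) (A B : Op) : A * (c • B) = c • (A * B) := by
  ext1 x
  exact map_smul A c (B x)

theorem op_smul_mul (c : ℂ) (A B : Op) : (c • A) * B = c • (A * B) := rfl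

theorem integral_op_mul_const {μ : Measure ℂ} {A : ℂ → Op} (hA : Integrable A μ) (B : Op) :
    (∫ v, A v ∂μ) * B = ∫ v, A v * B ∂μ :=
  (((ContinuousLinearMap.compL ℂ (Fin 2 → ℂ) (Fin 2 → ℂ) (Fin 2 → ℂ)).flip B).integral_comp_comm
    hA).symm

theorem integral_op_const_mul {μ : Measure ℂ} {A : ℂ → Op} (hA : Integrable A μ) (B : Op) :
    B * (∫ v, A v ∂μ) = ∫ v, B * A v ∂μ :=
  ((ContinuousLinearMap.compL ℂ _ _ _ B).integral_comp_comm hA).symm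

/-- The iterated kernel is a product along a chain of points, so a step may be peeled off at either
end. Fubini needs the majorant to be finite at the pair (z, w), which is therefore assumed. -/
theorem iterKernel_succ_left (hU : StronglyMeasurable U) (n : ℕ) {z w : ℂ}
    (h : iterMajorant Ω U (n + 1) z w < ⊤) :
    iterKernel Ω U (n + 1) z w = -∫ v in Ω, stepKernelLeft U z v * iterKernel Ω U n v w := by
  induction n generalizing z w with
  | zero =>
    simp only [iterKernel, stepKernel, stepKernelLeft]
    congr 2
    funext v
    rw [op_mul_smul, op_smul_mul, mul_assoc]
  | succ n ih =>
    set μ := volume.restrict Ω with hμ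
    have mK : StronglyMeasurable fun x : ℂ × ℂ => iterKernel Ω U n x.1 x.2 :=
      stronglyMeasurable_iterKernel hU n
    have mS := stronglyMeasurable_stepKernel hU
    have mL := stronglyMeasurable_stepKernelLeft hU
    have mLK : StronglyMeasurable fun x : ℂ × ℂ =>
        stepKernelLeft U z x.2 * iterKernel Ω U n x.2 x.1 :=
      stronglyMeasurable_op_mul (stronglyMeasurable_comp_pair mL measurable_const measurable_snd)
        (stronglyMeasurable_comp_pair mK measurable_snd measurable_fst)
    have mKS : ∀ u, StronglyMeasurable fun v => iterKernel Ω U n u v * stepKernel U v w := fun u =>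
      stronglyMeasurable_op_mul (stronglyMeasurable_comp_pair mK measurable_const measurable_id)
        (stronglyMeasurable_comp_pair mS measurable_id measurable_const)
    have hLK : ∀ v, ∫⁻ u in Ω, ‖stepKernelLeft U z u * iterKernel Ω U n u v‖ₑ ≤
        iterMajorant Ω U (n + 1) z v := by
      intro v
      rw [iterMajorant_succ_left hU.measurable]
      refine lintegral_mono fun u => (enorm_op_mul_le _ _).trans ?_
      gcongr
      · exact enorm_stepKernelLeft_le U z u
      · exact enorm_iterKernel_le n u v
    have hKS : ∀ u, ∫⁻ v in Ω, ‖iterKernel Ω U n u v * stepKernel U v w‖ₑ ≤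
        iterMajorant Ω U (n + 1) u w := by
      intro u
      refine lintegral_mono fun v => (enorm_op_mul_le _ _).trans ?_
      gcongr
      · exact enorm_iterKernel_le n u v
      · exact enorm_stepKernel_le U v w
    have hF : Integrable (fun x : ℂ × ℂ =>
        stepKernelLeft U z x.2 * iterKernel Ω U n x.2 x.1 * stepKernel U x.1 w) (μ.prod μ) := by
      have hm : StronglyMeasurable fun x : ℂ × ℂ =>
          stepKernelLeft U z x.2 * iterKernel Ω U n x.2 x.1 * stepKernel U x.1 w :=
        stronglyMeasurable_op_mul mLK
          (stronglyMeasurable_comp_pair mS measurable_fst measurable_const)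
      refine ⟨hm.aestronglyMeasurable, ?_⟩
      rw [HasFiniteIntegral, lintegral_prod _ hm.enorm.aemeasurable]
      refine lt_of_le_of_lt (lintegral_mono fun v => ?_) h
      calc ∫⁻ u, ‖stepKernelLeft U z u * iterKernel Ω U n u v * stepKernel U v w‖ₑ ∂μ
          ≤ ∫⁻ u, ‖stepKernelLeft U z u * iterKernel Ω U n u v‖ₑ * ‖stepKernel U v w‖ₑ ∂μ :=
            lintegral_mono fun u => enorm_op_mul_le _ _
        _ = (∫⁻ u, ‖stepKernelLeft U z u * iterKernel Ω U n u v‖ₑ ∂μ) * ‖stepKernel U v w‖ₑ :=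
            lintegral_mul_const _ (mLK.comp_measurable measurable_prodMk_left).enorm
        _ ≤ _ := by
            gcongr
            · exact hLK v
            · exact enorm_stepKernel_le U v w
    have mG : ∀ n, Measurable fun x : ℂ × ℂ => iterMajorant Ω U n x.1 x.2 := fun n =>
      measurable_iterMajorant hU.measurable n
    have hmU := hU.measurable
    have h1 : ∫ v in Ω, iterKernel Ω U (n + 1) z v * stepKernel U v w =
        ∫ v in Ω, -∫ u in Ω, stepKernelLeft U z u * iterKernel Ω U n u v * stepKernel U v w := by
      refine integral_congr_ae ?_
      have hm : Measurable fun v => iterMajorant Ω U (n + 1) z v * (‖U v‖ₑ * ‖(v - w)⁻¹‖ₑ) :=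
        Measurable.mul ((mG (n + 1)).comp measurable_prodMk_left) (by fun_prop)
      filter_upwards [ae_lt_top hm h.ne] with v hv
      -- In `ℝ≥0∞` one has ∞ · 0 = 0, so the finite product bounds the first factor only where the
      -- second is nonzero; where it is zero the step kernel vanishes.
      by_cases h0 : ‖U v‖ₑ * ‖(v - w)⁻¹‖ₑ = 0
      · simp [stepKernel_eq_zero h0]
      · have hv' : iterMajorant Ω U (n + 1) z v < ⊤ := by
          by_contra htop
          rw [not_lt, top_le_iff] at htop
          rw [htop, ENNReal.top_mul h0] at hv
          exact lt_irrefl _ hv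
        rw [ih hv', op_neg_mul, integral_op_mul_const]
        exact ⟨(mLK.comp_measurable measurable_prodMk_left).aestronglyMeasurable,
          (hLK v).trans_lt hv'⟩
    have h2 : ∫ u in Ω, ∫ v in Ω, stepKernelLeft U z u * iterKernel Ω U n u v * stepKernel U v w =
        ∫ u in Ω, -(stepKernelLeft U z u * iterKernel Ω U (n + 1) u w) := by
      refine integral_congr_ae ?_
      have hm : Measurable fun u => ‖(z - u)⁻¹‖ₑ * ‖U u‖ₑ * iterMajorant Ω U (n + 1) u w :=
        Measurable.mul (by fun_prop) ((mG (n + 1)).comp measurable_prodMk_right)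
      rw [iterMajorant_succ_left hU.measurable] at h
      filter_upwards [ae_lt_top hm h.ne] with u hu
      by_cases h0 : ‖(z - u)⁻¹‖ₑ * ‖U u‖ₑ = 0
      · simp [stepKernelLeft_eq_zero h0]
      · have hu' : iterMajorant Ω U (n + 1) u w < ⊤ := by
          by_contra htop
          rw [not_lt, top_le_iff] at htop
          rw [htop, ENNReal.mul_top h0] at hu
          exact lt_irrefl _ hu
        simp only [mul_assoc]
        rw [← integral_op_const_mul ⟨(mKS u).aestronglyMeasurable, (hKS u).trans_lt hu'⟩]
        simp only [iterKernel, op_mul_neg, neg_neg]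
    have h3 : iterKernel Ω U (n + 1 + 1) z w =
        -∫ v in Ω, iterKernel Ω U (n + 1) z v * stepKernel U v w := rfl
    rw [h3, h1, integral_neg, neg_neg, integral_integral_swap (f := fun v u =>
      stepKernelLeft U z u * iterKernel Ω U n u v * stepKernel U v w) hF, h2, integral_neg]

/-- Transposition of operators on `ℂ²`. -/
def transposeOp : Op ≃L[ℂ] Op :=
  ((matrixOp.symm.trans (Matrix.transposeLinearEquiv (Fin 2) (Fin 2) ℂ ℂ)).trans
    matrixOp).toContinuousLinearEquiv

theorem transposeOp_apply (A : Op) : transposeOp A = matrixOp (matrixOp.symm A)ᵀ := rfl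

theorem matrixOp_mul (A B : Matrix (Fin 2) (Fin 2) ℂ) :
    matrixOp (A * B) = matrixOp A * matrixOp B := by
  ext1 x
  exact (Matrix.mulVec_mulVec x A B).symm

theorem transposeOp_mul (A B : Op) : transposeOp (A * B) = transposeOp B * transposeOp A := by
  obtain ⟨A, rfl⟩ := matrixOp.surjective A
  obtain ⟨B, rfl⟩ := matrixOp.surjective B
  simp only [← matrixOp_mul, transposeOp_apply, LinearEquiv.symm_apply_apply, Matrix.transpose_mul]

theorem transposeOp_freeKernel (z w : ℂ) : transposeOp (freeKernel w z) = -freeKernel z w := by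
  rw [transposeOp_apply, freeKernel, freeKernel, LinearEquiv.symm_apply_apply,
    Matrix.diagonal_transpose, ← map_neg matrixOp, Matrix.diagonal_neg]
  congr 2
  funext i
  fin_cases i
  · simp [neg_inv]
  · simp [neg_inv]

theorem transposeOp_potentialOp (v : ℂ) :
    transposeOp (potentialOp U v) = -potentialOp (fun v => conj (U v)) v := by
  rw [transposeOp_apply, potentialOp, potentialOp, LinearEquiv.symm_apply_apply,
    ← map_neg matrixOp]
  congr 1
  ext i j
  fin_cases i <;> fin_cases j <;> simp

theorem transposeOp_stepKernel (z v : ℂ) :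
    transposeOp (stepKernel U v z) = stepKernelLeft (fun v => conj (U v)) z v := by
  rw [stepKernel, stepKernelLeft, map_smul, transposeOp_mul, transposeOp_freeKernel,
    transposeOp_potentialOp, op_neg_mul, op_mul_neg, neg_neg]

/-- Transposition reverses the chain, turns U into Ū in each potential, and gives a sign for each
potential and each free kernel. The two signs of every step cancel, and the one extra free kernel
leaves -1. -/
theorem transposeOp_iterKernel (hU : StronglyMeasurable U) (n : ℕ) {z w : ℂ}
    (h : iterMajorant Ω U n w z < ⊤) :
    transposeOp (iterKernel Ω U n w z) = -iterKernel Ω (fun v => conj (U v)) n z w := by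
  induction n generalizing z w with
  | zero => exact transposeOp_freeKernel z w
  | succ n ih =>
    have hU' : StronglyMeasurable fun v => conj (U v) := continuous_conj.comp_stronglyMeasurable hU
    have h' : iterMajorant Ω (fun v => conj (U v)) (n + 1) z w < ⊤ := by
      rwa [iterMajorant_conj, iterMajorant_symm hU.measurable]
    rw [iterKernel_succ_left hU' n h', neg_neg]
    simp only [iterKernel, map_neg]
    rw [← transposeOp.integral_comp_comm, ← integral_neg]
    refine integral_congr_ae ?_
    have hmU := hU.measurable
    have hm : Measurable fun v => iterMajorant Ω U n w v * (‖U v‖ₑ * ‖(v - z)⁻¹‖ₑ) :=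
      Measurable.mul ((measurable_iterMajorant hmU n).comp measurable_prodMk_left) (by fun_prop)
    filter_upwards [ae_lt_top hm h.ne] with v hv
    rw [transposeOp_mul, transposeOp_stepKernel]
    by_cases h0 : ‖U v‖ₑ * ‖(v - z)⁻¹‖ₑ = 0
    · have : stepKernelLeft (fun v => conj (U v)) z v = 0 := by
        refine stepKernelLeft_eq_zero ?_
        rw [enorm_conj, enorm_inv_sub_comm, mul_comm, h0]
      simp [this]
    · have hv' : iterMajorant Ω U n w v < ⊤ := by
        by_contra htop
        rw [not_lt, top_le_iff] at htop
        rw [htop, ENNReal.top_mul h0] at hv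
        exact lt_irrefl _ hv
      rw [ih hv', op_mul_neg, neg_neg]

theorem transposeOp_solutionKernel (hU : StronglyMeasurable U) (z w : ℂ) :
    transposeOp (solutionKernel Ω U w z) = -solutionKernel Ω (fun v => conj (U v)) z w := by
  have hG := majorant_conj_symm (Ω := Ω) hU.measurable z w
  by_cases h : majorant Ω U w z < ⊤
  · simp only [solutionKernel, hG, h, if_true]
    rw [transposeOp.map_tsum, ← tsum_neg]
    exact tsum_congr fun n =>
      transposeOp_iterKernel hU n ((ENNReal.le_tsum n).trans_lt h)
  · simp [solutionKernel, hG, h]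

theorem transpose_matrix_solutionKernel (hU : StronglyMeasurable U) (z w : ℂ) :
    -(matrixOp.symm (solutionKernel Ω U w z))ᵀ =
      matrixOp.symm (solutionKernel Ω (fun v => conj (U v)) z w) := by
  rw [LinearEquiv.eq_symm_apply, map_neg, ← transposeOp_apply, transposeOp_solutionKernel hU,
    neg_neg]

end Transpose

/-! ### Uniqueness of the integral kernel -/

/-- A countable family of Borel subsets of `ℂ`, stable under intersections, that generates the
Borel sets. -/
def countablePiSystem : Set (Set ℂ) :=
  sInter '' {s | s.Finite ∧ s ⊆ TopologicalSpace.countableBasis ℂ}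

theorem countable_countablePiSystem : countablePiSystem.Countable :=
  (countable_ofPred_finite_subset (TopologicalSpace.countable_countableBasis ℂ)).image _

theorem measurableSet_of_mem_countablePiSystem {A : Set ℂ} (hA : A ∈ countablePiSystem) :
    MeasurableSet A := by
  obtain ⟨s, ⟨hs, hsB⟩, rfl⟩ := hA
  exact MeasurableSet.sInter hs.countable fun t ht =>
    (TopologicalSpace.isOpen_of_mem_countableBasis (hsB ht)).measurableSet

theorem univ_mem_countablePiSystem : univ ∈ countablePiSystem :=
  ⟨∅, ⟨finite_empty, empty_subset _⟩, sInter_empty⟩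

theorem isPiSystem_countablePiSystem : IsPiSystem countablePiSystem := by
  rintro _ ⟨s, ⟨hs, hsB⟩, rfl⟩ _ ⟨t, ⟨ht, htB⟩, rfl⟩ -
  exact ⟨s ∪ t, ⟨hs.union ht, union_subset hsB htB⟩, sInter_union s t⟩

theorem generateFrom_countablePiSystem :
    borel ℂ = MeasurableSpace.generateFrom countablePiSystem := by
  refine le_antisymm ?_ (MeasurableSpace.generateFrom_le fun A hA => ?_)
  · rw [(TopologicalSpace.isBasis_countableBasis ℂ).borel_eq_generateFrom]
    refine MeasurableSpace.generateFrom_mono fun A hA => ?_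
    exact ⟨{A}, ⟨finite_singleton A, singleton_subset_iff.2 hA⟩, sInter_singleton A⟩
  · have := measurableSet_of_mem_countablePiSystem hA
    rwa [BorelSpace.measurable_eq (α := ℂ)] at this

/-- Dynkin's π-λ argument: the sets with vanishing integral are closed under complements and
countable disjoint unions. A countable generating system matters because each test set costs a null
set of z. -/
theorem ae_eq_zero_of_setIntegral_countablePiSystem {μ : Measure ℂ} {F : ℂ → ℂ}
    (hF : Integrable F μ) (h : ∀ A ∈ countablePiSystem, ∫ w in A, F w ∂μ = 0) : F =ᵐ[μ] 0 := by
  have huniv : ∫ w, F w ∂μ = 0 := by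
    rw [← setIntegral_univ]
    exact h _ univ_mem_countablePiSystem
  refine hF.ae_eq_zero_of_forall_setIntegral_eq_zero fun A hA _ => ?_
  refine MeasurableSpace.induction_on_inter (C := fun A _ => ∫ w in A, F w ∂μ = 0)
    ((BorelSpace.measurable_eq (α := ℂ)).trans generateFrom_countablePiSystem)
    isPiSystem_countablePiSystem (by simp) h (fun t ht h0 => ?_) (fun f hd hm h0 => ?_) A hA
  · have := integral_add_compl ht hF
    rwa [h0, zero_add, huniv] at this
  · rw [integral_iUnion hm hd hF.integrableOn]
    simp [h0]

section Unique

variable {p : ℝ≥0∞} {Ω : Set ℂ} {U U' : ℂ → ℂ} {K K' : ℂ → ℂ → Matrix (Fin 2) (Fin 2) ℂ}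

theorem onePlus_congr (hU : U =ᵐ[volume.restrict Ω] U') (h : ℂ → Fin 2 → ℂ) :
    onePlus Ω U h =ᵐ[volume.restrict Ω] onePlus Ω U' h := by
  filter_upwards [hU] with z hz
  simp only [onePlus, potentialMul, hz]

theorem IsInverseKernel.congr_potential (hK : IsInverseKernel p Ω U K)
    (hU : U =ᵐ[volume.restrict Ω] U') : IsInverseKernel p Ω U' K where
  measurable := hK.measurable
  apply f g := fun ⟨h, hh, hf, hg⟩ => hK.apply f g ⟨h, hh, (onePlus_congr hU h).trans hf, hg⟩

theorem IsInverseKernel.congr (hK : IsInverseKernel p Ω U K)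
    (hKK' : ∀ᵐ x ∂((volume.restrict Ω).prod (volume.restrict Ω)), K x.1 x.2 = K' x.1 x.2) :
    IsInverseKernel p Ω U K' where
  measurable i j := by
    refine (hK.measurable i j).congr ?_
    filter_upwards [hKK'] with x hx
    rw [hx]
  apply f g hfg := by
    filter_upwards [hK.apply f g hfg, Measure.ae_ae_of_ae_prod hKK'] with z hz hzK
    have h1 : (fun w => K z w *ᵥ f w) =ᵐ[volume.restrict Ω] fun w => K' z w *ᵥ f w := by
      filter_upwards [hzK] with w hw
      rw [hw]
    exact ⟨hz.1.congr h1, by rw [hz.2, integral_congr_ae h1]⟩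

theorem OnePlusBijective.exists_isInverseValue (hb : OnePlusBijective p Ω U) {f : ℂ → Fin 2 → ℂ}
    (hf : MemLp f p (volume.restrict Ω)) : ∃ g, IsInverseValue p Ω U f g :=
  (hb.surjective f hf).imp' (freeInverse Ω) fun h hh => ⟨h, hh.1, hh.2, EventuallyEq.rfl⟩

/-- Both kernels are tested on indicators of countably many sets times basis vectors. Outside one
null set of z all these integrals agree, so the rows K(z,·) agree almost everywhere, and Tonelli
gives equality on the product. -/
theorem IsInverseKernel.ae_eq (hb : OnePlusBijective p Ω U) (hfin : volume Ω ≠ ⊤)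
    (hK : IsInverseKernel p Ω U K) (hK' : IsInverseKernel p Ω U K') :
    ∀ᵐ x ∂((volume.restrict Ω).prod (volume.restrict Ω)), K x.1 x.2 = K' x.1 x.2 := by
  have : IsFiniteMeasure (volume.restrict Ω) := isFiniteMeasure_restrict.2 hfin
  have htest : ∀ A ∈ countablePiSystem, ∀ j : Fin 2, ∀ᵐ z ∂(volume.restrict Ω),
      (∀ i, Integrable (A.indicator fun w => K z w i j) (volume.restrict Ω)) ∧
      (∀ i, Integrable (A.indicator fun w => K' z w i j) (volume.restrict Ω)) ∧
      ∀ i, ∫ w in Ω, A.indicator (fun w => K z w i j) w =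
        ∫ w in Ω, A.indicator (fun w => K' z w i j) w := by
    intro A hA j
    have hAm := measurableSet_of_mem_countablePiSystem hA
    have hf : MemLp (A.indicator fun _ => (Pi.single j 1 : Fin 2 → ℂ)) p (volume.restrict Ω) :=
      (memLp_const _).indicator hAm
    obtain ⟨g, hg⟩ := hb.exists_isInverseValue hf
    have hentry : ∀ (K : ℂ → ℂ → Matrix (Fin 2) (Fin 2) ℂ) (z w : ℂ) (i : Fin 2),
        (K z w *ᵥ (A.indicator fun _ => (Pi.single j 1 : Fin 2 → ℂ)) w) i =
          A.indicator (fun w => K z w i j) w := by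
      intro K z w i
      by_cases hw : w ∈ A
      · simp [hw]
      · simp [hw]
    filter_upwards [hK.apply _ g hg, hK'.apply _ g hg] with z h1 h2
    have i1 := fun i => h1.1.eval i
    have i2 := fun i => h2.1.eval i
    have h3 := h1.2.symm.trans h2.2
    have hpi : (Real.pi : ℂ)⁻¹ ≠ 0 := by simp [Real.pi_ne_zero]
    have h4 := smul_right_injective _ hpi h3
    have h5 : ∀ i, ∫ w in Ω, A.indicator (fun w => K z w i j) w =
        ∫ w in Ω, A.indicator (fun w => K' z w i j) w := by
      intro i
      have : (∫ w in Ω, K z w *ᵥ (A.indicator fun _ => (Pi.single j 1 : Fin 2 → ℂ)) w) i =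
          (∫ w in Ω, K' z w *ᵥ (A.indicator fun _ => (Pi.single j 1 : Fin 2 → ℂ)) w) i :=
        congrFun h4 i
      rw [eval_integral i1, eval_integral i2] at this
      simpa only [hentry] using this
    simp only [hentry] at i1 i2
    exact ⟨i1, i2, h5⟩
  have hall : ∀ᵐ z ∂(volume.restrict Ω), ∀ A ∈ countablePiSystem, ∀ j : Fin 2,
      (∀ i, Integrable (A.indicator fun w => K z w i j) (volume.restrict Ω)) ∧
      (∀ i, Integrable (A.indicator fun w => K' z w i j) (volume.restrict Ω)) ∧
      ∀ i, ∫ w in Ω, A.indicator (fun w => K z w i j) w =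
        ∫ w in Ω, A.indicator (fun w => K' z w i j) w :=
    (ae_ball_iff countable_countablePiSystem).2 fun A hA => ae_all_iff.2 (htest A hA)
  have hentries : ∀ i j, ∀ᵐ x ∂((volume.restrict Ω).prod (volume.restrict Ω)),
      K x.1 x.2 i j = K' x.1 x.2 i j := by
    intro i j
    have hm : AEStronglyMeasurable (fun x : ℂ × ℂ => K x.1 x.2 i j - K' x.1 x.2 i j)
      ((volume.restrict Ω).prod (volume.restrict Ω)) :=
      (hK.measurable i j).sub (hK'.measurable i j)
    have h0 : ∫⁻ x, ‖K x.1 x.2 i j - K' x.1 x.2 i j‖ₑ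
        ∂((volume.restrict Ω).prod (volume.restrict Ω)) = 0 := by
      rw [lintegral_prod _ hm.enorm, lintegral_eq_zero_iff' hm.enorm.lintegral_prod_right']
      filter_upwards [hall] with z hz
      have hu := hz _ univ_mem_countablePiSystem j
      simp only [indicator_univ] at hu
      have h1 := ae_eq_zero_of_setIntegral_countablePiSystem ((hu.1 i).sub (hu.2.1 i)) (by
        intro A hA
        have hA' := hz A hA j
        have hAm := measurableSet_of_mem_countablePiSystem hA
        simp only [Pi.sub_apply]
        rw [integral_sub (hu.1 i).integrableOn (hu.2.1 i).integrableOn,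
          ← integral_indicator hAm, ← integral_indicator hAm, hA'.2.2 i, sub_self])
      have h2 : (fun w => ‖K z w i j - K' z w i j‖ₑ) =ᵐ[volume.restrict Ω] fun _ => 0 := by
        filter_upwards [h1] with w hw
        exact enorm_eq_zero.2 hw
      exact (lintegral_congr_ae h2).trans lintegral_zero
    rw [lintegral_eq_zero_iff' hm.enorm] at h0
    filter_upwards [h0] with x hx
    exact sub_eq_zero.1 (by simpa using hx)
  filter_upwards [ae_all_iff.2 fun i => ae_all_iff.2 (hentries i)] with x hx
  ext i j
  exact hx i j

/-- The hypotheses that make the Neumann series on `L^p(Ω)` converge. -/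
structure SmallPotential (p : ℝ≥0∞) (Ω : Set ℂ) (U : ℂ → ℂ) : Prop where
  measurableSet : MeasurableSet Ω
  volume_ne_top : volume Ω ≠ ⊤
  memLp : MemLp U 2 (volume.restrict Ω)
  small : ∃ q C : ℝ≥0∞, SobolevExponents p q ∧ C ≠ ⊤ ∧ IsRieszBound p q C ∧
    C * eLpNorm U 2 (volume.restrict Ω) < 1

namespace SmallPotential

theorem congr (h : SmallPotential p Ω U) (hU : U =ᵐ[volume.restrict Ω] U') :
    SmallPotential p Ω U' where
  measurableSet := h.measurableSet
  volume_ne_top := h.volume_ne_top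
  memLp := h.memLp.ae_eq hU
  small := by
    rw [← eLpNorm_congr_ae hU]
    exact h.small

theorem conjugate (h : SmallPotential p Ω U) : SmallPotential p Ω (fun z => conj (U z)) where
  measurableSet := h.measurableSet
  volume_ne_top := h.volume_ne_top
  memLp := h.memLp.of_le (continuous_conj.comp_aestronglyMeasurable h.memLp.1)
    (Eventually.of_forall fun z => (Complex.norm_conj (U z)).le)
  small := by
    rw [eLpNorm_congr_norm_ae (g := U) (Eventually.of_forall fun z => Complex.norm_conj (U z))]
    exact h.small

theorem onePlusBijective (h : SmallPotential p Ω U) : OnePlusBijective p Ω U := by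
  obtain ⟨q, C, hpq, -, hC, hs⟩ := h.small
  exact hC.onePlusBijective hpq h.measurableSet h.memLp hs

theorem isInverseKernel (h : SmallPotential p Ω U) (hU : StronglyMeasurable U) :
    IsInverseKernel p Ω U (fun z w => matrixOp.symm (solutionKernel Ω U z w)) := by
  obtain ⟨q, C, hpq, hCt, hC, hs⟩ := h.small
  exact hC.isInverseKernel_solutionKernel hpq hCt h.measurableSet hU h.memLp hs

theorem exists_isInverseKernel (h : SmallPotential p Ω U) : ∃ K, IsInverseKernel p Ω U K :=
  ⟨_, ((h.congr h.memLp.1.ae_eq_mk).isInverseKernel h.memLp.1.stronglyMeasurable_mk).congr_potential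
    h.memLp.1.ae_eq_mk.symm⟩

/-- By uniqueness K may be replaced by the Neumann kernel, for which the transposition identity
holds pointwise. -/
theorem isInverseKernel_transpose (h : SmallPotential p Ω U) (hK : IsInverseKernel p Ω U K) :
    IsInverseKernel p Ω (fun z => conj (U z)) (fun z w => -(K w z)ᵀ) := by
  -- The pointwise identities for the series use a potential that is strongly measurable, so U is
  -- replaced by a representative.
  set V := h.memLp.1.mk U
  have hUV : U =ᵐ[volume.restrict Ω] V := h.memLp.1.ae_eq_mk
  have hV : StronglyMeasurable V := h.memLp.1.stronglyMeasurable_mk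
  have hsV := h.congr hUV
  have h1 := (hK.congr_potential hUV).ae_eq hsV.onePlusBijective h.volume_ne_top
    (hsV.isInverseKernel hV)
  have h2 := (Measure.measurePreserving_swap (μ := volume.restrict Ω)
    (ν := volume.restrict Ω)).quasiMeasurePreserving.ae h1
  have h3 := hsV.conjugate.isInverseKernel (continuous_conj.comp_stronglyMeasurable hV)
  refine (h3.congr_potential ?_).congr ?_
  · filter_upwards [hUV] with z hz
    rw [hz]
  · filter_upwards [h2] with x hx
    exact (transpose_matrix_solutionKernel hV _ _).symm.trans
      (congrArg (fun M : Matrix (Fin 2) (Fin 2) ℂ => -Mᵀ) hx.symm)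

end SmallPotential

end Unique

/-! ### Wirtinger calculus and test functions -/

section Wirtinger

variable {f g : ℂ → ℂ} {z : ℂ}

theorem fderiv_real_eq (g : ℂ → ℂ) (z v : ℂ) :
    fderiv ℝ g z v = v.re * fderiv ℝ g z 1 + v.im * fderiv ℝ g z I := by
  conv_lhs => rw [show v = v.re • (1 : ℂ) + v.im • I by
    simp [Complex.real_smul, Complex.re_add_im]]
  rw [map_add, map_smul, map_smul, Complex.real_smul, Complex.real_smul]

theorem fderiv_eq_del_dbar (g : ℂ → ℂ) (z v : ℂ) :
    fderiv ℝ g z v = del g z * v + dbar g z * conj v := by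
  rw [fderiv_real_eq, del, dbar]
  have h1 : v = v.re + v.im * I := (Complex.re_add_im v).symm
  have h2 : conj v = v.re - v.im * I := by
    apply Complex.ext <;> simp
  rw [h2]
  generalize (v.re : ℂ) = a at *
  generalize (v.im : ℂ) = b at *
  rw [h1]
  linear_combination (b * fderiv ℝ g z I) * Complex.I_sq

theorem dbar_mul (hf : DifferentiableAt ℝ f z) (hg : DifferentiableAt ℝ g z) :
    dbar (fun x => f x * g x) z = f z * dbar g z + g z * dbar f z := by
  have : fderiv ℝ (fun x => f x * g x) z = f z • fderiv ℝ g z + g z • fderiv ℝ f z :=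
    fderiv_mul hf hg
  simp only [dbar, this, _root_.add_apply, _root_.smul_apply, smul_eq_mul]
  ring

theorem del_mul (hf : DifferentiableAt ℝ f z) (hg : DifferentiableAt ℝ g z) :
    del (fun x => f x * g x) z = f z * del g z + g z * del f z := by
  have : fderiv ℝ (fun x => f x * g x) z = f z • fderiv ℝ g z + g z • fderiv ℝ f z :=
    fderiv_mul hf hg
  simp only [del, this, _root_.add_apply, _root_.smul_apply, smul_eq_mul]
  ring

theorem fderiv_conj (hg : DifferentiableAt ℝ g z) (v : ℂ) :
    fderiv ℝ (fun x => conj (g x)) z v = conj (fderiv ℝ g z v) := by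
  have h := (conjCLE : ℂ →L[ℝ] ℂ).hasFDerivAt.comp z hg.hasFDerivAt
  have h' : HasFDerivAt (fun x => conj (g x)) ((conjCLE : ℂ →L[ℝ] ℂ).comp (fderiv ℝ g z)) z := h
  rw [h'.fderiv]
  simp

theorem dbar_conj (hg : DifferentiableAt ℝ g z) :
    dbar (fun x => conj (g x)) z = conj (del g z) := by
  simp only [dbar, del, fderiv_conj hg, map_div₀, map_sub, map_mul, conj_I, map_ofNat]
  ring

theorem dbar_congr (h : f =ᶠ[𝓝 z] g) : dbar f z = dbar g z := by
  simp only [dbar, h.fderiv_eq]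

theorem del_congr (h : f =ᶠ[𝓝 z] g) : del f z = del g z := by
  simp only [del, h.fderiv_eq]

theorem continuous_dbar (hg : ContDiff ℝ 1 g) : Continuous (dbar g) := by
  have := hg.continuous_fderiv one_ne_zero
  unfold dbar
  fun_prop

theorem continuous_del (hg : ContDiff ℝ 1 g) : Continuous (del g) := by
  have := hg.continuous_fderiv one_ne_zero
  unfold del
  fun_prop

theorem dbar_eq_zero_of_notMem_tsupport (hz : z ∉ tsupport g) : dbar g z = 0 := by
  rw [dbar_congr (notMem_tsupport_iff_eventuallyEq.1 hz)]
  simp [dbar]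

theorem del_eq_zero_of_notMem_tsupport (hz : z ∉ tsupport g) : del g z = 0 := by
  rw [del_congr (notMem_tsupport_iff_eventuallyEq.1 hz)]
  simp [del]

end Wirtinger

namespace IsTestFunction

variable {Ω Ω' : Set ℂ} {f g : ℂ → ℂ}

theorem mono (hg : IsTestFunction Ω g) (h : Ω ⊆ Ω') : IsTestFunction Ω' g :=
  ⟨hg.smooth, hg.compact, hg.support.trans h⟩

theorem contDiff_one (hg : IsTestFunction Ω g) : ContDiff ℝ 1 g :=
  hg.smooth.of_le (by exact_mod_cast le_top)

theorem differentiable (hg : IsTestFunction Ω g) : Differentiable ℝ g :=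
  hg.contDiff_one.differentiable one_ne_zero

theorem continuous (hg : IsTestFunction Ω g) : Continuous g := hg.smooth.continuous

theorem continuous_dbar (hg : IsTestFunction Ω g) : Continuous (dbar g) :=
  QuaternionicCauchy.continuous_dbar hg.contDiff_one

theorem continuous_del (hg : IsTestFunction Ω g) : Continuous (del g) :=
  QuaternionicCauchy.continuous_del hg.contDiff_one

theorem hasCompactSupport_dbar (hg : IsTestFunction Ω g) : HasCompactSupport (dbar g) :=
  HasCompactSupport.intro hg.compact fun _ => dbar_eq_zero_of_notMem_tsupport

theorem hasCompactSupport_del (hg : IsTestFunction Ω g) : HasCompactSupport (del g) :=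
  HasCompactSupport.intro hg.compact fun _ => del_eq_zero_of_notMem_tsupport

theorem mul_left (hg : IsTestFunction Ω g) (hf : ContDiff ℝ ∞ f) :
    IsTestFunction Ω (fun x => g x * f x) where
  smooth := hg.smooth.mul hf
  compact := hg.compact.mul_right
  support := (closure_mono fun _ => mt fun h => by simp [h]).trans hg.support

theorem conjugate (hg : IsTestFunction Ω g) : IsTestFunction Ω (fun x => conj (g x)) where
  smooth := conjCLE.contDiff.comp hg.smooth
  compact := hg.compact.comp_left (map_zero conj)
  support := (closure_mono fun _ => mt fun h => by simp [h]).trans hg.support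

end IsTestFunction

theorem exists_isTestFunction_eq_one {S Ω : Set ℂ} (hS : IsCompact S) (hΩ : IsOpen Ω)
    (h : S ⊆ Ω) : ∃ ρ, IsTestFunction Ω ρ ∧ ∀ z ∈ S, ∀ᶠ x in 𝓝 z, ρ x = 1 := by
  obtain ⟨T, hT, hST, hTΩ⟩ := exists_compact_between hS hΩ h
  obtain ⟨ρ, h1, h0, -⟩ := exists_contMDiffMap_one_nhds_of_subset_interior (n := ⊤)
    (modelWithCornersSelf ℝ ℂ) hS.isClosed hST
  have hsupp : tsupport (fun x => (ρ x : ℂ)) ⊆ T :=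
    closure_minimal (fun x hx => by
      by_contra hxT
      simp [h0 x hxT] at hx) hT.isClosed
  refine ⟨fun x => ρ x, ⟨ofRealCLM.contDiff.comp ρ.contMDiff.contDiff,
    hT.of_isClosed_subset (isClosed_tsupport _) hsupp, hsupp.trans hTΩ⟩, fun z hz => ?_⟩
  filter_upwards [(eventually_nhdsSet_iff_forall.1 h1) z hz] with x hx
  simp [hx]

/-! ### The Cauchy–Pompeiu formula and the Cauchy transform -/

section Pompeiu

variable {χ : ℂ → ℂ}

theorem integral_fderiv_radial (hχ : ContDiff ℝ 1 χ) (hc : HasCompactSupport χ) (w e : ℂ)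
    (he : e ≠ 0) : ∫ r in Ioi (0 : ℝ), fderiv ℝ χ (w - r * e) e = χ w := by
  have hd : ∀ r : ℝ, HasDerivAt (fun r : ℝ => χ (w - r * e)) (-fderiv ℝ χ (w - r * e) e) r := by
    intro r
    have h1 : HasDerivAt (fun r : ℝ => w - r * e) (-e) r := by
      simpa using ((Complex.ofRealCLM.hasDerivAt (x := r)).mul_const e).const_sub w
    have := ((hχ.differentiable one_ne_zero) (w - r * e)).hasFDerivAt.comp_hasDerivAt r h1
    exact this.congr_deriv (map_neg _ _)
  have hemb : IsClosedEmbedding (fun r : ℝ => w - r * e) := by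
    have hm : IsClosedEmbedding (fun r : ℝ => (r : ℂ) * e) :=
      (Homeomorph.mulRight₀ e he).isClosedEmbedding.comp Complex.isometry_ofReal.isClosedEmbedding
    exact (Homeomorph.subLeft w).isClosedEmbedding.comp hm
  have hcs : HasCompactSupport (fun r : ℝ => fderiv ℝ χ (w - r * e) e) :=
    (hc.fderiv_apply ℝ e).comp_isClosedEmbedding hemb
  have hcont : Continuous (fun r : ℝ => fderiv ℝ χ (w - r * e) e) := by
    have := hχ.continuous_fderiv one_ne_zero
    fun_prop
  have h0 : Tendsto (fun r : ℝ => χ (w - r * e)) atTop (𝓝 0) :=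
    ((hc.comp_isClosedEmbedding hemb).is_zero_at_infty).mono_left atTop_le_cocompact
  have := integral_Ioi_of_hasDerivAt_of_tendsto' (a := (0 : ℝ)) (fun r _ => hd r)
    (hcont.integrable_of_hasCompactSupport hcs).neg.integrableOn h0
  rw [integral_neg] at this
  simpa using this

theorem integral_fderiv_angular (hχ : ContDiff ℝ 1 χ) (w : ℂ) {r : ℝ} (hr : r ≠ 0) :
    ∫ θ in Ioo (-Real.pi) Real.pi, fderiv ℝ χ (w - r * exp (θ * I)) (I * exp (θ * I)) = 0 := by
  have hd : ∀ θ : ℝ, HasDerivAt (fun θ : ℝ => χ (w - r * exp (θ * I)))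
      ((-r) • fderiv ℝ χ (w - r * exp (θ * I)) (I * exp (θ * I))) θ := by
    intro θ
    have h1 : HasDerivAt (fun θ : ℝ => w - r * exp (θ * I)) ((-r) • (I * exp (θ * I))) θ := by
      have h2 : HasDerivAt (fun θ : ℝ => exp (θ * I)) (exp (θ * I) * I) θ := by
        simpa using ((Complex.ofRealCLM.hasDerivAt (x := θ)).mul_const I).cexp
      refine ((h2.const_mul (r : ℂ)).const_sub w).congr_deriv ?_
      rw [Complex.real_smul]
      push_cast
      ring
    have := ((hχ.differentiable one_ne_zero) _).hasFDerivAt.comp_hasDerivAt θ h1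
    exact this.congr_deriv (map_smul _ _ _)
  have hcont : Continuous
      (fun θ : ℝ => fderiv ℝ χ (w - r * exp (θ * I)) (I * exp (θ * I))) := by
    have := hχ.continuous_fderiv one_ne_zero
    fun_prop
  have := intervalIntegral.integral_eq_sub_of_hasDerivAt (fun θ _ => hd θ)
    ((hcont.const_smul (-r)).intervalIntegrable (-Real.pi) Real.pi)
  rw [intervalIntegral.integral_smul] at this
  have h2 : exp ((Real.pi : ℝ) * I) = exp ((-Real.pi : ℝ) * I) := by
    rw [Complex.exp_pi_mul_I]
    push_cast
    rw [neg_mul, Complex.exp_neg, Complex.exp_pi_mul_I]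
    norm_num
  rw [h2, sub_self, smul_eq_zero] at this
  rw [← integral_Ioc_eq_integral_Ioo, ← intervalIntegral.integral_of_le
    (by linarith [Real.pi_pos])]
  exact this.resolve_left (neg_ne_zero.2 hr)

theorem integrableOn_fderiv_polar (hχ : ContDiff ℝ 1 χ) (hc : HasCompactSupport χ) (w c : ℂ) :
    IntegrableOn (fun x : ℝ × ℝ => fderiv ℝ χ (w - x.1 * exp (x.2 * I)) (c * exp (x.2 * I)))
      (Ioi (0 : ℝ) ×ˢ Ioo (-Real.pi) Real.pi) := by
  obtain ⟨R, hR⟩ := hc.isCompact.isBounded.subset_closedBall w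
  have hcont : Continuous
      (fun x : ℝ × ℝ => fderiv ℝ χ (w - x.1 * exp (x.2 * I)) (c * exp (x.2 * I))) := by
    have := hχ.continuous_fderiv one_ne_zero
    fun_prop
  refine IntegrableOn.of_forall_sdiff_eq_zero
    (hcont.continuousOn.integrableOn_compact
      ((isCompact_Icc (a := (0 : ℝ)) (b := R)).prod (isCompact_Icc (a := -Real.pi) (b := Real.pi))))
    (measurableSet_Ioi.prod measurableSet_Ioo) ?_
  rintro ⟨r, θ⟩ ⟨⟨hr, hθ⟩, hx⟩
  have hrR : R < r := by
    by_contra hle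
    exact hx ⟨⟨(mem_Ioi.1 hr).le, not_lt.1 hle⟩, ⟨hθ.1.le, hθ.2.le⟩⟩
  have hn : w - r * exp (θ * I) ∉ tsupport χ := by
    intro h
    have := hR h
    rw [mem_closedBall_iff_norm, sub_sub_cancel_left, norm_neg, norm_mul, norm_exp_ofReal_mul_I,
      norm_real, mul_one, Real.norm_of_nonneg (mem_Ioi.1 hr).le] at this
    linarith
  have h0 : fderiv ℝ χ (w - r * exp (θ * I)) = 0 :=
    image_eq_zero_of_notMem_tsupport fun h => hn (tsupport_fderiv_subset ℝ h)
  simp [h0]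

/-- The Cauchy–Pompeiu formula for compactly supported functions. -/
theorem integral_inv_mul_dbar (hχ : ContDiff ℝ 1 χ) (hc : HasCompactSupport χ) (w : ℂ) :
    ∫ ζ, ζ⁻¹ * dbar χ (w - ζ) = Real.pi * χ w := by
  set G : ℂ → ℝ × ℝ → ℂ := fun c x =>
    fderiv ℝ χ (w - x.1 * exp (x.2 * I)) (c * exp (x.2 * I)) with hG
  have hGi : ∀ c, IntegrableOn (G c) (Ioi (0 : ℝ) ×ˢ Ioo (-Real.pi) Real.pi) :=
    integrableOn_fderiv_polar hχ hc w
  -- In polar coordinates the Jacobian r cancels the modulus of ζ⁻¹, and e^(-iθ) ∂̄χ is half the sum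
  -- of the derivative in the direction e^(iθ) and i times the one in the direction i e^(iθ). The
  -- first integrates to χ(w) along every ray, the second to 0 around every circle.
  have hpt : ∀ x ∈ Ioi (0 : ℝ) ×ˢ Ioo (-Real.pi) Real.pi,
      x.1 • ((Complex.polarCoord.symm x)⁻¹ * dbar χ (w - Complex.polarCoord.symm x)) =
        2⁻¹ * (G 1 x + I * G I x) := by
    rintro ⟨r, θ⟩ ⟨hr, -⟩
    have hr0 : (r : ℂ) ≠ 0 := by exact_mod_cast (mem_Ioi.1 hr).ne'
    have he : Complex.polarCoord.symm (r, θ) = r * exp (θ * I) := by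
      rw [Complex.polarCoord_symm_apply, Complex.exp_mul_I]
      push_cast
      ring
    have hne := Complex.exp_ne_zero (θ * I)
    have hcc : exp (θ * I) * conj (exp (θ * I)) = 1 := by
      rw [Complex.mul_conj, Complex.normSq_eq_norm_sq, norm_exp_ofReal_mul_I]
      simp
    simp only [hG, he, fderiv_eq_del_dbar, Complex.real_smul, map_mul, conj_I, one_mul, map_one]
    field_simp
    linear_combination (-2 * dbar χ (w - r * exp (θ * I))) * hcc +
      (dbar χ (w - r * exp (θ * I)) * exp (θ * I) * conj (exp (θ * I))
        - del χ (w - r * exp (θ * I)) * exp (θ * I) ^ 2) * Complex.I_sq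
  rw [← Complex.integral_comp_polarCoord_symm,
    show polarCoord.target = Ioi (0 : ℝ) ×ˢ Ioo (-Real.pi) Real.pi from rfl,
    setIntegral_congr_fun (measurableSet_Ioi.prod measurableSet_Ioo) hpt,
    integral_const_mul, integral_add (hGi 1) ((hGi I).const_mul I), integral_const_mul]
  have h1 : ∫ x in Ioi (0 : ℝ) ×ˢ Ioo (-Real.pi) Real.pi, G 1 x = 2 * Real.pi * χ w := by
    rw [Measure.volume_eq_prod, ← setIntegral_prod_swap, setIntegral_prod]
    · have : ∀ θ : ℝ, ∫ r in Ioi (0 : ℝ), G 1 (Prod.swap (θ, r)) = χ w := fun θ => by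
        simp only [hG, Prod.swap, one_mul]
        exact integral_fderiv_radial hχ hc w _ (Complex.exp_ne_zero _)
      simp only [this, integral_const, measureReal_restrict_apply_univ, Real.volume_real_Ioo]
      rw [max_eq_left (by linarith [Real.pi_pos]), Complex.real_smul]
      push_cast
      ring
    · exact (hGi 1).swap
  have h2 : ∫ x in Ioi (0 : ℝ) ×ˢ Ioo (-Real.pi) Real.pi, G I x = 0 := by
    rw [Measure.volume_eq_prod, setIntegral_prod _ (hGi I)]
    rw [setIntegral_congr_fun measurableSet_Ioi (g := fun _ => 0) fun r hr =>
      integral_fderiv_angular hχ w (mem_Ioi.1 hr).ne']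
    simp
  rw [h1, h2]
  ring

end Pompeiu

/-- The Cauchy kernel `ζ⁻¹`, cut off outside the disc of radius `R`. -/
def truncatedInv (R : ℝ) (ζ : ℂ) : ℂ := if ‖ζ‖ < R then ζ⁻¹ else 0

theorem truncatedInv_of_lt {R : ℝ} {ζ : ℂ} (h : ‖ζ‖ < R) : truncatedInv R ζ = ζ⁻¹ := if_pos h

/-- The truncation makes the Cauchy kernel integrable on ℂ, so that convolution estimates apply. On
compact sets R can be taken so large that nothing is changed. -/
theorem integrable_truncatedInv (R : ℝ) : Integrable (truncatedInv R) := by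
  refine ⟨(Measurable.ite (measurableSet_lt measurable_norm measurable_const) measurable_inv
    measurable_const).aestronglyMeasurable, ?_⟩
  rw [hasFiniteIntegral_iff_enorm]
  refine lt_of_eq_of_lt ?_ (ENNReal.ofReal_lt_top (r := 2 * Real.pi * R))
  rw [← lintegral_inv_ball]
  refine lintegral_congr fun z => ?_
  by_cases h : ‖z‖ < R <;> simp [truncatedInv, h]

theorem locallyIntegrable_inv : LocallyIntegrable (fun ζ : ℂ => ζ⁻¹) := by
  rw [locallyIntegrable_iff]
  intro K hK
  obtain ⟨R, hR⟩ := hK.isBounded.subset_ball 0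
  refine (integrable_truncatedInv R).integrableOn.congr_fun (fun z hz => ?_) hK.measurableSet
  exact truncatedInv_of_lt (mem_ball_zero_iff.1 (hR hz))

/-- The Cauchy transform. -/
def cauchyTransform (χ : ℂ → ℂ) (z : ℂ) : ℂ := (Real.pi : ℂ)⁻¹ * ∫ ζ, ζ⁻¹ * χ (z - ζ)

theorem integral_inv_sub_mul (χ : ℂ → ℂ) (z : ℂ) :
    ∫ w, (z - w)⁻¹ * χ w = ∫ ζ, ζ⁻¹ * χ (z - ζ) := by
  rw [← integral_sub_left_eq_self (fun ζ => (z - ζ)⁻¹ * χ ζ) volume z]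
  simp

section Transform

variable {χ : ℂ → ℂ}

theorem cauchyTransform_eq_convolution (χ : ℂ → ℂ) : cauchyTransform χ =
    fun z => (Real.pi : ℂ)⁻¹ *
      convolution (fun ζ : ℂ => ζ⁻¹) χ (ContinuousLinearMap.mul ℝ ℂ) volume z :=
  rfl

theorem contDiff_cauchyTransform (hχ : ContDiff ℝ ∞ χ) (hc : HasCompactSupport χ) :
    ContDiff ℝ ∞ (cauchyTransform χ) := by
  rw [cauchyTransform_eq_convolution]
  exact contDiff_const.mul (hc.contDiff_convolution_right (n := ⊤)
    (ContinuousLinearMap.mul ℝ ℂ) locallyIntegrable_inv hχ)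

theorem fderiv_cauchyTransform (hχ : ContDiff ℝ ∞ χ) (hc : HasCompactSupport χ) (z v : ℂ) :
    fderiv ℝ (cauchyTransform χ) z v = (Real.pi : ℂ)⁻¹ * ∫ ζ, ζ⁻¹ * fderiv ℝ χ (z - ζ) v := by
  have h1 : ContDiff ℝ 1 χ := hχ.of_le (by exact_mod_cast le_top)
  have h := hc.hasFDerivAt_convolution_right (ContinuousLinearMap.mul ℝ ℂ) locallyIntegrable_inv
    h1 z
  have h2 := h.const_mul ((Real.pi : ℂ)⁻¹)
  rw [cauchyTransform_eq_convolution, h2.fderiv, _root_.smul_apply, smul_eq_mul,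
    convolution_precompR_apply _ locallyIntegrable_inv (hc.fderiv ℝ)
      (h1.continuous_fderiv one_ne_zero)]
  rfl

/-- Derivatives of the convolution fall on χ, and what results is the Cauchy–Pompeiu formula. -/
theorem dbar_cauchyTransform (hχ : ContDiff ℝ ∞ χ) (hc : HasCompactSupport χ) (z : ℂ) :
    dbar (cauchyTransform χ) z = χ z := by
  have h1 : ContDiff ℝ 1 χ := hχ.of_le (by exact_mod_cast le_top)
  have hi : ∀ v : ℂ, Integrable (fun ζ : ℂ => ζ⁻¹ * fderiv ℝ χ (z - ζ) v) := by
    intro v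
    have hcont := h1.continuous_fderiv one_ne_zero
    exact (hc.fderiv_apply ℝ v).convolutionExists_right (ContinuousLinearMap.mul ℝ ℂ)
      locallyIntegrable_inv (by fun_prop) z
  have h2 := integral_inv_mul_dbar h1 hc z
  have h3 : ∀ ζ : ℂ, ζ⁻¹ * dbar χ (z - ζ) =
      2⁻¹ * (ζ⁻¹ * fderiv ℝ χ (z - ζ) 1 + I * (ζ⁻¹ * fderiv ℝ χ (z - ζ) I)) := by
    intro ζ
    rw [dbar]
    ring
  simp only [h3] at h2
  rw [integral_const_mul, integral_add (hi 1) ((hi I).const_mul I), integral_const_mul] at h2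
  rw [dbar, fderiv_cauchyTransform hχ hc, fderiv_cauchyTransform hχ hc]
  have hpi : (Real.pi : ℂ) ≠ 0 := by exact_mod_cast Real.pi_ne_zero
  generalize (∫ ζ : ℂ, ζ⁻¹ * fderiv ℝ χ (z - ζ) 1) = a at h2 ⊢
  generalize (∫ ζ : ℂ, ζ⁻¹ * fderiv ℝ χ (z - ζ) I) = b at h2 ⊢
  field_simp
  linear_combination 2 * h2

end Transform

/-! ### Compactly supported weak solutions are Cauchy transforms -/

section Representation

variable {Ω S : Set ℂ}

theorem exists_norm_sub_lt {K S : Set ℂ} (hK : IsCompact K) (hS : IsCompact S) :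
    ∃ R : ℝ, ∀ z ∈ K, ∀ w ∈ S, ‖z - w‖ < R := by
  obtain ⟨a, ha⟩ := hK.isBounded.subset_ball 0
  obtain ⟨b, hb⟩ := hS.isBounded.subset_ball 0
  refine ⟨a + b, fun z hz w hw => (norm_sub_le z w).trans_lt (add_lt_add ?_ ?_)⟩
  · exact mem_ball_zero_iff.1 (ha hz)
  · exact mem_ball_zero_iff.1 (hb hw)

variable {h : ℂ → ℂ}

theorem locallyIntegrable_integral_inv (hS : IsCompact S) (hh : Integrable h)
    (h0 : ∀ z, z ∉ S → h z = 0) :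
    LocallyIntegrable (fun z => ∫ w, (z - w)⁻¹ * h w) := by
  rw [locallyIntegrable_iff]
  intro K hK
  obtain ⟨R, hR⟩ := exists_norm_sub_lt hK hS
  refine ((hh.integrable_convolution (ContinuousLinearMap.mul ℝ ℂ)
    (integrable_truncatedInv R)).integrableOn (s := K)).congr_fun (fun z hz => ?_)
    hK.measurableSet
  refine integral_congr_ae (Eventually.of_forall fun w => ?_)
  simp only [ContinuousLinearMap.mul_apply']
  by_cases hw : w ∈ S
  · rw [truncatedInv_of_lt (hR z hz w hw), mul_comm]
  · rw [h0 w hw, zero_mul, mul_zero]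

/-- Fubini; the minus sign is the antisymmetry of the kernel 1/(z - w). -/
theorem integral_mul_cauchyTransform (hS : IsCompact S) (hh : Integrable h)
    (h0 : ∀ z, z ∉ S → h z = 0) {φ : ℂ → ℂ} (hφ : Continuous φ) (hc : HasCompactSupport φ) :
    ∫ z, h z * cauchyTransform φ z =
      -∫ w, φ w * ((Real.pi : ℂ)⁻¹ * ∫ z, (w - z)⁻¹ * h z) := by
  obtain ⟨R, hR⟩ := exists_norm_sub_lt hc hS
  obtain ⟨B, hB⟩ := hc.exists_bound_of_continuous hφ
  have hint : Integrable
      (Function.uncurry fun w z : ℂ => φ w * (h z * truncatedInv R (w - z))) := by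
    have h1 := Integrable.convolution_integrand (ContinuousLinearMap.mul ℝ ℂ) hh
      (integrable_truncatedInv R)
    exact h1.bdd_mul (c := B) (hφ.comp continuous_fst).aestronglyMeasurable
      (Eventually.of_forall fun x => hB x.1)
  have hpt : ∀ w z : ℂ, φ w * (h z * truncatedInv R (w - z)) = φ w * ((w - z)⁻¹ * h z) := by
    intro w z
    by_cases hw : w ∈ tsupport φ
    · by_cases hz : z ∈ S
      · rw [truncatedInv_of_lt (hR w hw z hz), mul_comm (h z)]
      · simp [h0 z hz]
    · simp [image_eq_zero_of_notMem_tsupport hw]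
  have hswap := integral_integral_swap hint
  simp only [hpt] at hswap
  have hl : ∀ z, h z * cauchyTransform φ z =
      -((Real.pi : ℂ)⁻¹ * ∫ w, φ w * ((w - z)⁻¹ * h z)) := by
    intro z
    rw [cauchyTransform, ← integral_inv_sub_mul, ← mul_neg, ← integral_neg, mul_left_comm,
      ← integral_const_mul]
    congr 2
    funext w
    rw [← neg_sub w z, inv_neg]
    ring
  have hr : ∀ w, φ w * ((Real.pi : ℂ)⁻¹ * ∫ z, (w - z)⁻¹ * h z) =
      (Real.pi : ℂ)⁻¹ * ∫ z, φ w * ((w - z)⁻¹ * h z) := by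
    intro w
    rw [mul_left_comm, ← integral_const_mul]
  simp only [hl, hr]
  rw [integral_neg, integral_const_mul, integral_const_mul, hswap]

/-- By duality: every smooth compactly supported φ is ∂̄ of its Cauchy transform Cφ, so ∫uφ = ∫u
∂̄(Cφ) = -∫h Cφ = ∫φ Ch. -/
theorem ae_eq_integral_of_dbar_eq {u : ℂ → ℂ} (hΩ : IsOpen Ω) (hS : IsCompact S) (hSΩ : S ⊆ Ω)
    (hu : Integrable u) (hu0 : ∀ z, z ∉ S → u z = 0) (hh : Integrable h)
    (h0 : ∀ z, z ∉ S → h z = 0)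
    (heq : ∀ χ, IsTestFunction Ω χ → ∫ z, u z * dbar χ z = -∫ z, h z * χ z) :
    ∀ᵐ z, u z = (Real.pi : ℂ)⁻¹ * ∫ w, (z - w)⁻¹ * h w := by
  have hli : LocallyIntegrable (fun z => (Real.pi : ℂ)⁻¹ * ∫ w, (z - w)⁻¹ * h w) :=
    (locallyIntegrable_integral_inv hS hh h0).smul ((Real.pi : ℂ)⁻¹)
  have hz := ae_eq_zero_of_integral_contDiff_smul_eq_zero (hu.locallyIntegrable.sub hli) (by
    intro g hg hgc
    set φ : ℂ → ℂ := fun z => g z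
    have hφ : ContDiff ℝ ∞ φ := ofRealCLM.contDiff.comp hg
    have hφc : HasCompactSupport φ := hgc.comp_left (g := fun x : ℝ => (x : ℂ)) rfl
    -- Cφ does not have compact support in Ω. A cutoff ρ equal to 1 near S repairs this without
    -- changing the integrals, as u and h vanish off S.
    obtain ⟨ρ, hρ, hρ1⟩ := exists_isTestFunction_eq_one hS hΩ hSΩ
    have hC := contDiff_cauchyTransform hφ hφc
    have h1 := heq _ (hρ.mul_left hC)
    have h2 : ∀ z, u z * dbar (fun x => ρ x * cauchyTransform φ x) z = φ z * u z := by
      intro z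
      by_cases hzS : z ∈ S
      · have : (fun x => ρ x * cauchyTransform φ x) =ᶠ[𝓝 z] cauchyTransform φ := by
          filter_upwards [hρ1 z hzS] with x hx
          rw [hx, one_mul]
        rw [dbar_congr this, dbar_cauchyTransform hφ hφc, mul_comm]
      · rw [hu0 z hzS, zero_mul, mul_zero]
    have h3 : ∀ z, h z * (ρ z * cauchyTransform φ z) = h z * cauchyTransform φ z := by
      intro z
      by_cases hzS : z ∈ S
      · rw [(hρ1 z hzS).self_of_nhds, one_mul]
      · rw [h0 z hzS, zero_mul, zero_mul]
    simp only [h2, h3] at h1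
    rw [integral_mul_cauchyTransform hS hh h0 hφ.continuous hφc, neg_neg] at h1
    have i1 : Integrable fun z => φ z * u z := by
      obtain ⟨B, hB⟩ := hφc.exists_bound_of_continuous hφ.continuous
      exact hu.bdd_mul (c := B) hφ.continuous.aestronglyMeasurable (Eventually.of_forall hB)
    have i2 : Integrable fun z => φ z * ((Real.pi : ℂ)⁻¹ * ∫ w, (z - w)⁻¹ * h w) :=
      hli.integrable_smul_left_of_hasCompactSupport hφ.continuous hφc
    have h4 : ∀ z, g z • (u z - (Real.pi : ℂ)⁻¹ * ∫ w, (z - w)⁻¹ * h w) =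
        φ z * u z - φ z * ((Real.pi : ℂ)⁻¹ * ∫ w, (z - w)⁻¹ * h w) := by
      intro z
      rw [Complex.real_smul, mul_sub]
    refine (integral_congr_ae (Eventually.of_forall h4)).trans ?_
    rw [integral_sub i1 i2, h1, sub_self])
  filter_upwards [hz] with z hz
  exact sub_eq_zero.1 hz

/-- The second component satisfies a ∂-equation; complex conjugation turns it into a ∂̄-equation. -/
theorem ae_eq_freeInverse {u H : ℂ → Fin 2 → ℂ} (hΩ : IsOpen Ω) (hS : IsCompact S)
    (hSΩ : S ⊆ Ω) (hu : ∀ i, IntegrableOn (fun z => u z i) Ω) (hu0 : ∀ z, z ∉ S → u z = 0)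
    (hH : ∀ i, IntegrableOn (fun z => H z i) Ω) (hH0 : ∀ z, z ∉ S → H z = 0)
    (heq : ∀ χ, IsTestFunction Ω χ →
      ∫ z in Ω, u z 0 * dbar χ z = -∫ z in Ω, H z 0 * χ z ∧
      ∫ z in Ω, u z 1 * del χ z = -∫ z in Ω, H z 1 * χ z) :
    u =ᵐ[volume.restrict Ω] freeInverse Ω H := by
  have hu0' : ∀ i z, z ∉ S → u z i = 0 := fun i z hz => by rw [hu0 z hz, Pi.zero_apply]
  have hH0' : ∀ i z, z ∉ S → H z i = 0 := fun i z hz => by rw [hH0 z hz, Pi.zero_apply]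
  have hfull : ∀ f : ℂ → ℂ, (∀ z, z ∉ S → f z = 0) → ∫ z in Ω, f z = ∫ z, f z := fun f hf =>
    setIntegral_eq_integral_of_forall_compl_eq_zero fun z hz => hf z fun h => hz (hSΩ h)
  have hu' : ∀ i, Integrable (fun z => u z i) := fun i =>
    (hu i).integrable_of_forall_notMem_eq_zero fun z hz => hu0' i z fun h => hz (hSΩ h)
  have hH' : ∀ i, Integrable (fun z => H z i) := fun i =>
    (hH i).integrable_of_forall_notMem_eq_zero fun z hz => hH0' i z fun h => hz (hSΩ h)
  have e0 := ae_eq_integral_of_dbar_eq hΩ hS hSΩ (hu' 0) (hu0' 0) (hH' 0) (hH0' 0) (by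
    intro χ hχ
    have := (heq χ hχ).1
    rwa [hfull _ fun z hz => by rw [hu0' 0 z hz, zero_mul],
      hfull _ fun z hz => by rw [hH0' 0 z hz, zero_mul]] at this)
  have hconj : ∀ v : ℂ → ℂ, Integrable v → Integrable fun z => conj (v z) := fun v hv =>
    ((conjCLE : ℂ →L[ℝ] ℂ).integrable_comp hv)
  have e1 := ae_eq_integral_of_dbar_eq hΩ hS hSΩ (hconj _ (hu' 1))
    (fun z hz => by rw [hu0' 1 z hz, map_zero]) (hconj _ (hH' 1))
    (fun z hz => by rw [hH0' 1 z hz, map_zero]) (by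
    intro χ hχ
    have := (heq _ hχ.conjugate).2
    rw [hfull _ fun z hz => by rw [hu0' 1 z hz, zero_mul],
      hfull _ fun z hz => by rw [hH0' 1 z hz, zero_mul]] at this
    have h2 := congrArg conj this
    rw [map_neg, ← integral_conj, ← integral_conj] at h2
    simp only [map_mul, Complex.conj_conj] at h2
    rw [← h2]
    congr 1
    funext z
    rw [← dbar_conj (hχ.conjugate.differentiable z)]
    simp only [Complex.conj_conj])
  filter_upwards [ae_restrict_of_ae e0, ae_restrict_of_ae e1] with z h0 h1
  ext i
  fin_cases i
  · change u z 0 = (Real.pi : ℂ)⁻¹ * ∫ w in Ω, (z - w)⁻¹ * H w 0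
    rw [h0, hfull _ fun w hw => by rw [hH0' 0 w hw, mul_zero]]
  · change u z 1 = (Real.pi : ℂ)⁻¹ * ∫ w in Ω, (conj z - conj w)⁻¹ * H w 1
    rw [← Complex.conj_conj (u z 1), h1, hfull _ fun w hw => by rw [hH0' 1 w hw, mul_zero],
      map_mul, ← integral_conj]
    simp only [map_mul, map_inv₀, map_sub, Complex.conj_conj, Complex.conj_ofReal]

end Representation

/-! ### Localizing a solution by a test function -/

theorem memLp_mul_of_eq_zero {S : Set ℂ} (hS : IsCompact S) {φ v : ℂ → ℂ} {s : ℝ≥0∞}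
    (hφ : Continuous φ) (h0 : ∀ z, z ∉ S → φ z = 0) (hv : MemLp v s (volume.restrict S)) :
    MemLp (fun z => φ z * v z) s := by
  obtain ⟨B, hB⟩ := (HasCompactSupport.intro hS h0).exists_bound_of_continuous hφ
  have hv' := (memLp_indicator_iff_restrict hS.measurableSet).2 hv
  have heq : (fun z => φ z * v z) = fun z => φ z * S.indicator v z := by
    funext z
    by_cases hz : z ∈ S
    · rw [indicator_of_mem hz]
    · rw [h0 z hz, zero_mul, zero_mul]
  rw [heq]
  refine hv'.of_le_mul (c := B) (hφ.aestronglyMeasurable.mul hv'.1) (Eventually.of_forall ?_)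
  intro z
  rw [norm_mul]
  exact mul_le_mul_of_nonneg_right (hB z) (norm_nonneg _)

/-- The diagonal Dirac operator applied to `g`, acting on `ψ`. -/
def commutatorTerm (g : ℂ → ℂ) (ψ : ℂ → Fin 2 → ℂ) (z : ℂ) : Fin 2 → ℂ :=
  ![dbar g z * ψ z 0, del g z * ψ z 1]

section Localize

variable {p : ℝ≥0∞} {Ω : Set ℂ} {U : ℂ → ℂ} {ψ : ℂ → Fin 2 → ℂ} {g : ℂ → ℂ}

theorem MemLpLoc.memLp_mul {s : ℝ≥0∞} (hψ : MemLpLoc Ω s ψ) {S : Set ℂ} (hS : IsCompact S)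
    (hSΩ : S ⊆ Ω) {φ : ℂ → ℂ} (hφ : Continuous φ) (h0 : ∀ z, z ∉ S → φ z = 0) (i : Fin 2) :
    MemLp (fun z => φ z * ψ z i) s :=
  memLp_mul_of_eq_zero hS hφ h0 ((hψ S hS hSΩ).eval i)

theorem MemLpLoc.mono_exponent {s t : ℝ≥0∞} (hψ : MemLpLoc Ω t ψ) (h : s ≤ t) :
    MemLpLoc Ω s ψ := fun C hC hCΩ => by
  have : IsFiniteMeasure (volume.restrict C) :=
    isFiniteMeasure_restrict.2 hC.measure_lt_top.ne
  exact (hψ C hC hCΩ).mono_exponent h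

theorem memLp_commutatorTerm {s : ℝ≥0∞} (hψ : MemLpLoc Ω s ψ) (hg : IsTestFunction Ω g) :
    MemLp (commutatorTerm g ψ) s := by
  refine MemLp.of_eval fun i => ?_
  fin_cases i
  · exact hψ.memLp_mul hg.compact hg.support hg.continuous_dbar
      (fun z => dbar_eq_zero_of_notMem_tsupport) 0
  · exact hψ.memLp_mul hg.compact hg.support hg.continuous_del
      (fun z => del_eq_zero_of_notMem_tsupport) 1

theorem memLp_smul_of_isTestFunction {s : ℝ≥0∞} (hψ : MemLpLoc Ω s ψ) (hg : IsTestFunction Ω g) :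
    MemLp (fun z => g z • ψ z) s :=
  MemLp.of_eval fun i => hψ.memLp_mul hg.compact hg.support hg.continuous
    (fun _ => image_eq_zero_of_notMem_tsupport) i

/-- Testing the weak equation with gχ and applying Leibniz yields the weak equation of gψ, whose
right-hand side gains the commutator term. The exponent s > 2 makes U·gψ an L^r function with r > 1,
hence integrable on Ω. -/
theorem MemKernel.ae_eq_freeInverse {r s : ℝ≥0∞} (hrs : SobolevExponents r s) (hΩ : IsOpen Ω)
    (hfin : volume Ω ≠ ⊤) (hU : MemLp U 2 (volume.restrict Ω)) (hψs : MemLpLoc Ω s ψ)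
    (hψ : MemKernel Ω U ψ) (hg : IsTestFunction Ω g) :
    (fun z => g z • ψ z) =ᵐ[volume.restrict Ω]
      freeInverse Ω (commutatorTerm g ψ - potentialMul U fun z => g z • ψ z) := by
  have : IsFiniteMeasure (volume.restrict Ω) := isFiniteMeasure_restrict.2 hfin
  set u : ℂ → Fin 2 → ℂ := fun z => g z • ψ z with hu_def
  have hu : MemLp u s := memLp_smul_of_isTestFunction hψs hg
  have hF : MemLp (commutatorTerm g ψ) s := memLp_commutatorTerm hψs hg
  have hs1 : 1 ≤ s := (ENNReal.one_lt_two.trans hrs.two_lt).le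
  have hMu := hrs.memLp_potentialMul hU (hu.restrict Ω)
  have hui : ∀ i, IntegrableOn (fun z => u z i) Ω := fun i =>
    ((hu.restrict Ω).eval i).integrable hs1
  have hFi : ∀ i, IntegrableOn (fun z => commutatorTerm g ψ z i) Ω := fun i =>
    ((hF.restrict Ω).eval i).integrable hs1
  have hMi : ∀ i, IntegrableOn (fun z => potentialMul U u z i) Ω := fun i =>
    (hMu.eval i).integrable hrs.one_lt.le
  have hHi : ∀ i, IntegrableOn (fun z => (commutatorTerm g ψ - potentialMul U u) z i) Ω :=
    fun i => (hFi i).sub (hMi i)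
  have hu0 : ∀ z, z ∉ tsupport g → u z = 0 := fun z hz => by
    simp only [hu_def, image_eq_zero_of_notMem_tsupport hz, zero_smul]
  refine QuaternionicCauchy.ae_eq_freeInverse hΩ hg.compact hg.support hui hu0 hHi ?_ ?_
  · intro z hz
    ext i
    fin_cases i <;>
      simp [commutatorTerm, potentialMul, hu0 z hz, dbar_eq_zero_of_notMem_tsupport hz,
        del_eq_zero_of_notMem_tsupport hz]
  · intro χ hχ
    have hbd : ∀ {φ v : ℂ → ℂ}, Continuous φ → HasCompactSupport φ → IntegrableOn v Ω →
        IntegrableOn (fun z => v z * φ z) Ω := by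
      intro φ v hφ hφc hv
      obtain ⟨B, hB⟩ := hφc.exists_bound_of_continuous hφ
      exact hv.mul_bdd (c := B) hφ.aestronglyMeasurable (Eventually.of_forall hB)
    obtain ⟨h0, h1⟩ := hψ.2 _ (hg.mul_left hχ.smooth)
    constructor
    · have e : ∀ z, -(ψ z 0 * dbar (fun x => g x * χ x) z) - conj (U z) * ψ z 1 * (g z * χ z) =
          -(u z 0 * dbar χ z + (commutatorTerm g ψ - potentialMul U u) z 0 * χ z) := by
        intro z
        rw [dbar_mul (hg.differentiable z) (hχ.differentiable z), Pi.sub_apply, Pi.sub_apply,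
          potentialMul_apply_zero]
        simp only [commutatorTerm, hu_def, Pi.smul_apply, smul_eq_mul, cons_val_zero]
        ring
      simp only [e] at h0
      rw [integral_neg, integral_add (hbd hχ.continuous_dbar hχ.hasCompactSupport_dbar (hui 0))
        (hbd hχ.continuous hχ.compact (hHi 0))] at h0
      linear_combination -h0
    · have e : ∀ z, U z * ψ z 0 * (g z * χ z) - ψ z 1 * del (fun x => g x * χ x) z =
          -(u z 1 * del χ z + (commutatorTerm g ψ - potentialMul U u) z 1 * χ z) := by
        intro z
        rw [del_mul (hg.differentiable z) (hχ.differentiable z), Pi.sub_apply, Pi.sub_apply,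
          potentialMul_apply_one]
        simp only [commutatorTerm, hu_def, Pi.smul_apply, smul_eq_mul, cons_val_one]
        simp only [cons_val_fin_one]
        ring
      simp only [e] at h1
      rw [integral_neg, integral_add (hbd hχ.continuous_del hχ.hasCompactSupport_del (hui 1))
        (hbd hχ.continuous hχ.compact (hHi 1))] at h1
      linear_combination -h1

/-- The product of a solution with a test function is in the range of `I_Ω(U)`. -/
theorem MemKernel.isInverseValue {q : ℝ≥0∞} (hpq : SobolevExponents p q) (hΩ : IsOpen Ω)
    (hfin : volume Ω ≠ ⊤) (hU : MemLp U 2 (volume.restrict Ω)) (hψ : MemKernel Ω U ψ)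
    (hg : IsTestFunction Ω g) :
    IsInverseValue p Ω U (commutatorTerm g ψ) fun z => g z • ψ z := by
  have : IsFiniteMeasure (volume.restrict Ω) := isFiniteMeasure_restrict.2 hfin
  obtain ⟨⟨t, ht, hψt⟩, -⟩ := id hψ
  -- The working exponent s = min t q is finite, exceeds 2, and is at most q, as the improvement of
  -- integrability requires.
  have hs2 : 2 < min t q := lt_min ht hpq.two_lt
  have hst : min t q ≠ ⊤ := ((min_le_right _ _).trans_lt hpq.ne_top.lt_top).ne
  have hrs := SobolevExponents.of_right hs2 hst
  have hψs : MemLpLoc Ω (min t q) ψ := hψt.mono_exponent (min_le_left _ _)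
  have hF : MemLp (commutatorTerm g ψ) p (volume.restrict Ω) :=
    ((memLp_commutatorTerm hψs hg).restrict Ω).mono_exponent (hpq.lt_two.trans hs2).le
  have heq := hψ.ae_eq_freeInverse hrs hΩ hfin hU hψs hg
  have hu := hpq.memLp_of_eq_freeInverse hrs (min_le_right _ _) hΩ.measurableSet hfin hU hF
    ((memLp_smul_of_isTestFunction hψs hg).restrict Ω) heq
  -- The preimage under 1 + M_U I_Ω(0) is h = F - M_U u with u = gψ, since I_Ω(0) h = u.
  refine ⟨_, hF.sub (hpq.memLp_potentialMul hU hu), ?_, heq.symm⟩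
  filter_upwards [potentialMul_congr (EventuallyEq.refl _ U) heq] with z hz
  rw [onePlus, ← hz, Pi.sub_apply, sub_add_cancel]

end Localize

/-! ### One null set of points z' for all test functions -/

theorem exists_compact_exhaustion {Ω : Set ℂ} (hΩ : IsOpen Ω) :
    ∃ C : ℕ → Set ℂ, (∀ n, IsCompact (C n)) ∧ (∀ n, C n ⊆ Ω) ∧
      ∀ S, IsCompact S → S ⊆ Ω → ∃ n, S ⊆ C n := by
  have : LocallyCompactSpace Ω := hΩ.locallyCompactSpace
  set K : CompactExhaustion Ω := CompactExhaustion.choice Ω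
  refine ⟨fun n => (↑) '' K n, fun n => (K.isCompact n).image continuous_subtype_val,
    fun n => by rintro _ ⟨x, -, rfl⟩; exact x.2, fun S hS hSΩ => ?_⟩
  have h1 : IsCompact ((↑) ⁻¹' S : Set Ω) :=
    IsInducing.subtypeVal.isCompact_preimage' hS (by rwa [Subtype.range_coe])
  obtain ⟨n, hn⟩ := K.exists_superset_of_isCompact h1
  exact ⟨n, fun z hz => ⟨⟨z, hSΩ hz⟩, hn hz, rfl⟩⟩

theorem IsTestFunction.dbar_eq_zero {C : Set ℂ} {g : ℂ → ℂ} (hg : IsTestFunction C g) {z : ℂ}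
    (hz : z ∉ C) : dbar g z = 0 :=
  dbar_eq_zero_of_notMem_tsupport fun h => hz (hg.support h)

theorem IsTestFunction.del_eq_zero {C : Set ℂ} {g : ℂ → ℂ} (hg : IsTestFunction C g) {z : ℂ}
    (hz : z ∉ C) : del g z = 0 :=
  del_eq_zero_of_notMem_tsupport fun h => hz (hg.support h)

theorem IsTestFunction.eq_zero {C : Set ℂ} {g : ℂ → ℂ} (hg : IsTestFunction C g) {z : ℂ}
    (hz : z ∉ C) : g z = 0 :=
  image_eq_zero_of_notMem_tsupport fun h => hz (hg.support h)

/-- The test functions supported in a compact set are separable in the `C¹` topology. -/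
theorem exists_countable_dense_testFunctions {C : Set ℂ} (hC : IsCompact C) :
    ∃ D : Set (ℂ → ℂ), D.Countable ∧ (∀ g ∈ D, IsTestFunction C g) ∧
      ∀ g, IsTestFunction C g → ∀ ε : ℝ, 0 < ε → ∃ g' ∈ D, ∀ z,
        ‖g z - g' z‖ ≤ ε ∧ ‖dbar g z - dbar g' z‖ ≤ ε ∧ ‖del g z - del g' z‖ ≤ ε := by
  have : CompactSpace C := isCompact_iff_compactSpace.1 hC
  let X := {g : ℂ → ℂ // IsTestFunction C g}
  let Φ : X → C(C, ℂ × ℂ × ℂ) := fun g =>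
    ⟨fun z => (g.1 z, dbar g.1 z, del g.1 z), by
      have h1 := g.2.continuous
      have h2 := g.2.continuous_dbar
      have h3 := g.2.continuous_del
      fun_prop⟩
  -- Under g ↦ (g, ∂̄g, ∂g) the test functions embed in a space of continuous functions on a compact
  -- set. That space is second countable, so the induced topology is separable.
  let _ : TopologicalSpace X := TopologicalSpace.induced Φ inferInstance
  have : SecondCountableTopology X :=
    TopologicalSpace.secondCountableTopology_induced X C(C, ℂ × ℂ × ℂ) Φ
  obtain ⟨D, hDc, hD⟩ := TopologicalSpace.exists_countable_dense X
  refine ⟨Subtype.val '' D, hDc.image _, by rintro _ ⟨g, -, rfl⟩; exact g.2, fun g hg ε hε => ?_⟩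
  obtain ⟨g', hg', hg'D⟩ := hD.exists_mem_open
    (isOpen_induced_iff.2 ⟨Metric.ball (Φ ⟨g, hg⟩) ε, Metric.isOpen_ball, rfl⟩)
    ⟨⟨g, hg⟩, Metric.mem_ball_self hε⟩
  refine ⟨g'.1, ⟨g', by assumption, rfl⟩, fun z => ?_⟩
  by_cases hz : z ∈ C
  · have h1 : dist (Φ ⟨g, hg⟩ ⟨z, hz⟩) (Φ g' ⟨z, hz⟩) ≤ ε := by
      refine (ContinuousMap.dist_apply_le_dist _).trans ?_
      rw [dist_comm]
      exact (Metric.mem_ball.1 (by assumption)).le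
    rw [Prod.dist_eq, Prod.dist_eq, max_le_iff, max_le_iff] at h1
    simp only [dist_eq_norm] at h1
    exact h1
  · rw [hg.eq_zero hz, g'.2.eq_zero hz, hg.dbar_eq_zero hz, g'.2.dbar_eq_zero hz,
      hg.del_eq_zero hz, g'.2.del_eq_zero hz]
    simp [hε.le]

/-- The pair `(a, b)` is locally integrable on `Ω` and `-∂̄a - ∂b = π c δ_{z'}` there. -/
structure ReproducesAt (Ω : Set ℂ) (a b : ℂ → ℂ) (z' c : ℂ) : Prop where
  integrableOn_left : ∀ C, IsCompact C → C ⊆ Ω → IntegrableOn a C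
  integrableOn_right : ∀ C, IsCompact C → C ⊆ Ω → IntegrableOn b C
  integral_eq : ∀ g, IsTestFunction Ω g →
    ∫ z in Ω, (a z * dbar g z + b z * del g z) = Real.pi * (g z' * c)

theorem integrable_mul_of_integrableOn {C : Set ℂ} (hC : IsCompact C) {a φ : ℂ → ℂ}
    (ha : IntegrableOn a C) (hφ : Continuous φ) (h0 : ∀ z, z ∉ C → φ z = 0) :
    Integrable (fun z => a z * φ z) := by
  have := memLp_mul_of_eq_zero hC hφ h0 (memLp_one_iff_integrable.2 ha)
  simpa only [mul_comm] using memLp_one_iff_integrable.1 this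

/-- Both sides depend continuously on g in the C¹ norm: changing g by ε alters the difference by at
most ε(‖a‖₁ + ‖b‖₁ + π|c|), with L¹ norms over C. -/
theorem integral_eq_of_forall_dense {C Ω : Set ℂ} (hC : IsCompact C) (hCΩ : C ⊆ Ω)
    {D : Set (ℂ → ℂ)} (hDC : ∀ g ∈ D, IsTestFunction C g)
    (hD : ∀ g, IsTestFunction C g → ∀ ε : ℝ, 0 < ε → ∃ g' ∈ D, ∀ z,
        ‖g z - g' z‖ ≤ ε ∧ ‖dbar g z - dbar g' z‖ ≤ ε ∧ ‖del g z - del g' z‖ ≤ ε)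
    {a b : ℂ → ℂ} {z' c : ℂ} (ha : IntegrableOn a C) (hb : IntegrableOn b C)
    (heq : ∀ g ∈ D, ∫ z in Ω, (a z * dbar g z + b z * del g z) = Real.pi * (g z' * c))
    {g : ℂ → ℂ} (hg : IsTestFunction C g) :
    ∫ z in Ω, (a z * dbar g z + b z * del g z) = Real.pi * (g z' * c) := by
  have hint : ∀ g, IsTestFunction C g →
      IntegrableOn (fun z => a z * dbar g z + b z * del g z) C := fun g hg =>
    ((integrable_mul_of_integrableOn hC ha hg.continuous_dbar fun z => hg.dbar_eq_zero).add
      (integrable_mul_of_integrableOn hC hb hg.continuous_del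
        fun z => hg.del_eq_zero)).integrableOn
  have hres : ∀ g, IsTestFunction C g → ∫ z in Ω, (a z * dbar g z + b z * del g z) =
      ∫ z in C, (a z * dbar g z + b z * del g z) := fun g hg => by
    have h0 : ∀ z, z ∉ C → a z * dbar g z + b z * del g z = 0 := fun z hz => by
      rw [hg.dbar_eq_zero hz, hg.del_eq_zero hz, mul_zero, mul_zero, add_zero]
    rw [setIntegral_eq_integral_of_forall_compl_eq_zero h0,
      setIntegral_eq_integral_of_forall_compl_eq_zero fun z hz => h0 z fun h => hz (hCΩ h)]
  set M : ℝ := ∫ z in C, (‖a z‖ + ‖b z‖)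
  have hM : 0 ≤ M := integral_nonneg fun z => by positivity
  have hbound : ∀ ε : ℝ, 0 < ε →
      ‖(∫ z in Ω, (a z * dbar g z + b z * del g z)) - Real.pi * (g z' * c)‖ ≤
        ε * (M + Real.pi * ‖c‖) := by
    intro ε hε
    obtain ⟨g', hg', hgg'⟩ := hD g hg ε hε
    have h1 := heq g' hg'
    rw [hres g' (hDC g' hg')] at h1
    have h2 : (∫ z in Ω, (a z * dbar g z + b z * del g z)) - Real.pi * (g z' * c) =
        (∫ z in C, (a z * (dbar g z - dbar g' z) + b z * (del g z - del g' z))) -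
          Real.pi * ((g z' - g' z') * c) := by
      have h3 : ∫ z in C, (a z * (dbar g z - dbar g' z) + b z * (del g z - del g' z)) =
          (∫ z in C, (a z * dbar g z + b z * del g z)) -
            ∫ z in C, (a z * dbar g' z + b z * del g' z) := by
        rw [← integral_sub (hint g hg) (hint g' (hDC g' hg'))]
        refine integral_congr_ae (Eventually.of_forall fun z => ?_)
        simp only
        ring
      rw [hres g hg, h3, h1]
      ring
    rw [h2]
    refine (norm_sub_le _ _).trans ?_
    rw [mul_add]
    refine add_le_add ?_ ?_
    · rw [← integral_const_mul]
      refine norm_integral_le_of_norm_le ((ha.norm.add hb.norm).const_mul ε)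
        (Eventually.of_forall fun z => ?_)
      refine (norm_add_le _ _).trans ?_
      rw [norm_mul, norm_mul, mul_add, mul_comm ε, mul_comm ε]
      exact add_le_add (mul_le_mul_of_nonneg_left (hgg' z).2.1 (norm_nonneg _))
        (mul_le_mul_of_nonneg_left (hgg' z).2.2 (norm_nonneg _))
    · rw [norm_mul, norm_mul, norm_real, Real.norm_of_nonneg Real.pi_pos.le]
      have := mul_le_mul_of_nonneg_right (hgg' z').1 (norm_nonneg c)
      nlinarith [Real.pi_pos]
  have hP : 0 ≤ M + Real.pi * ‖c‖ := by positivity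
  refine sub_eq_zero.1 (norm_le_zero_iff.1 (le_of_forall_pos_le_add fun δ hδ => ?_))
  rw [zero_add]
  refine (hbound (δ / (M + Real.pi * ‖c‖ + 1)) (by positivity)).trans ?_
  rw [div_mul_eq_mul_div, div_le_iff₀ (by positivity)]
  nlinarith

theorem mulVec_fin_two_apply (A : Matrix (Fin 2) (Fin 2) ℂ) (v : Fin 2 → ℂ) (i : Fin 2) :
    (A *ᵥ v) i = A i 0 * v 0 + A i 1 * v 1 := by
  rw [Matrix.mulVec, dotProduct, Fin.sum_univ_two]

section Representation

variable {p : ℝ≥0∞} {Ω : Set ℂ} {U : ℂ → ℂ} {K : ℂ → ℂ → Matrix (Fin 2) (Fin 2) ℂ}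
  {ψ : ℂ → Fin 2 → ℂ}

/-- Absolute convergence is part of the notion of kernel; it is used for ψ cut off to C, one
component at a time. -/
theorem IsInverseKernel.ae_integrableOn_mul (hK : IsInverseKernel p Ω U K)
    (hb : OnePlusBijective p Ω U) (hψ : MemLpLoc Ω p ψ) {C : Set ℂ} (hC : IsCompact C)
    (hCΩ : C ⊆ Ω) :
    ∀ᵐ z' ∂(volume.restrict Ω), ∀ i j, IntegrableOn (fun z => K z' z i j * ψ z j) C := by
  have hj : ∀ j, ∀ᵐ z' ∂(volume.restrict Ω), ∀ i,
      IntegrableOn (fun z => K z' z i j * ψ z j) C := by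
    intro j
    set f : ℂ → Fin 2 → ℂ := C.indicator fun z => Pi.single j (ψ z j) with hf_def
    have hf : MemLp f p (volume.restrict Ω) := by
      refine ((memLp_indicator_iff_restrict hC.measurableSet).2 ?_).restrict Ω
      refine (hψ C hC hCΩ).of_le ?_ ?_
      · refine aestronglyMeasurable_fin2 fun i => ?_
        by_cases hij : i = j
        · subst hij
          simpa using ((hψ C hC hCΩ).eval i).1
        · simpa [Pi.single_eq_of_ne hij] using aestronglyMeasurable_const
      · refine Eventually.of_forall fun z => ?_
        rw [Pi.norm_single]
        exact norm_le_pi_norm _ _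
    obtain ⟨g, hg⟩ := hb.exists_isInverseValue hf
    filter_upwards [hK.apply f g hg] with z' hz' i
    have h1 := (hz'.1.eval i).integrableOn (s := C)
    rw [IntegrableOn, Measure.restrict_restrict_of_subset hCΩ] at h1
    refine IntegrableOn.congr_fun h1 (fun z hz => ?_) hC.measurableSet
    simp only [hf_def, indicator_of_mem hz]
    rw [Matrix.mulVec_single]
    simp
  filter_upwards [ae_all_iff.2 hj] with z' hz' i j
  exact hz' j i

theorem MemKernel.ae_integral_eq {q : ℝ≥0∞} (hpq : SobolevExponents p q) (hΩ : IsOpen Ω)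
    (hfin : volume Ω ≠ ⊤) (hU : MemLp U 2 (volume.restrict Ω)) (hK : IsInverseKernel p Ω U K)
    (hψ : MemKernel Ω U ψ) {g : ℂ → ℂ} (hg : IsTestFunction Ω g) :
    ∀ᵐ z' ∂(volume.restrict Ω), ∀ i,
      ∫ z in Ω, (K z' z i 0 * ψ z 0 * dbar g z + K z' z i 1 * ψ z 1 * del g z) =
        Real.pi * (g z' * ψ z' i) := by
  filter_upwards [hK.apply _ _ (hψ.isInverseValue hpq hΩ hfin hU hg)] with z' hz' i
  have h1 : g z' * ψ z' i = ((Real.pi : ℂ)⁻¹ • ∫ w in Ω, K z' w *ᵥ commutatorTerm g ψ w) i :=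
    congrFun hz'.2 i
  rw [Pi.smul_apply, eval_integral fun i => hz'.1.eval i, smul_eq_mul] at h1
  have hpi : (Real.pi : ℂ) ≠ 0 := by exact_mod_cast Real.pi_ne_zero
  rw [h1, mul_inv_cancel_left₀ hpi]
  refine integral_congr_ae (Eventually.of_forall fun z => ?_)
  refine Eq.trans ?_ (mulVec_fin_two_apply _ _ _).symm
  simp only [commutatorTerm, cons_val_zero, cons_val_one, cons_val_fin_one]
  ring

/-- For each member of a countable exhaustion of Ω, the identity is imposed on countably many dense
test functions supported there. Outside the union of the null sets it extends to all test functions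
by density. -/
theorem MemKernel.ae_reproducesAt {q : ℝ≥0∞} (hpq : SobolevExponents p q) (hΩ : IsOpen Ω)
    (hfin : volume Ω ≠ ⊤) (hU : MemLp U 2 (volume.restrict Ω)) (hb : OnePlusBijective p Ω U)
    (hK : IsInverseKernel p Ω U K) (hψ : MemKernel Ω U ψ) :
    ∀ᵐ z' ∂(volume.restrict Ω), ∀ i,
      ReproducesAt Ω (fun z => K z' z i 0 * ψ z 0) (fun z => K z' z i 1 * ψ z 1) z' (ψ z' i) := by
  obtain ⟨C, hC, hCΩ, hCex⟩ := exists_compact_exhaustion hΩ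
  choose D hDc hDC hD using fun n => exists_countable_dense_testFunctions (hC n)
  obtain ⟨⟨t, ht, hψt⟩, -⟩ := id hψ
  have hψp : MemLpLoc Ω p ψ := hψt.mono_exponent (hpq.lt_two.trans ht).le
  have h1 := ae_all_iff.2 fun n => hK.ae_integrableOn_mul hb hψp (hC n) (hCΩ n)
  have h2 := ae_all_iff.2 fun n => (ae_ball_iff (hDc n)).2 fun g hg =>
    hψ.ae_integral_eq hpq hΩ hfin hU hK ((hDC n g hg).mono (hCΩ n))
  filter_upwards [h1, h2] with z' hz1 hz2 i
  refine ⟨fun S hS hSΩ => ?_, fun S hS hSΩ => ?_, fun g hg => ?_⟩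
  · obtain ⟨n, hn⟩ := hCex S hS hSΩ
    exact (hz1 n i 0).mono_set hn
  · obtain ⟨n, hn⟩ := hCex S hS hSΩ
    exact (hz1 n i 1).mono_set hn
  · obtain ⟨n, hn⟩ := hCex _ hg.compact hg.support
    exact integral_eq_of_forall_dense (hC n) (hCΩ n) (hDC n) (hD n) (hz1 n i 0) (hz1 n i 1)
      (fun g hg => hz2 n g hg i) ⟨hg.smooth, hg.compact, hn⟩

end Representation

/-! ### Lipschitz closed paths and their winding numbers -/

section Lipschitz

variable {C : NNReal} {f : ℝ → ℂ}

theorem ae_differentiableAt_of_lipschitzOnWith (hf : LipschitzOnWith C f (Icc 0 1)) :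
    ∀ᵐ s, s ∈ Ioo (0 : ℝ) 1 → DifferentiableAt ℝ f s := by
  filter_upwards [hf.ae_differentiableWithinAt_of_mem_real] with s hs hs1
  exact (hs (Ioo_subset_Icc_self hs1)).differentiableAt (Icc_mem_nhds hs1.1 hs1.2)

theorem norm_deriv_le_of_mem_Ioo (hf : LipschitzOnWith C f (Icc 0 1)) {s : ℝ}
    (hs : s ∈ Ioo (0 : ℝ) 1) : ‖deriv f s‖ ≤ C :=
  norm_deriv_le_of_lipschitzOn (Icc_mem_nhds hs.1 hs.2) hf

theorem intervalIntegral_congr_Ioo {f g : ℝ → ℂ}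
    (h : ∀ᵐ s, s ∈ Ioo (0 : ℝ) 1 → f s = g s) :
    ∫ s in (0 : ℝ)..1, f s = ∫ s in (0 : ℝ)..1, g s := by
  rw [intervalIntegral.integral_of_le zero_le_one, intervalIntegral.integral_of_le zero_le_one,
    integral_Ioc_eq_integral_Ioo, integral_Ioc_eq_integral_Ioo]
  exact setIntegral_congr_ae measurableSet_Ioo h

theorem intervalIntegrable_deriv_of_lipschitzOnWith (hf : LipschitzOnWith C f (Icc 0 1)) :
    IntervalIntegrable (deriv f) volume 0 1 := by
  rw [intervalIntegrable_iff_integrableOn_Ioo_of_le zero_le_one]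
  exact Measure.integrableOn_of_bounded (M := C) (by simp)
    (measurable_deriv f).aestronglyMeasurable
    ((ae_restrict_iff' measurableSet_Ioo).2 (Eventually.of_forall fun s hs =>
      norm_deriv_le_of_mem_Ioo hf hs))

theorem integral_deriv_of_lipschitzOnWith (hf : LipschitzOnWith C f (Icc 0 1)) :
    ∫ s in (0 : ℝ)..1, deriv f s = f 1 - f 0 := by
  have key : ∀ L : ℂ →L[ℝ] ℝ, L (∫ s in (0 : ℝ)..1, deriv f s) = L (f 1 - f 0) := by
    intro L
    have hL : LipschitzOnWith (‖L‖₊ * C) (fun s => L (f s)) (uIcc 0 1) := by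
      rw [uIcc_of_le zero_le_one]
      exact L.lipschitz.comp_lipschitzOnWith hf
    have h1 := hL.absolutelyContinuousOnInterval.integral_deriv_eq_sub
    rw [map_sub, ← h1, ← L.intervalIntegral_comp_comm
      (intervalIntegrable_deriv_of_lipschitzOnWith hf),
      intervalIntegral.integral_of_le zero_le_one, intervalIntegral.integral_of_le zero_le_one,
      integral_Ioc_eq_integral_Ioo, integral_Ioc_eq_integral_Ioo]
    refine setIntegral_congr_ae measurableSet_Ioo ?_
    filter_upwards [ae_differentiableAt_of_lipschitzOnWith hf] with s hs hs1
    exact (L.hasFDerivAt.comp_hasDerivAt s (hs hs1).hasDerivAt).deriv.symm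
  exact Complex.ext (key reCLM) (key imCLM)

end Lipschitz

/-- A closed path `γ`, together with a version `v` of its derivative, such that exact one-forms
integrate to zero. -/
structure IsClosedPath (γ v : ℝ → ℂ) : Prop where
  continuous : Continuous γ
  measurable : Measurable v
  bounded : ∃ B, ∀ s, ‖v s‖ ≤ B
  integral_fderiv : ∀ F : ℂ → ℂ, ContDiff ℝ 1 F → HasCompactSupport F →
    ∫ s in Ioc (0 : ℝ) 1, fderiv ℝ F (γ s) (v s) = 0

/-- γ is controlled only on [0,1], so it is extended by its end values, and its derivative is set to
0 outside (0,1). Exact forms integrate to 0 because F ∘ γ is Lipschitz and takes the same value at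
both ends. -/
theorem exists_isClosedPath {C : NNReal} {γ : ℝ → ℂ} (hγ : LipschitzOnWith C γ (Icc 0 1))
    (h01 : γ 0 = γ 1) : ∃ γ' v, IsClosedPath γ' v ∧ EqOn γ' γ (Icc 0 1) ∧
      ∀ s ∈ Ioo (0 : ℝ) 1, v s = deriv γ s := by
  have heq : EqOn (IccExtend (zero_le_one (α := ℝ)) fun x => γ x) γ (Icc 0 1) := fun s hs =>
    IccExtend_of_mem _ _ hs
  refine ⟨IccExtend zero_le_one fun x => γ x, (Ioo (0 : ℝ) 1).indicator (deriv γ),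
    ⟨?_, ?_, ?_, ?_⟩, heq, fun s hs => indicator_of_mem hs _⟩
  · exact (continuousOn_iff_continuous_domRestrict.1 hγ.continuousOn).Icc_extend'
  · exact (measurable_deriv γ).indicator measurableSet_Ioo
  · refine ⟨C, fun s => ?_⟩
    by_cases hs : s ∈ Ioo (0 : ℝ) 1
    · rw [indicator_of_mem hs]
      exact norm_deriv_le_of_mem_Ioo hγ hs
    · rw [indicator_of_notMem hs, norm_zero]
      exact C.2
  · intro F hF hFc
    obtain ⟨K, hK⟩ := hF.lipschitzWith_of_hasCompactSupport hFc one_ne_zero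
    have h1 := integral_deriv_of_lipschitzOnWith (hK.comp_lipschitzOnWith hγ)
    rw [Function.comp_apply, Function.comp_apply, h01, sub_self] at h1
    rw [← intervalIntegral.integral_of_le zero_le_one, ← h1]
    refine intervalIntegral_congr_Ioo ?_
    filter_upwards [ae_differentiableAt_of_lipschitzOnWith hγ] with s hs hs1
    rw [indicator_of_mem hs1, heq (Ioo_subset_Icc_self hs1)]
    exact (((hF.differentiable one_ne_zero) _).hasFDerivAt.comp_hasDerivAt s
      (hs hs1).hasDerivAt).deriv.symm

namespace IsClosedPath

variable {γ v : ℝ → ℂ}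

theorem isCompact_image (h : IsClosedPath γ v) : IsCompact (γ '' Icc 0 1) :=
  isCompact_Icc.image h.continuous

theorem mem_image {s : ℝ} (hs : s ∈ Ioc (0 : ℝ) 1) : γ s ∈ γ '' Icc 0 1 :=
  mem_image_of_mem γ (Ioc_subset_Icc_self hs)

theorem integral_fderiv_of_contDiffAt (h : IsClosedPath γ v) {V : Set ℂ} (hV : IsOpen V)
    (hγV : γ '' Icc 0 1 ⊆ V) {F : ℂ → ℂ} (hF : ∀ z ∈ V, ContDiffAt ℝ 1 F z) :
    ∫ s in Ioc (0 : ℝ) 1, fderiv ℝ F (γ s) (v s) = 0 := by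
  obtain ⟨ρ, hρ, hρ1⟩ := exists_isTestFunction_eq_one h.isCompact_image hV hγV
  have h1 : ContDiff ℝ 1 (fun z => ρ z * F z) := contDiff_iff_contDiffAt.2 fun z => by
    by_cases hz : z ∈ tsupport ρ
    · exact hρ.contDiff_one.contDiffAt.mul (hF z (hρ.support hz))
    · refine (contDiffAt_const (c := (0 : ℂ))).congr_of_eventuallyEq ?_
      filter_upwards [notMem_tsupport_iff_eventuallyEq.1 hz] with x hx
      simp [hx]
  have h2 := h.integral_fderiv _ h1 hρ.compact.mul_right
  rw [← h2]
  refine setIntegral_congr_fun measurableSet_Ioc fun s hs => ?_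
  have : (fun z => ρ z * F z) =ᶠ[𝓝 (γ s)] F := by
    filter_upwards [hρ1 _ (mem_image hs)] with z hz
    rw [hz, one_mul]
  simp only [this.fderiv_eq]

theorem integrable_bounded_mul (h : IsClosedPath γ v) {f : ℝ → ℂ}
    (hf : IntegrableOn f (Ioc 0 1)) : IntegrableOn (fun s => v s * f s) (Ioc 0 1) := by
  obtain ⟨B, hB⟩ := h.bounded
  exact hf.bdd_mul (c := B) h.measurable.aestronglyMeasurable (Eventually.of_forall hB)

end IsClosedPath

/-- The winding number of a closed path with derivative `v`. -/
def winding (γ v : ℝ → ℂ) (z : ℂ) : ℂ :=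
  (2 * Real.pi * I)⁻¹ * ∫ s in Ioc (0 : ℝ) 1, v s * (γ s - z)⁻¹

namespace IsClosedPath

variable {γ v : ℝ → ℂ}

/-- The difference of the two integrands is exact: log((ζ-z)/(ζ-z₁)) is a primitive near the path,
the quotient lying within distance 1 of 1 and so in the slit plane. -/
theorem winding_eq_of_norm_lt (h : IsClosedPath γ v) {z₁ z : ℂ}
    (hz : ∀ s ∈ Icc (0 : ℝ) 1, ‖z₁ - z‖ < ‖γ s - z₁‖) : winding γ v z = winding γ v z₁ := by
  set V : Set ℂ := {ζ | ‖z₁ - z‖ < ‖ζ - z₁‖}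
  have hV : IsOpen V := isOpen_lt continuous_const (by fun_prop)
  have hγV : γ '' Icc 0 1 ⊆ V := by
    rintro _ ⟨s, hs, rfl⟩
    exact hz s hs
  have hne : ∀ ζ ∈ V, ζ - z₁ ≠ 0 ∧ ζ - z ≠ 0 := by
    intro ζ hζ
    have hζ' : ‖z₁ - z‖ < ‖ζ - z₁‖ := hζ
    refine ⟨fun h0 => ?_, fun h0 => ?_⟩
    · rw [h0, norm_zero] at hζ'
      exact absurd hζ' (norm_nonneg _).not_gt
    · rw [← sub_eq_zero.1 h0, norm_sub_rev] at hζ'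
      exact lt_irrefl _ hζ'
  have hslit : ∀ ζ ∈ V, (ζ - z) / (ζ - z₁) ∈ slitPlane := by
    intro ζ hζ
    have hζ' : ‖z₁ - z‖ < ‖ζ - z₁‖ := hζ
    have h1 : ‖(z₁ - z) / (ζ - z₁)‖ < 1 := by
      rw [norm_div, div_lt_one (norm_pos_iff.2 (hne ζ hζ).1)]
      exact hζ'
    have h2 : (ζ - z) / (ζ - z₁) = 1 + (z₁ - z) / (ζ - z₁) := by
      rw [eq_comm, ← div_self (hne ζ hζ).1, ← add_div, sub_add_sub_cancel]
    rw [h2]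
    exact mem_slitPlane_of_norm_lt_one h1
  set F : ℂ → ℂ := fun ζ => Complex.log ((ζ - z) / (ζ - z₁))
  have hFd : ∀ ζ ∈ V, HasDerivAt F ((ζ - z)⁻¹ - (ζ - z₁)⁻¹) ζ := by
    intro ζ hζ
    have h1 : HasDerivAt (fun ζ : ℂ => (ζ - z) / (ζ - z₁))
        ((1 * (ζ - z₁) - (ζ - z) * 1) / (ζ - z₁) ^ 2) ζ :=
      ((hasDerivAt_id ζ).sub_const z).div ((hasDerivAt_id ζ).sub_const z₁) (hne ζ hζ).1
    refine (h1.clog (hslit ζ hζ)).congr_deriv ?_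
    have := (hne ζ hζ).1
    have := (hne ζ hζ).2
    field_simp
  have hFc : ∀ ζ ∈ V, ContDiffAt ℝ 1 F ζ := by
    intro ζ hζ
    have h1 : ContDiffAt ℂ 1 F ζ := by
      have := (hne ζ hζ).1
      exact (Complex.contDiffAt_log (hslit ζ hζ)).comp ζ
        ((contDiffAt_id.sub contDiffAt_const).div (contDiffAt_id.sub contDiffAt_const) this)
    exact h1.restrict_scalars ℝ
  have h0 := h.integral_fderiv_of_contDiffAt hV hγV hFc
  have hint : ∀ w : ℂ, (∀ s ∈ Icc (0 : ℝ) 1, γ s - w ≠ 0) →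
      IntegrableOn (fun s => v s * (γ s - w)⁻¹) (Ioc 0 1) := fun w hw =>
    h.integrable_bounded_mul ((ContinuousOn.integrableOn_compact isCompact_Icc
      ((h.continuous.continuousOn.sub continuousOn_const).inv₀ hw)).mono_set Ioc_subset_Icc_self)
  have h1 : ∫ s in Ioc (0 : ℝ) 1, fderiv ℝ F (γ s) (v s) =
      ∫ s in Ioc (0 : ℝ) 1, (v s * (γ s - z)⁻¹ - v s * (γ s - z₁)⁻¹) := by
    refine setIntegral_congr_fun measurableSet_Ioc fun s hs => ?_
    have h2 := (hFd _ (hγV (mem_image hs))).hasFDerivAt.restrictScalars ℝ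
    simp only [h2.fderiv]
    simp
    ring
  rw [h1, integral_sub (hint z fun s hs => (hne _ (hγV (mem_image_of_mem γ hs))).2)
    (hint z₁ fun s hs => (hne _ (hγV (mem_image_of_mem γ hs))).1), sub_eq_zero] at h0
  rw [winding, winding, h0]

theorem eventually_winding_eq (h : IsClosedPath γ v) {z₁ : ℂ} (hz₁ : z₁ ∉ γ '' Icc 0 1) :
    ∀ᶠ z in 𝓝 z₁, winding γ v z = winding γ v z₁ := by
  obtain ⟨δ, hδ, hball⟩ := Metric.isOpen_iff.1 h.isCompact_image.isClosed.isOpen_compl z₁ hz₁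
  filter_upwards [Metric.ball_mem_nhds z₁ hδ] with z hz
  refine h.winding_eq_of_norm_lt fun s hs => ?_
  rw [mem_ball_iff_norm'] at hz
  refine hz.trans_le (not_lt.1 fun hlt => ?_)
  exact hball (mem_ball_iff_norm.2 hlt) (mem_image_of_mem γ hs)

/-- The trace of a closed path together with the points that it surrounds is closed. -/
theorem isClosed_surrounded (h : IsClosedPath γ v) :
    IsClosed ({z | winding γ v z ≠ 0} ∪ γ '' Icc 0 1) := by
  rw [← isOpen_compl_iff, isOpen_iff_mem_nhds]
  intro z hz
  rw [mem_compl_iff, mem_union, not_or, mem_ofPred_eq, not_not] at hz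
  filter_upwards [h.eventually_winding_eq hz.2,
    h.isCompact_image.isClosed.isOpen_compl.mem_nhds hz.2] with w hw hwγ
  rw [mem_compl_iff, mem_union, not_or, mem_ofPred_eq, not_not]
  exact ⟨hw.trans hz.1, hwγ⟩

end IsClosedPath

/-! ### Mollified winding numbers as test functions -/

namespace IsClosedPath

variable {γ v : ℝ → ℂ} {χ : ℂ → ℂ}

/-- For each s the integral of 1/|γ(s) - ζ| over K is bounded by that of the truncated kernel,
independently of s, and v is bounded. Hence the winding number is locally integrable, even across
the trace of γ. -/
theorem integrable_prod_inv (h : IsClosedPath γ v) {K : Set ℂ} (hK : IsCompact K) :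
    Integrable (fun x : ℂ × ℝ => v x.2 * (γ x.2 - x.1)⁻¹)
      ((volume.restrict K).prod (volume.restrict (Ioc (0 : ℝ) 1))) := by
  obtain ⟨R, hR⟩ := exists_norm_sub_lt h.isCompact_image hK
  obtain ⟨B, hB⟩ := h.bounded
  have hmeas : Measurable fun x : ℂ × ℝ => v x.2 * (γ x.2 - x.1)⁻¹ := by
    have h1 := h.measurable
    have h2 := h.continuous.measurable
    fun_prop
  have hshift : ∀ s : ℝ, Integrable fun ζ => truncatedInv R (γ s - ζ) := fun s =>
    (integrable_truncatedInv R).comp_sub_left (γ s)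
  have heq : ∀ s ∈ Ioc (0 : ℝ) 1, ∀ ζ ∈ K, (γ s - ζ)⁻¹ = truncatedInv R (γ s - ζ) :=
    fun s hs ζ hζ => (truncatedInv_of_lt (hR _ (mem_image hs) ζ hζ)).symm
  have hKi : ∀ s ∈ Ioc (0 : ℝ) 1, IntegrableOn (fun ζ => (γ s - ζ)⁻¹) K := fun s hs =>
    (hshift s).integrableOn.congr_fun (fun ζ hζ => (heq s hs ζ hζ).symm) hK.measurableSet
  refine (integrable_prod_iff' hmeas.aestronglyMeasurable).2 ⟨?_, ?_⟩
  · filter_upwards [ae_restrict_mem measurableSet_Ioc] with s hs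
    exact (hKi s hs).const_mul (v s)
  · refine Measure.integrableOn_of_bounded (M := B * ∫ ζ, ‖truncatedInv R ζ‖) (by simp)
      hmeas.norm.aestronglyMeasurable.prod_swap.integral_prod_right' ?_
    filter_upwards [ae_restrict_mem measurableSet_Ioc] with s hs
    rw [Real.norm_of_nonneg (integral_nonneg fun ζ => norm_nonneg _)]
    simp only [norm_mul]
    rw [integral_const_mul]
    refine mul_le_mul (hB s) ?_ (integral_nonneg fun ζ => norm_nonneg _)
      ((norm_nonneg _).trans (hB s))
    rw [setIntegral_congr_fun hK.measurableSet fun ζ hζ => congrArg norm (heq s hs ζ hζ),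
      ← integral_sub_left_eq_self (fun ζ => ‖truncatedInv R ζ‖) volume (γ s)]
    exact setIntegral_le_integral (hshift s).norm (Eventually.of_forall fun ζ => norm_nonneg _)

theorem locallyIntegrable_winding (h : IsClosedPath γ v) : LocallyIntegrable (winding γ v) := by
  rw [locallyIntegrable_iff]
  intro K hK
  exact (h.integrable_prod_inv hK).integral_prod_left.const_mul _

theorem integral_winding_mul (h : IsClosedPath γ v) {φ : ℂ → ℂ} (hφ : Continuous φ)
    (hc : HasCompactSupport φ) (z : ℂ) :
    ∫ ζ, winding γ v ζ * φ (z - ζ) =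
      -(2 * I)⁻¹ * ∫ s in Ioc (0 : ℝ) 1, v s * cauchyTransform φ (z - γ s) := by
  set K : Set ℂ := (fun ζ => z - ζ) '' tsupport φ
  have hK : IsCompact K := hc.image (by fun_prop)
  have h0 : ∀ ζ, ζ ∉ K → φ (z - ζ) = 0 := fun ζ hζ => by
    refine image_eq_zero_of_notMem_tsupport fun hmem => hζ ⟨z - ζ, hmem, sub_sub_cancel z ζ⟩
  obtain ⟨B, hB⟩ := hc.exists_bound_of_continuous hφ
  have hint : Integrable (Function.uncurry fun (ζ : ℂ) (s : ℝ) =>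
      φ (z - ζ) * (v s * (γ s - ζ)⁻¹))
      ((volume.restrict K).prod (volume.restrict (Ioc (0 : ℝ) 1))) :=
    (h.integrable_prod_inv hK).bdd_mul (c := B)
      (hφ.comp (continuous_const.sub continuous_fst)).aestronglyMeasurable
      (Eventually.of_forall fun x => hB _)
  have hswap := integral_integral_swap hint
  have hl : ∀ ζ, winding γ v ζ * φ (z - ζ) = (2 * Real.pi * I)⁻¹ *
      ∫ s in Ioc (0 : ℝ) 1, φ (z - ζ) * (v s * (γ s - ζ)⁻¹) := fun ζ => by
    rw [winding, integral_const_mul]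
    ring
  have hr : ∀ s : ℝ, ∫ ζ in K, φ (z - ζ) * (v s * (γ s - ζ)⁻¹) =
      -(Real.pi * (v s * cauchyTransform φ (z - γ s))) := fun s => by
    rw [setIntegral_eq_integral_of_forall_compl_eq_zero fun ζ hζ => by rw [h0 ζ hζ, zero_mul]]
    have hpi : (Real.pi : ℂ) ≠ 0 := by exact_mod_cast Real.pi_ne_zero
    rw [cauchyTransform, mul_left_comm, mul_inv_cancel_left₀ hpi, ← mul_neg, ← integral_neg,
      ← integral_sub_right_eq_self (fun η => -(η⁻¹ * φ (z - γ s - η))) (γ s),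
      ← integral_const_mul]
    refine integral_congr_ae (Eventually.of_forall fun ζ => ?_)
    simp only
    rw [sub_sub_sub_cancel_right, ← neg_sub ζ (γ s), inv_neg]
    ring
  rw [← setIntegral_eq_integral_of_forall_compl_eq_zero (s := K) fun ζ hζ => by
    rw [h0 ζ hζ, mul_zero]]
  simp only [hl]
  rw [integral_const_mul, hswap]
  simp only [hr]
  rw [integral_neg, integral_const_mul]
  have hpi : (Real.pi : ℂ) ≠ 0 := by exact_mod_cast Real.pi_ne_zero
  have := Complex.I_ne_zero
  field_simp

end IsClosedPath

/-- The winding number, averaged against `χ`. -/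
def windingAverage (γ v : ℝ → ℂ) (χ : ℂ → ℂ) (z : ℂ) : ℂ := ∫ ζ, winding γ v ζ * χ (z - ζ)

namespace IsClosedPath

variable {γ v : ℝ → ℂ} {χ : ℂ → ℂ}

theorem contDiff_windingAverage (h : IsClosedPath γ v) (hχ : ContDiff ℝ ∞ χ)
    (hc : HasCompactSupport χ) : ContDiff ℝ ∞ (windingAverage γ v χ) :=
  hc.contDiff_convolution_right (n := ⊤) (ContinuousLinearMap.mul ℝ ℂ)
    h.locallyIntegrable_winding hχ

theorem fderiv_windingAverage (h : IsClosedPath γ v) (hχ : ContDiff ℝ ∞ χ)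
    (hc : HasCompactSupport χ) (z e : ℂ) : fderiv ℝ (windingAverage γ v χ) z e =
      -(2 * I)⁻¹ * ∫ s in Ioc (0 : ℝ) 1, v s * fderiv ℝ (cauchyTransform χ) (z - γ s) e := by
  have h1 : ContDiff ℝ 1 χ := hχ.of_le (by exact_mod_cast le_top)
  have hd : HasFDerivAt (windingAverage γ v χ) _ z := hc.hasFDerivAt_convolution_right
    (ContinuousLinearMap.mul ℝ ℂ) h.locallyIntegrable_winding h1 z
  have hcont := h1.continuous_fderiv one_ne_zero
  have h2 := h.integral_winding_mul (φ := fun x => fderiv ℝ χ x e) (by fun_prop)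
    (hc.fderiv_apply ℝ e) z
  rw [hd.fderiv, convolution_precompR_apply _ h.locallyIntegrable_winding (hc.fderiv ℝ) hcont]
  simp only [fderiv_cauchyTransform hχ hc]
  exact h2

theorem integrableOn_mul_comp (h : IsClosedPath γ v) {f : ℂ → ℂ} (hf : Continuous f) (z : ℂ) :
    IntegrableOn (fun s => v s * f (z - γ s)) (Ioc 0 1) := by
  have := h.continuous
  exact h.integrable_bounded_mul ((Continuous.integrableOn_Icc (by fun_prop)).mono_set
    Ioc_subset_Icc_self)

/-- By Fubini the average is a path integral of the Cauchy transform of χ, and ∂̄ of that transform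
is χ. -/
theorem dbar_windingAverage (h : IsClosedPath γ v) (hχ : ContDiff ℝ ∞ χ)
    (hc : HasCompactSupport χ) (z : ℂ) : dbar (windingAverage γ v χ) z =
      -(2 * I)⁻¹ * ∫ s in Ioc (0 : ℝ) 1, v s * χ (z - γ s) := by
  have hC := (contDiff_cauchyTransform hχ hc).continuous_fderiv (by simp)
  have hi : ∀ e : ℂ, IntegrableOn
      (fun s => v s * fderiv ℝ (cauchyTransform χ) (z - γ s) e) (Ioc 0 1) := fun e =>
    h.integrableOn_mul_comp (f := fun x => fderiv ℝ (cauchyTransform χ) x e) (by fun_prop) z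
  rw [dbar, h.fderiv_windingAverage hχ hc, h.fderiv_windingAverage hχ hc]
  have h1 : ∀ s, v s * χ (z - γ s) = 2⁻¹ * (v s * fderiv ℝ (cauchyTransform χ) (z - γ s) 1 +
      I * (v s * fderiv ℝ (cauchyTransform χ) (z - γ s) I)) := fun s => by
    rw [← dbar_cauchyTransform hχ hc, dbar]
    ring
  simp only [h1]
  rw [integral_const_mul, integral_add (hi 1) ((hi I).const_mul I), integral_const_mul]
  ring

/-- The differential of ζ ↦ Cχ(z - ζ) has integral 0 along the closed path. This trades ∂Cχ dζ for
-χ dζ̄ under the integral. -/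
theorem del_windingAverage (h : IsClosedPath γ v) (hχ : ContDiff ℝ ∞ χ)
    (hc : HasCompactSupport χ) (z : ℂ) : del (windingAverage γ v χ) z =
      (2 * I)⁻¹ * ∫ s in Ioc (0 : ℝ) 1, conj (v s) * χ (z - γ s) := by
  have hCs := contDiff_cauchyTransform hχ hc
  have hC1 : ContDiff ℝ 1 (cauchyTransform χ) := hCs.of_le (by exact_mod_cast le_top)
  have hC := hC1.continuous_fderiv one_ne_zero
  have hi : ∀ e : ℂ, IntegrableOn
      (fun s => v s * fderiv ℝ (cauchyTransform χ) (z - γ s) e) (Ioc 0 1) := fun e =>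
    h.integrableOn_mul_comp (f := fun x => fderiv ℝ (cauchyTransform χ) x e) (by fun_prop) z
  have hΦ : ∀ ζ w, fderiv ℝ (fun x => cauchyTransform χ (z - x)) ζ w =
      -(w * del (cauchyTransform χ) (z - ζ) + conj w * χ (z - ζ)) := by
    intro ζ w
    have h1 := ((hC1.differentiable one_ne_zero) (z - ζ)).hasFDerivAt.comp ζ
      ((hasFDerivAt_id (𝕜 := ℝ) ζ).const_sub z)
    have h2 : HasFDerivAt (fun x => cauchyTransform χ (z - x)) _ ζ := h1
    rw [h2.fderiv]
    simp only [ContinuousLinearMap.comp_neg, ContinuousLinearMap.comp_id, _root_.neg_apply]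
    rw [fderiv_eq_del_dbar, dbar_cauchyTransform hχ hc]
    ring
  have h0 := h.integral_fderiv_of_contDiffAt isOpen_univ (subset_univ _)
    (F := fun x => cauchyTransform χ (z - x))
    fun ζ _ => (hC1.comp (contDiff_const.sub contDiff_id)).contDiffAt
  simp only [hΦ] at h0
  have hi1 : IntegrableOn (fun s => v s * del (cauchyTransform χ) (z - γ s)) (Ioc 0 1) :=
    h.integrableOn_mul_comp (continuous_del hC1) z
  have hi2 : IntegrableOn (fun s => conj (v s) * χ (z - γ s)) (Ioc 0 1) := by
    have h3 := h.integrableOn_mul_comp (f := fun x => conj (χ x))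
      (continuous_conj.comp hχ.continuous) z
    have h4 := (conjCLE : ℂ →L[ℝ] ℂ).integrable_comp h3
    simpa [IntegrableOn] using h4
  rw [integral_neg, integral_add hi1 hi2, neg_eq_zero] at h0
  rw [del, h.fderiv_windingAverage hχ hc, h.fderiv_windingAverage hχ hc]
  have h1 : ∀ s, v s * del (cauchyTransform χ) (z - γ s) =
      2⁻¹ * (v s * fderiv ℝ (cauchyTransform χ) (z - γ s) 1 -
      I * (v s * fderiv ℝ (cauchyTransform χ) (z - γ s) I)) := fun s => by
    rw [del]
    ring
  simp only [h1] at h0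
  rw [integral_const_mul, integral_sub (hi 1) ((hi I).const_mul I), integral_const_mul] at h0
  linear_combination (-(2 * I)⁻¹) * h0

/-- The support lies within r of the points with nonzero winding number, and this thickening is
compact and contained in Ω. -/
theorem isTestFunction_windingAverage (h : IsClosedPath γ v) {Ω Z : Set ℂ} (hZ : IsCompact Z)
    {r : ℝ} (hr : Metric.cthickening r Z ⊆ Ω) (hwZ : ∀ z, winding γ v z ≠ 0 → z ∈ Z)
    (hχ : ContDiff ℝ ∞ χ) (hc : HasCompactSupport χ) (hχr : tsupport χ ⊆ Metric.ball 0 r) :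
    IsTestFunction Ω (windingAverage γ v χ) := by
  have hsub : tsupport (windingAverage γ v χ) ⊆ Metric.cthickening r Z := by
    refine closure_minimal (fun z hz => ?_) Metric.isClosed_cthickening
    by_contra hzr
    refine hz (integral_eq_zero_of_ae (Eventually.of_forall fun ζ => ?_))
    by_cases hζ : winding γ v ζ = 0
    · simp [hζ]
    · have : z - ζ ∉ tsupport χ := fun hmem => hzr <| by
        refine Metric.mem_cthickening_of_dist_le z ζ r Z (hwZ ζ hζ) ?_
        rw [dist_eq_norm]
        exact (mem_ball_zero_iff.1 (hχr hmem)).le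
      simp [image_eq_zero_of_notMem_tsupport this]
  exact ⟨h.contDiff_windingAverage hχ hc,
    hZ.cthickening.of_isClosed_subset (isClosed_tsupport _) hsub, hsub.trans hr⟩

end IsClosedPath

theorem windingAverage_eq_integral {γ v : ℝ → ℂ} {χ : ℂ → ℂ} {z' : ℂ} {r : ℝ}
    (hw : ∀ z ∈ Metric.ball z' r, winding γ v z = 1) (hχr : tsupport χ ⊆ Metric.ball 0 r) :
    windingAverage γ v χ z' = ∫ w, χ w := by
  rw [← integral_sub_left_eq_self χ volume z']
  refine integral_congr_ae (Eventually.of_forall fun ζ => ?_)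
  simp only
  by_cases hζ : z' - ζ ∈ tsupport χ
  · rw [hw ζ (mem_ball_iff_norm'.2 (mem_ball_zero_iff.1 (hχr hζ))), one_mul]
  · rw [image_eq_zero_of_notMem_tsupport hζ, mul_zero]

/-! ### Residue formula along almost every translate -/

section Translate

variable {γ v : ℝ → ℂ} {a : ℂ → ℂ} {χ : ℂ → ℂ}

/-- The shear (s, w) ↦ (s, γ(s) + w) preserves measure, so the claim reduces to a product of
integrable functions. -/
theorem integrable_prod_translate (hγ : Continuous γ) (hv : Measurable v) {B : ℝ}
    (hB : ∀ s, ‖v s‖ ≤ B) (ha : Integrable a) :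
    Integrable (fun x : ℝ × ℂ => v x.1 * a (γ x.1 + x.2))
      ((volume.restrict (Ioc (0 : ℝ) 1)).prod volume) := by
  have hv1 : Integrable v (volume.restrict (Ioc (0 : ℝ) 1)) :=
    Measure.integrableOn_of_bounded (M := B) (by simp) hv.aestronglyMeasurable
      (Eventually.of_forall hB)
  have hmp : MeasurePreserving (fun x : ℝ × ℂ => (x.1, γ x.1 + x.2))
      ((volume.restrict (Ioc (0 : ℝ) 1)).prod volume)
      ((volume.restrict (Ioc (0 : ℝ) 1)).prod volume) :=
    (MeasurePreserving.id _).skew_product (g := fun s z => γ s + z)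
      ((hγ.comp continuous_fst).add continuous_snd).measurable
      (Eventually.of_forall fun s => map_add_left_eq_self volume (γ s))
  exact hmp.integrable_comp_of_integrable (hv1.mul_prod ha)

theorem integral_mul_integral_translate (hγ : Continuous γ) (hv : Measurable v) {B : ℝ}
    (hB : ∀ s, ‖v s‖ ≤ B) (ha : Integrable a) (hχ : Continuous χ) (hc : HasCompactSupport χ) :
    ∫ w, χ w * ∫ s in Ioc (0 : ℝ) 1, v s * a (γ s + w) =
      ∫ z, a z * ∫ s in Ioc (0 : ℝ) 1, v s * χ (z - γ s) := by
  obtain ⟨D, hD⟩ := hc.exists_bound_of_continuous hχ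
  have hv1 : Integrable v (volume.restrict (Ioc (0 : ℝ) 1)) :=
    Measure.integrableOn_of_bounded (M := B) (by simp) hv.aestronglyMeasurable
      (Eventually.of_forall hB)
  have h1 : Integrable (Function.uncurry fun (s : ℝ) (w : ℂ) => χ w * (v s * a (γ s + w)))
      ((volume.restrict (Ioc (0 : ℝ) 1)).prod volume) :=
    (integrable_prod_translate hγ hv hB ha).bdd_mul (c := D)
      (hχ.comp continuous_snd).aestronglyMeasurable (Eventually.of_forall fun x => hD _)
  have h2 : Integrable (Function.uncurry fun (s : ℝ) (z : ℂ) => χ (z - γ s) * (v s * a z))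
      ((volume.restrict (Ioc (0 : ℝ) 1)).prod volume) :=
    (hv1.mul_prod ha).bdd_mul (c := D)
      (hχ.comp (continuous_snd.sub (hγ.comp continuous_fst))).aestronglyMeasurable
      (Eventually.of_forall fun x => hD _)
  have e1 := integral_integral_swap h1
  have e2 := integral_integral_swap h2
  have e3 : ∀ s : ℝ, ∫ w, χ w * (v s * a (γ s + w)) = ∫ z, χ (z - γ s) * (v s * a z) := by
    intro s
    rw [← integral_add_left_eq_self (fun z => χ (z - γ s) * (v s * a z)) (γ s)]
    simp only [add_sub_cancel_left]
  simp only [← integral_const_mul]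
  rw [← e1]
  simp only [e3]
  rw [e2]
  refine integral_congr_ae (Eventually.of_forall fun z => integral_congr_ae
    (Eventually.of_forall fun s => ?_))
  simp only
  ring

end Translate

/-- Averaging the contour integrals against χ(w) gives -2i ∫ (a ∂̄N + b ∂N), where N is the
mollified winding number. By hypothesis this is -2πi c N(z') = -2πi c ∫χ. As χ is an arbitrary real
bump in the ball, the equality holds for almost every w. -/
theorem IsClosedPath.ae_integral_translate {γ v : ℝ → ℂ} (h : IsClosedPath γ v)
    {Ω Z : Set ℂ} (hZ : IsCompact Z) {r : ℝ} (hr : Metric.cthickening r Z ⊆ Ω)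
    (hwZ : ∀ z, winding γ v z ≠ 0 → z ∈ Z) (hγZ : γ '' Icc 0 1 ⊆ Z) {a b : ℂ → ℂ} {z' c : ℂ}
    (hw : ∀ z ∈ Metric.ball z' r, winding γ v z = 1) (hab : ReproducesAt Ω a b z' c) :
    ∀ᵐ w ∂(volume.restrict (Metric.ball (0 : ℂ) r)),
      IntegrableOn (fun s => v s * a (γ s + w)) (Ioc 0 1) ∧
      IntegrableOn (fun s => conj (v s) * b (γ s + w)) (Ioc 0 1) ∧
      (∫ s in Ioc (0 : ℝ) 1, v s * a (γ s + w)) - ∫ s in Ioc (0 : ℝ) 1, conj (v s) * b (γ s + w) =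
        -(2 * Real.pi * I * c) := by
  obtain ⟨B, hB⟩ := h.bounded
  have hB' : ∀ s, ‖conj (v s)‖ ≤ B := fun s => (Complex.norm_conj (v s)).trans_le (hB s)
  have hv' : Measurable fun s => conj (v s) := continuous_conj.measurable.comp h.measurable
  set T := Metric.cthickening r Z with hT_def
  have hT : IsCompact T := hZ.cthickening
  -- Cut off to the compact thickening T, the coefficients become integrable on ℂ; translates by |w|
  -- < r stay in T, so nothing changes on them.
  set a' := T.indicator a
  set b' := T.indicator b
  have ha' : Integrable a' :=
    (integrable_indicator_iff hT.measurableSet).2 (hab.integrableOn_left T hT hr)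
  have hb' : Integrable b' :=
    (integrable_indicator_iff hT.measurableSet).2 (hab.integrableOn_right T hT hr)
  have hmem : ∀ w ∈ Metric.ball (0 : ℂ) r, ∀ s ∈ Ioc (0 : ℝ) 1, γ s + w ∈ T := by
    intro w hw s hs
    refine Metric.mem_cthickening_of_dist_le _ (γ s) r Z (hγZ (mem_image hs)) ?_
    rw [dist_eq_norm, add_sub_cancel_left]
    exact (mem_ball_zero_iff.1 hw).le
  have pa := integrable_prod_translate h.continuous h.measurable hB ha'
  have pb := integrable_prod_translate h.continuous hv' hB' hb'
  set J : ℂ → ℂ := fun w => (∫ s in Ioc (0 : ℝ) 1, v s * a' (γ s + w)) -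
    ∫ s in Ioc (0 : ℝ) 1, conj (v s) * b' (γ s + w) with hJ
  have ia : Integrable fun w => ∫ s in Ioc (0 : ℝ) 1, v s * a' (γ s + w) := pa.integral_prod_right
  have ib : Integrable fun w => ∫ s in Ioc (0 : ℝ) 1, conj (v s) * b' (γ s + w) :=
    pb.integral_prod_right
  have hJi : Integrable J := ia.sub ib
  have hJL : ∀ᵐ w, w ∈ Metric.ball (0 : ℂ) r → J w + 2 * Real.pi * I * c = 0 := by
    refine Metric.isOpen_ball.ae_eq_zero_of_integral_contDiff_smul_eq_zero
      ((hJi.locallyIntegrable.add (locallyIntegrable_const _)).locallyIntegrableOn _)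
      fun g hg hgc hgr => ?_
    set χ : ℂ → ℂ := fun z => g z with hχ_def
    have hχ : ContDiff ℝ ∞ χ := ofRealCLM.contDiff.comp hg
    have hχc : HasCompactSupport χ := hgc.comp_left (g := fun x : ℝ => (x : ℂ)) rfl
    have hχr : tsupport χ ⊆ Metric.ball 0 r :=
      (closure_mono fun z => mt fun h0 => by simp [hχ_def, h0]).trans hgr
    have hn := h.isTestFunction_windingAverage hZ (subset_refl T) hwZ hχ hχc hχr
    have hbd : ∀ {f : ℂ → ℂ}, Integrable f → Integrable fun w => χ w * f w := fun hf => by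
      obtain ⟨D, hD⟩ := hχc.exists_bound_of_continuous hχ.continuous
      exact hf.bdd_mul (c := D) hχ.continuous.aestronglyMeasurable (Eventually.of_forall hD)
    have hχi : Integrable χ := hχ.continuous.integrable_of_hasCompactSupport hχc
    have e1 := integral_mul_integral_translate h.continuous h.measurable hB ha' hχ.continuous hχc
    have e2 := integral_mul_integral_translate h.continuous hv' hB' hb' hχ.continuous hχc
    have hI : (2 * I : ℂ) ≠ 0 := by simp
    have e3 : ∀ z, ∫ s in Ioc (0 : ℝ) 1, v s * χ (z - γ s) =
        -(2 * I) * dbar (windingAverage γ v χ) z := fun z => by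
      rw [h.dbar_windingAverage hχ hχc, neg_mul, neg_mul, mul_neg, neg_neg,
        mul_inv_cancel_left₀ hI]
    have e4 : ∀ z, ∫ s in Ioc (0 : ℝ) 1, conj (v s) * χ (z - γ s) =
        2 * I * del (windingAverage γ v χ) z := fun z => by
      rw [h.del_windingAverage hχ hχc, mul_inv_cancel_left₀ hI]
    simp only [e3] at e1
    simp only [e4] at e2
    have e5 := hab.integral_eq _ (hn.mono hr)
    rw [windingAverage_eq_integral hw hχr,
      setIntegral_eq_integral_of_forall_compl_eq_zero fun z hz => by
        rw [hn.dbar_eq_zero fun h => hz (hr h), hn.del_eq_zero fun h => hz (hr h), mul_zero,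
          mul_zero, add_zero]] at e5
    have e6 : ∀ z, a z * dbar (windingAverage γ v χ) z + b z * del (windingAverage γ v χ) z =
        a' z * dbar (windingAverage γ v χ) z + b' z * del (windingAverage γ v χ) z := by
      intro z
      by_cases hz : z ∈ T
      · simp only [a', b', indicator_of_mem hz]
      · rw [hn.dbar_eq_zero hz, hn.del_eq_zero hz, mul_zero, mul_zero, mul_zero, mul_zero]
    simp only [e6] at e5
    have j1 : Integrable fun z => a' z * dbar (windingAverage γ v χ) z :=
      integrable_mul_of_integrableOn hT ha'.integrableOn hn.continuous_dbar
        fun z => hn.dbar_eq_zero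
    have j2 : Integrable fun z => b' z * del (windingAverage γ v χ) z :=
      integrable_mul_of_integrableOn hT hb'.integrableOn hn.continuous_del
        fun z => hn.del_eq_zero
    rw [integral_add j1 j2] at e5
    have e7 : ∀ w, g w • (J w + 2 * Real.pi * I * c) =
        (χ w * ∫ s in Ioc (0 : ℝ) 1, v s * a' (γ s + w)) -
          (χ w * ∫ s in Ioc (0 : ℝ) 1, conj (v s) * b' (γ s + w)) +
          χ w * (2 * Real.pi * I * c) := by
      intro w
      rw [Complex.real_smul, hJ]
      ring
    refine (integral_congr_ae (Eventually.of_forall e7)).trans ?_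
    have j3 : Integrable fun w => (χ w * ∫ s in Ioc (0 : ℝ) 1, v s * a' (γ s + w)) -
        χ w * ∫ s in Ioc (0 : ℝ) 1, conj (v s) * b' (γ s + w) := (hbd ia).sub (hbd ib)
    rw [integral_add j3 (hχi.mul_const _), integral_sub (hbd ia) (hbd ib), e1, e2,
      integral_mul_const]
    have e8 : ∀ x y : ℂ, x * (-(2 * I) * y) = -(2 * I) * (x * y) := fun x y => by ring
    have e9 : ∀ x y : ℂ, x * (2 * I * y) = 2 * I * (x * y) := fun x y => by ring
    simp only [e8, e9]
    rw [integral_const_mul, integral_const_mul]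
    linear_combination (-(2 * I)) * e5
  rw [ae_restrict_iff' Metric.isOpen_ball.measurableSet]
  filter_upwards [hJL, pa.prod_left_ae, pb.prod_left_ae] with w h1 h2 h3 hwr
  have ea : EqOn (fun s => v s * a' (γ s + w)) (fun s => v s * a (γ s + w)) (Ioc 0 1) :=
    fun s hs => by simp only [a', indicator_of_mem (hmem w hwr s hs)]
  have eb : EqOn (fun s => conj (v s) * b' (γ s + w)) (fun s => conj (v s) * b (γ s + w))
      (Ioc 0 1) := fun s hs => by simp only [b', indicator_of_mem (hmem w hwr s hs)]
  refine ⟨IntegrableOn.congr_fun h2 ea measurableSet_Ioc,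
    IntegrableOn.congr_fun h3 eb measurableSet_Ioc, ?_⟩
  rw [← setIntegral_congr_fun measurableSet_Ioc ea, ← setIntegral_congr_fun measurableSet_Ioc eb]
  exact eq_neg_of_add_eq_zero_left (h1 hwr)

/-- The residue formula along almost every small translate of a path that surrounds `z'` once. -/
theorem SurroundsOnce.exists_ae_integral {Ω : Set ℂ} (hΩ : IsOpen Ω)
    (hbd : Bornology.IsBounded Ω) {γ : ℝ → ℂ} {z' : ℂ} (hγ : SurroundsOnce Ω γ z') :
    ∃ r : ℝ, 0 < r ∧ ∀ a b c, ReproducesAt Ω a b z' c →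
      ∀ᵐ w ∂(volume.restrict (Metric.ball (0 : ℂ) r)),
        IntervalIntegrable
          (fun s => a (γ s + w) * deriv γ s - b (γ s + w) * conj (deriv γ s)) volume 0 1 ∧
        ∫ s in (0 : ℝ)..1, (a (γ s + w) * deriv γ s - b (γ s + w) * conj (deriv γ s)) =
          -(2 * Real.pi * I * c) := by
  obtain ⟨C, hC⟩ := hγ.lipschitz
  obtain ⟨γ', v, h, hγγ', hv⟩ := exists_isClosedPath hC hγ.closed
  have himage : γ' '' Icc 0 1 = γ '' Icc 0 1 := hγγ'.image_eq
  have hwind : ∀ z, winding γ' v z = windingNumber γ z := by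
    intro z
    rw [winding, windingNumber, ← intervalIntegral.integral_of_le zero_le_one]
    congr 1
    refine intervalIntegral_congr_Ioo (Eventually.of_forall fun s hs => ?_)
    rw [hv s hs, hγγ' (Ioo_subset_Icc_self hs), div_eq_mul_inv]
  -- The trace together with all points of nonzero winding number. It is closed, and it lies in Ω
  -- because points outside Ω have winding number 0; as Ω is bounded, it is compact.
  set Z : Set ℂ := {z | winding γ' v z ≠ 0} ∪ γ' '' Icc 0 1
  have hZΩ : Z ⊆ Ω := by
    refine union_subset (fun z hz => ?_) ?_
    · by_contra hzΩ
      exact hz ((hwind z).trans (hγ.winding_outside z hzΩ))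
    · rw [himage]
      exact hγ.mapsTo.image_subset
  have hZ : IsCompact Z := Metric.isCompact_of_isClosed_isBounded h.isClosed_surrounded
    (hbd.subset hZΩ)
  obtain ⟨r₁, hr₁, hr₁Ω⟩ := hZ.exists_cthickening_subset_open hΩ hZΩ
  have hz' : z' ∉ γ' '' Icc 0 1 := by
    rw [himage]
    exact hγ.avoids
  obtain ⟨r₂, hr₂, hball⟩ := Metric.eventually_nhds_iff_ball.1 (h.eventually_winding_eq hz')
  -- Here r₁ keeps the thickening of Z inside Ω and r₂ keeps the winding number equal to 1 around
  -- z'. Neither depends on a, b, c, so one radius serves both components of ψ.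
  refine ⟨min r₁ r₂, lt_min hr₁ hr₂, fun a b c hab => ?_⟩
  have key := h.ae_integral_translate hZ
    ((Metric.cthickening_mono (min_le_left r₁ r₂) Z).trans hr₁Ω) (fun z hz => Or.inl hz)
    subset_union_right (fun z hz => (hball z (Metric.ball_subset_ball (min_le_right _ _) hz)).trans
      ((hwind z').trans hγ.winding_one)) hab
  filter_upwards [key] with w hw
  have heq : ∀ s ∈ Ioo (0 : ℝ) 1, v s * a (γ' s + w) - conj (v s) * b (γ' s + w) =
      a (γ s + w) * deriv γ s - b (γ s + w) * conj (deriv γ s) := fun s hs => by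
    rw [hv s hs, hγγ' (Ioo_subset_Icc_self hs)]
    ring
  constructor
  · rw [intervalIntegrable_iff_integrableOn_Ioo_of_le zero_le_one]
    exact IntegrableOn.congr_fun ((hw.1.sub hw.2.1).mono_set Ioo_subset_Ioc_self) heq
      measurableSet_Ioo
  · rw [← hw.2.2, ← integral_sub hw.1 hw.2.1, ← intervalIntegral.integral_of_le zero_le_one]
    exact (intervalIntegral_congr_Ioo (Eventually.of_forall heq)).symm

/-! ### Translation into matrix-valued differential forms -/

section Forms

variable {Ω : Set ℂ} {K : ℂ → ℂ → Matrix (Fin 2) (Fin 2) ℂ} {ψ : ℂ → Fin 2 → ℂ} {z' : ℂ}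
  {f : ℂ → Matrix (Fin 2) (Fin 2) ℂ}

theorem leftForm_apply (K : ℂ → ℂ → Matrix (Fin 2) (Fin 2) ℂ) (ψ : ℂ → Fin 2 → ℂ)
    (z' z v : ℂ) (i : Fin 2) : leftForm K ψ z' z v i =
      K z' z i 0 * ψ z 0 * v - K z' z i 1 * ψ z 1 * conj v := by
  rw [leftForm, mulVec_fin_two_apply]
  simp [Matrix.mulVec_diagonal]
  ring

theorem rightForm_eq_neg_leftForm (K : ℂ → ℂ → Matrix (Fin 2) (Fin 2) ℂ) (φ : ℂ → Fin 2 → ℂ)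
    (z' z v : ℂ) : rightForm K φ z' z v = -leftForm (fun z w => -(K w z)ᵀ) φ z' z v := by
  rw [rightForm, leftForm, Matrix.neg_mulVec, neg_neg, Matrix.mulVec_transpose]
  congr 1
  ext i
  simp [Matrix.mulVec_diagonal, Matrix.vecMul_diagonal, mul_comm]

theorem IsCutoff.isTestFunction (hf : IsCutoff Ω z' f) (i j : Fin 2) :
    IsTestFunction Ω (fun z => f z i j) := by
  have hsub : tsupport (fun z => f z i j) ⊆ tsupport f :=
    closure_mono fun z => mt fun h => by simp [h]
  exact ⟨hf.smooth i j, hf.compact.of_isClosed_subset (isClosed_tsupport _) hsub,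
    hsub.trans hf.support⟩

theorem IsCutoff.transpose (hf : IsCutoff Ω z' f) : IsCutoff Ω z' fun z => (f z)ᵀ := by
  have hsub : tsupport (fun z => (f z)ᵀ) ⊆ tsupport f :=
    closure_mono fun z => mt fun h => by simp [h]
  refine ⟨fun i j => hf.smooth j i, hf.compact.of_isClosed_subset (isClosed_tsupport _) hsub,
    hsub.trans hf.support, ?_⟩
  filter_upwards [hf.eq_one] with z hz
  rw [hz, Matrix.transpose_one]

/-- With respect to dx∧dy, df∧dz has density 2i ∂̄f and df∧(-dz̄) has density 2i ∂f. As f multiplies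
from the left, its entries act on different rows of K. -/
theorem dWedge_leftForm_apply (f : ℂ → Matrix (Fin 2) (Fin 2) ℂ) (z : ℂ) (i : Fin 2) :
    dWedge f (leftForm K ψ z') z i = 2 * I *
      ((K z' z 0 0 * ψ z 0 * dbar (fun x => f x i 0) z +
        K z' z 0 1 * ψ z 1 * del (fun x => f x i 0) z) +
      (K z' z 1 0 * ψ z 0 * dbar (fun x => f x i 1) z +
        K z' z 1 1 * ψ z 1 * del (fun x => f x i 1) z)) := by
  rw [dWedge, Pi.sub_apply, mulVec_fin_two_apply, mulVec_fin_two_apply]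
  simp only [leftForm_apply, matrixD, Matrix.of_apply, dbar, del, conj_I, map_one]
  ring_nf
  simp only [Complex.I_sq]
  ring

/-- Exchanging the two one-forms gives a sign that cancels the sign between right and left forms. -/
theorem wedgeD_rightForm (K : ℂ → ℂ → Matrix (Fin 2) (Fin 2) ℂ) (φ : ℂ → Fin 2 → ℂ)
    (f : ℂ → Matrix (Fin 2) (Fin 2) ℂ) : wedgeD (rightForm K φ z') f =
      dWedge (fun z => (f z)ᵀ) (leftForm (fun z w => -(K w z)ᵀ) φ z') := by
  funext z
  have hT : ∀ v, matrixD (fun z => (f z)ᵀ) z v = (matrixD f z v)ᵀ := fun v => rfl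
  rw [wedgeD, dWedge, rightForm_eq_neg_leftForm, rightForm_eq_neg_leftForm, hT, hT,
    Matrix.mulVec_transpose, Matrix.mulVec_transpose, Matrix.neg_vecMul, Matrix.neg_vecMul]
  abel

theorem hasContourIntegral_leftForm (hΩ : IsOpen Ω) (hbd : Bornology.IsBounded Ω)
    (h : ∀ i, ReproducesAt Ω (fun z => K z' z i 0 * ψ z 0) (fun z => K z' z i 1 * ψ z 1) z' (ψ z' i))
    {γ : ℝ → ℂ} (hγ : SurroundsOnce Ω γ z') :
    HasContourIntegral (leftForm K ψ z') γ (-((2 * Real.pi * I : ℂ) • ψ z')) := by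
  obtain ⟨r, hr, hrep⟩ := hγ.exists_ae_integral hΩ hbd
  refine ⟨r, hr, ?_⟩
  filter_upwards [ae_all_iff.2 fun i => hrep _ _ _ (h i)] with w hw
  have heq : ∀ i, (fun s => leftForm K ψ z' (γ s + w) (deriv γ s) i) = fun s =>
      K z' (γ s + w) i 0 * ψ (γ s + w) 0 * deriv γ s -
        K z' (γ s + w) i 1 * ψ (γ s + w) 1 * conj (deriv γ s) := fun i =>
    funext fun s => leftForm_apply K ψ z' _ _ i
  have hi : ∀ i, Integrable (fun s => leftForm K ψ z' (γ s + w) (deriv γ s) i)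
      (volume.restrict (Ioc (0 : ℝ) 1)) := fun i => by
    rw [heq i]
    exact (intervalIntegrable_iff_integrableOn_Ioc_of_le zero_le_one).1 (hw i).1
  refine ⟨(intervalIntegrable_iff_integrableOn_Ioc_of_le zero_le_one).2 (Integrable.of_eval hi), ?_⟩
  rw [intervalIntegral.integral_of_le zero_le_one]
  ext i
  rw [eval_integral hi, heq i, ← intervalIntegral.integral_of_le zero_le_one, (hw i).2]
  simp

/-- Each entry of f is a test function, so the reproducing identity applies entrywise; since f(z') =
1, the values recombine to ψ(z'). -/
theorem integrable_dWedge_leftForm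
    (h : ∀ i, ReproducesAt Ω (fun z => K z' z i 0 * ψ z 0) (fun z => K z' z i 1 * ψ z 1) z' (ψ z' i))
    (hf : IsCutoff Ω z' f) :
    Integrable (dWedge f (leftForm K ψ z')) (volume.restrict Ω) ∧
      ∫ z in Ω, dWedge f (leftForm K ψ z') z = (2 * Real.pi * I : ℂ) • ψ z' := by
  have hint : ∀ i j, IntegrableOn (fun z => K z' z j 0 * ψ z 0 * dbar (fun x => f x i j) z +
      K z' z j 1 * ψ z 1 * del (fun x => f x i j) z) Ω := fun i j => by
    have ht := hf.isTestFunction i j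
    exact ((integrable_mul_of_integrableOn ht.compact
        ((h j).integrableOn_left _ ht.compact ht.support) ht.continuous_dbar
        fun z => dbar_eq_zero_of_notMem_tsupport).add
      (integrable_mul_of_integrableOn ht.compact
        ((h j).integrableOn_right _ ht.compact ht.support) ht.continuous_del
        fun z => del_eq_zero_of_notMem_tsupport)).integrableOn
  have hi : ∀ i, Integrable (fun z => dWedge f (leftForm K ψ z') z i) (volume.restrict Ω) :=
    fun i => by
      simp only [dWedge_leftForm_apply]
      exact ((hint i 0).add (hint i 1)).const_mul _
  refine ⟨Integrable.of_eval hi, ?_⟩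
  ext i
  rw [eval_integral hi]
  simp only [dWedge_leftForm_apply]
  rw [integral_const_mul, integral_add (hint i 0) (hint i 1),
    (h 0).integral_eq _ (hf.isTestFunction i 0), (h 1).integral_eq _ (hf.isTestFunction i 1),
    hf.eq_one.self_of_nhds, Pi.smul_apply, smul_eq_mul]
  have h1 : (1 : Matrix (Fin 2) (Fin 2) ℂ) i 0 * ψ z' 0 +
      (1 : Matrix (Fin 2) (Fin 2) ℂ) i 1 * ψ z' 1 = ψ z' i := by
    rw [← mulVec_fin_two_apply, Matrix.one_mulVec]
  linear_combination (2 * I * Real.pi) * h1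

end Forms

/-! ### Assembling the theorem -/

section Main

variable {p : ℝ≥0∞} {Ω : Set ℂ} {U : ℂ → ℂ} {K : ℂ → ℂ → Matrix (Fin 2) (Fin 2) ℂ}

theorem MemKernelTransposed.memKernel {φ : ℂ → Fin 2 → ℂ} (hφ : MemKernelTransposed Ω U φ) :
    MemKernel Ω (fun z => conj (U z)) φ := by
  refine ⟨hφ.1, fun g hg => ?_⟩
  obtain ⟨h0, h1⟩ := hφ.2 g hg
  refine ⟨?_, ?_⟩
  · rw [← neg_eq_zero, ← integral_neg, ← h0]
    congr 1
    funext z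
    rw [Complex.conj_conj]
    ring
  · rw [← neg_eq_zero, ← integral_neg, ← h1]
    congr 1
    funext z
    ring

theorem SmallPotential.ae_reproducesAt (h : SmallPotential p Ω U) (hΩ : IsOpen Ω)
    (hK : IsInverseKernel p Ω U K) {ψ : ℂ → Fin 2 → ℂ} (hψ : MemKernel Ω U ψ) :
    ∀ᵐ z' ∂(volume.restrict Ω), ∀ i,
      ReproducesAt Ω (fun z => K z' z i 0 * ψ z 0) (fun z => K z' z i 1 * ψ z 1) z' (ψ z' i) := by
  obtain ⟨q, C, hpq, -⟩ := h.small
  exact hψ.ae_reproducesAt hpq hΩ h.volume_ne_top h.memLp h.onePlusBijective hK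

/-- ε = 1/(C+1) with C the Sobolev constant of p; the added 1 keeps ε finite also when C = 0. -/
theorem exists_smallPotential (hp1 : 1 < p) (hp2 : p < 2) :
    ∃ ε : ℝ≥0∞, 0 < ε ∧ ∀ (Ω : Set ℂ) (U : ℂ → ℂ), IsOpen Ω → Bornology.IsBounded Ω →
      MemLp U 2 (volume.restrict Ω) → eLpNorm U 2 (volume.restrict Ω) < ε →
      SmallPotential p Ω U := by
  have hpq := SobolevExponents.of_left hp1 hp2
  obtain ⟨C, hCt, hC⟩ := exists_eLpNorm_rieszOn_le hpq
  refine ⟨(C + 1)⁻¹, ENNReal.inv_pos.2 (by simp [hCt]), fun Ω U hΩ hbd hU hε =>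
    ⟨hΩ.measurableSet, hbd.measure_lt_top.ne, hU, _, C, hpq, hCt, hC, ?_⟩⟩
  rw [← one_div, ENNReal.lt_div_iff_mul_lt (by simp) (by simp [hCt]), mul_comm] at hε
  exact (mul_le_mul_left (self_le_add_right C 1) _).trans_lt hε

end Main

end QuaternionicCauchy

end

theorem mainTheorem11 (p : ℝ≥0∞) (hp1 : 1 < p) (hp2 : p < 2) :
    ∃ ε : ℝ≥0∞, 0 < ε ∧ ∀ (Ω : Set ℂ) (U : ℂ → ℂ),
      IsOpen Ω → Bornology.IsBounded Ω →
      MemLp U 2 (volume.restrict Ω) → eLpNorm U 2 (volume.restrict Ω) < ε →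
      QuaternionicCauchy.OnePlusBijective p Ω U ∧
      (∃ K : ℂ → ℂ → Matrix (Fin 2) (Fin 2) ℂ, QuaternionicCauchy.IsInverseKernel p Ω U K) ∧
      ∀ K : ℂ → ℂ → Matrix (Fin 2) (Fin 2) ℂ, QuaternionicCauchy.IsInverseKernel p Ω U K →
        (∀ ψ : ℂ → Fin 2 → ℂ, QuaternionicCauchy.MemKernel Ω U ψ →
          ∀ᵐ z' ∂(volume.restrict Ω),
            (∀ γ : ℝ → ℂ, QuaternionicCauchy.SurroundsOnce Ω γ z' →
              ∃ L : Fin 2 → ℂ,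
                QuaternionicCauchy.HasContourIntegral
                  (QuaternionicCauchy.leftForm K ψ z') γ L ∧
                ψ z' = (-1 / (2 * Real.pi * I) : ℂ) • L) ∧
            (∀ f : ℂ → Matrix (Fin 2) (Fin 2) ℂ, QuaternionicCauchy.IsCutoff Ω z' f →
              Integrable
                (QuaternionicCauchy.dWedge f (QuaternionicCauchy.leftForm K ψ z'))
                (volume.restrict Ω) ∧
              ψ z' = (1 / (2 * Real.pi * I) : ℂ) •
                ∫ z in Ω, QuaternionicCauchy.dWedge f
                  (QuaternionicCauchy.leftForm K ψ z') z)) ∧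
        (∀ φ : ℂ → Fin 2 → ℂ, QuaternionicCauchy.MemKernelTransposed Ω U φ →
          ∀ᵐ z' ∂(volume.restrict Ω),
            (∀ γ : ℝ → ℂ, QuaternionicCauchy.SurroundsOnce Ω γ z' →
              ∃ L : Fin 2 → ℂ,
                QuaternionicCauchy.HasContourIntegral
                  (QuaternionicCauchy.rightForm K φ z') γ L ∧
                φ z' = (1 / (2 * Real.pi * I) : ℂ) • L) ∧
            (∀ f : ℂ → Matrix (Fin 2) (Fin 2) ℂ, QuaternionicCauchy.IsCutoff Ω z' f →
              Integrable
                (QuaternionicCauchy.wedgeD (QuaternionicCauchy.rightForm K φ z') f)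
                (volume.restrict Ω) ∧
              φ z' = (1 / (2 * Real.pi * I) : ℂ) •
                ∫ z in Ω, QuaternionicCauchy.wedgeD
                  (QuaternionicCauchy.rightForm K φ z') f z)) := by
  obtain ⟨ε, hε, h⟩ := QuaternionicCauchy.exists_smallPotential hp1 hp2
  have hne : (2 * Real.pi * I : ℂ) ≠ 0 := by simp [Real.pi_ne_zero]
  refine ⟨ε, hε, fun Ω U hΩ hbd hU hUε => ?_⟩
  have hs := h Ω U hΩ hbd hU hUε
  refine ⟨hs.onePlusBijective, hs.exists_isInverseKernel, fun K hK => ⟨fun ψ hψ => ?_,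
    fun φ hφ => ?_⟩⟩
  · filter_upwards [hs.ae_reproducesAt hΩ hK hψ] with z' hz'
    refine ⟨fun γ hγ => ⟨_, QuaternionicCauchy.hasContourIntegral_leftForm hΩ hbd hz' hγ, ?_⟩,
      fun f hf => ?_⟩
    · rw [smul_neg, neg_div, neg_smul, neg_neg, smul_smul, one_div_mul_cancel hne, one_smul]
    · obtain ⟨h1, h2⟩ := QuaternionicCauchy.integrable_dWedge_leftForm hz' hf
      exact ⟨h1, by rw [h2, smul_smul, one_div_mul_cancel hne, one_smul]⟩
  -- The formulas for φ are those for ψ with potential Ū and kernel -K(w,z)ᵀ; the opposite sign of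
  -- the contour formula comes from passing between right and left forms.
  · filter_upwards [hs.conjugate.ae_reproducesAt hΩ (hs.isInverseKernel_transpose hK)
      hφ.memKernel] with z' hz'
    refine ⟨fun γ hγ => ⟨(2 * Real.pi * I : ℂ) • φ z', ?_, ?_⟩, fun f hf => ?_⟩
    · obtain ⟨r, hr, hw⟩ := QuaternionicCauchy.hasContourIntegral_leftForm
        (K := fun z w => -(K w z)ᵀ) hΩ hbd hz' hγ
      refine ⟨r, hr, ?_⟩
      filter_upwards [hw] with w hw
      simp only [QuaternionicCauchy.rightForm_eq_neg_leftForm]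
      exact ⟨hw.1.neg, by rw [intervalIntegral.integral_neg, hw.2, neg_neg]⟩
    · rw [smul_smul, one_div_mul_cancel hne, one_smul]
    · obtain ⟨h1, h2⟩ := QuaternionicCauchy.integrable_dWedge_leftForm
        (K := fun z w => -(K w z)ᵀ) hz' hf.transpose
      rw [QuaternionicCauchy.wedgeD_rightForm]
      exact ⟨h1, by rw [h2, smul_smul, one_div_mul_cancel hne, one_smul]⟩
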